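/- Let $n\ge 3$ be odd, $C=(n-1)/2$, and let $\zeta\in\mathbb C$ be a primitive $n$-th root of unity. Let $W=\langle r,s\mid r^n=s^2=e,\ srs^{-1}=r^{-1}\rangle$ be the dihedral group of order $2n$. It acts on $S=\mathbb C[X,Y]$ (with $\deg X=\deg Y=1$) by algebra automorphisms with $rX=\zeta X$, $rY=\zeta^{-1}Y$, $sX=Y$, $sY=X$. Let $A=S*W$ be the skew group algebra, that is, $S\otimes_{\mathbb C}\mathbb CW$ with $(p\otimes w)(p'\otimes w')=p\,w(p')\otimes ww'$, graded by $A_i=S_i\otimes\mathbb CW$. The irreducible complex representations of $W$ are $\mathrm{triv}$, $\mathrm{sgn}$ (where $r\mapsto 1$, $s\mapsto -1$) and $\chi_1,\dots,\chi_C$, where $\chi_k$ has a basis $b^+,b^-$ with $r b^{\pm}=\zeta^{\pm k}b^{\pm}$ and $s b^{\pm}=b^{\mp}$. Write $\mathrm{Irr}\,W$ for this set. Since $\chi_k\cong\chi_{n-k}$, the symbol $\chi_{C+1}$ below means $\chi_C$. For $\lambda\in\mathrm{Irr}\,W$ let $P_\lambda=S\otimes_{\mathbb C}\lambda$, with $(p\otimes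 w)(f\otimes v)=p\,w(f)\otimes wv$ and $(P_\lambda)_i=S_i\otimes\lambda$. Let $L_\lambda$ be the simple graded $A$-module equal to $\lambda$ in degree $0$, on which $S_{>0}$ acts by zero. For a finitely generated graded $A$-module $M$ put $[M:L_\mu]_q=\sum_{i\in\mathbb Z}q^i[M_i:\mu]\in\mathbb Z(\!(q)\!)$, where $[M_i:\mu]$ is the multiplicity of $\mu$ in the $W$-representation $M_i$. For $D\subseteq\mathrm{Irr}\,W$ put $$F_\lambda^{D}=P_\lambda\Big/\sum_{\mu\in D,\ d>0,\ f}\operatorname{im}f,$$ where $f$ runs over the $A$-module homomorphisms $P_\mu\to P_\lambda$ that are homogeneous of degree $d$. For a preorder $\precsim$ on $\mathrm{Irr}\,W$, the trace quotient modules of $\precsim$ are the graded modules $F_\lambda^{\{\mu\,:\,\lambda\precsim\mu\}}$ $(\lambda\in\mathrm{Irr}\,W)$. For a family $K=\{K_\lambda\}_{\lambda\in\mathrm{Irr}\,W}$ of finitely generated graded $A$-modules, let $\lambda\precsim_K\mu$ mean that there are $l\ge 0$ and a sequence $\lambda=\lambda_0,\lambda_1,\dots,\lambda_l=\mu$ in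 $\mathrm{Irr}\,W$ with $\operatorname{Ext}^1_A(K_{\lambda_{i-1}},L_{\lambda_i})\ne0$ for $1\le i\le l$. This is a preorder. Write $\lambda\sim_K\mu$ if $\lambda\precsim_K\mu$ and $\mu\precsim_K\lambda$. Suppose that, up to isomorphism of graded $A$-modules, $K$ is one of the following: 1. $K_{\mathrm{triv}}=F_{\mathrm{triv}}^{\{\chi_1\}}$, $K_{\mathrm{sgn}}=F_{\mathrm{sgn}}^{\{\chi_1\}}$, $K_{\chi_1}=F_{\chi_1}^{\{\mathrm{triv},\mathrm{sgn},\chi_2\}}$, and $K_{\chi_i}=F_{\chi_i}^{\{\chi_{i-1},\chi_{i+1}\}}$ for $2\le i\le C$; 2. $K_{\mathrm{triv}}=F_{\mathrm{triv}}^{\{\chi_1\}}$, $K_{\mathrm{sgn}}=F_{\mathrm{sgn}}^{\{\mathrm{sgn}\}}$, $K_{\chi_1}=F_{\chi_1}^{\{\mathrm{triv},\mathrm{sgn},\chi_2\}}$ or $F_{\chi_1}^{\{\mathrm{sgn},\chi_2\}}$, and, for each $i$ with $2\le i\le C$ independently, $K_{\chi_i}=F_{\chi_i}^{\{\chi_{i-1},\chi_{i+1}\}}$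 or $F_{\chi_i}^{\{\mathrm{sgn},\chi_{i+1}\}}$. Then: (a) for all $\lambda,\mu\in\mathrm{Irr}\,W$ with $\lambda\not\precsim_K\mu$ there are $\lambda'\sim_K\lambda$ and $\mu'\sim_K\mu$ with $[K_{\lambda'}:L_{\mu'}]_q\ne 0$; (b) $\precsim_K$ is the unique preorder on $\mathrm{Irr}\,W$ whose trace quotient modules are $K$: for a preorder $\precsim$ on $\mathrm{Irr}\,W$, one has $K_\lambda\cong F_\lambda^{\{\mu\,:\,\lambda\precsim\mu\}}$ as graded $A$-modules for all $\lambda$ if and only if $\precsim$ equals $\precsim_K$. -/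

import Mathlib

open scoped TensorProduct

namespace DihedralSpringer

noncomputable section

/-! ### Indices of the irreducible representations -/

/-- The index set of the irreducible complex representations of the dihedral group of order `2 n`
(`n` odd): `triv`, `sgn`, and `χ_i` for `1 ≤ i ≤ C = (n - 1) / 2`. -/
inductive Irr (n : ℕ) : Type
  | triv : Irr n
  | sgn : Irr n
  | chi (i : ℕ) (one_le : 1 ≤ i) (le_C : i ≤ (n - 1) / 2) : Irr n

/-- The dimension of an irreducible representation. -/
def Irr.dim {n : ℕ} : Irr n → ℕ
  | .triv => 1
  | .sgn => 1
  | .chi _ _ _ => 2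

/-- The index of the irreducible representation `χ_k ≅ χ_{n-k}` for `0 < k < n` and `n` odd. -/
def chiIdx {n : ℕ} (hn : Odd n) (k : ℕ) (h0 : 0 < k) (hk : k < n) : Irr n :=
  if h : k ≤ (n - 1) / 2 then .chi k h0 h
  else .chi (n - k) (by omega) (by obtain ⟨m, rfl⟩ := hn; omega)

/-! ### The dihedral group acting on polynomials

The group is `DihedralGroup n`, with `r i = r ^ i` and `sr i = s * r ^ i`. -/

/-- The complex number `ζ ^ i` for `i : ZMod n`, where `ζ ^ n = 1`. -/
def zpw {n : ℕ} (ζ : rootsOfUnity n ℂ) (i : ZMod n) : ℂ :=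
  (((ζ ^ (i.cast : ℤ) : rootsOfUnity n ℂ) : ℂˣ) : ℂ)

theorem zpw_intCast {n : ℕ} (ζ : rootsOfUnity n ℂ) (k : ℤ) :
    zpw ζ (k : ZMod n) = (((ζ ^ k : rootsOfUnity n ℂ) : ℂˣ) : ℂ) := by
  have h : ζ ^ (((k : ZMod n)).cast : ℤ) = ζ ^ k := by
    rw [zpow_eq_zpow_iff_modEq]
    have h1 : (((k : ZMod n).cast : ℤ)) ≡ k [ZMOD n] := by
      rw [← ZMod.intCast_eq_intCast_iff]
      simp
    refine h1.of_dvd ?_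
    have h2 : ζ ^ n = 1 := by
      ext
      have := ζ.2
      rw [mem_rootsOfUnity] at this
      simp [this]
    exact_mod_cast orderOf_dvd_of_pow_eq_one h2
  rw [zpw, h]

theorem zpw_zero {n : ℕ} (ζ : rootsOfUnity n ℂ) : zpw ζ 0 = 1 := by
  have := zpw_intCast ζ 0
  simpa using this

theorem zpw_add {n : ℕ} (ζ : rootsOfUnity n ℂ) (i j : ZMod n) :
    zpw ζ (i + j) = zpw ζ i * zpw ζ j := by
  obtain ⟨a, rfl⟩ := ZMod.intCast_surjective i
  obtain ⟨b, rfl⟩ := ZMod.intCast_surjective j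
  rw [← Int.cast_add, zpw_intCast, zpw_intCast, zpw_intCast, zpow_add]
  simp

/-- The polynomial ring `S = ℂ[X, Y]` with `X = X 0` and `Y = X 1`, on which the dihedral group
acts through `ζ`. -/
def Poly (n : ℕ) (_ζ : rootsOfUnity n ℂ) : Type := MvPolynomial (Fin 2) ℂ

variable {n : ℕ} {ζ : rootsOfUnity n ℂ}

instance : CommRing (Poly n ζ) := inferInstanceAs (CommRing (MvPolynomial (Fin 2) ℂ))

instance : Algebra ℂ (Poly n ζ) := inferInstanceAs (Algebra ℂ (MvPolynomial (Fin 2) ℂ))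

/-- The homogeneous polynomials of degree `d`. -/
def polyDeg (n : ℕ) (ζ : rootsOfUnity n ℂ) (d : ℕ) : Submodule ℂ (Poly n ζ) :=
  MvPolynomial.homogeneousSubmodule (Fin 2) ℂ d

theorem mem_iSup_homogeneousSubmodule (p : MvPolynomial (Fin 2) ℂ) :
    p ∈ ⨆ d, MvPolynomial.homogeneousSubmodule (Fin 2) ℂ d := by
  rw [← MvPolynomial.sum_homogeneousComponent p]
  exact Submodule.sum_mem _ fun d _ =>
    Submodule.mem_iSup_of_mem d (MvPolynomial.homogeneousComponent_mem d _)

theorem mem_iSup_polyDeg (p : Poly n ζ) : p ∈ ⨆ d, polyDeg n ζ d :=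
  mem_iSup_homogeneousSubmodule p

/-- The action of `g` on `S`: `r • X = ζ X`, `r • Y = ζ⁻¹ Y`, `s • X = Y`, `s • Y = X`. -/
def polyHom (ζ : rootsOfUnity n ℂ) :
    DihedralGroup n → (MvPolynomial (Fin 2) ℂ →ₐ[ℂ] MvPolynomial (Fin 2) ℂ)
  | .r i => MvPolynomial.aeval
      ![MvPolynomial.C (zpw ζ i) * MvPolynomial.X 0, MvPolynomial.C (zpw ζ (-i)) * MvPolynomial.X 1]
  | .sr i => MvPolynomial.aeval
      ![MvPolynomial.C (zpw ζ i) * MvPolynomial.X 1, MvPolynomial.C (zpw ζ (-i)) * MvPolynomial.X 0]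

theorem polyHom_one : polyHom ζ 1 = AlgHom.id ℂ _ := by
  rw [DihedralGroup.one_def]
  ext i
  fin_cases i <;> simp [polyHom, zpw_zero]

theorem polyHom_mul (g h : DihedralGroup n) :
    polyHom ζ (g * h) = (polyHom ζ g).comp (polyHom ζ h) := by
  apply MvPolynomial.algHom_ext
  intro i
  rcases g with a | a <;> rcases h with b | b <;> fin_cases i <;>
    simp [polyHom, ← mul_assoc, ← MvPolynomial.C_mul, ← zpw_add, sub_eq_add_neg,
      add_comm, MvPolynomial.algHom_C]

instance : MulSemiringAction (DihedralGroup n) (Poly n ζ) where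
  smul g p := polyHom ζ g p
  one_smul p := congrArg (fun f : MvPolynomial (Fin 2) ℂ →ₐ[ℂ] MvPolynomial (Fin 2) ℂ => f p)
    polyHom_one
  mul_smul g h p := congrArg
    (fun f : MvPolynomial (Fin 2) ℂ →ₐ[ℂ] MvPolynomial (Fin 2) ℂ => f p) (polyHom_mul g h)
  smul_zero g := map_zero (polyHom ζ g)
  smul_add g := map_add (polyHom ζ g)
  smul_one g := map_one (polyHom ζ g)
  smul_mul g := map_mul (polyHom ζ g)

instance : SMulCommClass (DihedralGroup n) ℂ (Poly n ζ) where
  smul_comm g c p := map_smul (polyHom ζ g) c p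

/-- The `ℂ`-linear representation of the dihedral group on `S`. -/
def polyRep (n : ℕ) (ζ : rootsOfUnity n ℂ) : Representation ℂ (DihedralGroup n) (Poly n ζ) where
  toFun g :=
    { toFun := fun p => g • p
      map_add' := smul_add g
      map_smul' := fun c p => smul_comm g c p }
  map_one' := by ext p; exact one_smul _ p
  map_mul' g h := by ext p; exact mul_smul g h p

theorem polyHom_isHomogeneous (g : DihedralGroup n) {d : ℕ} {p : MvPolynomial (Fin 2) ℂ}
    (hp : p.IsHomogeneous d) : (polyHom ζ g p).IsHomogeneous d := by
  have key : ∀ φ : Fin 2 → MvPolynomial (Fin 2) ℂ, (∀ i, (φ i).IsHomogeneous 1) →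
      (MvPolynomial.aeval φ p).IsHomogeneous d := by
    intro φ hφ
    have := hp.aeval φ hφ
    simpa using this
  rcases g with i | i <;> refine key _ fun k => ?_ <;> fin_cases k <;>
    simpa using ((MvPolynomial.isHomogeneous_C (Fin 2) _).mul (MvPolynomial.isHomogeneous_X ℂ _))

theorem smul_mem_polyDeg (g : DihedralGroup n) {d : ℕ} {p : Poly n ζ} (hp : p ∈ polyDeg n ζ d) :
    g • p ∈ polyDeg n ζ d :=
  (MvPolynomial.mem_homogeneousSubmodule d _).2
    (polyHom_isHomogeneous g ((MvPolynomial.mem_homogeneousSubmodule d _).1 hp))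

/-- The skew group algebra `A = S * W`, with `(s ⊗ w) (s' ⊗ w') = s w(s') ⊗ w w'`; the element
`s ⊗ w` is `SkewMonoidAlgebra.single w s`. -/
abbrev SkewAlg (n : ℕ) (ζ : rootsOfUnity n ℂ) : Type :=
  SkewMonoidAlgebra (Poly n ζ) (DihedralGroup n)

/-- The homogeneous part `A_d = S_d ⊗ ℂW` of degree `d`; it is zero in negative degrees. -/
def algDeg (n : ℕ) (ζ : rootsOfUnity n ℂ) (d : ℕ) : Submodule ℂ (SkewAlg n ζ) where
  carrier := {a | ∀ g, a.coeff g ∈ polyDeg n ζ d}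
  add_mem' ha hb g := by
    simpa using (polyDeg n ζ d).add_mem (ha g) (hb g)
  zero_mem' g := by simp
  smul_mem' c a ha g := by
    simpa using (polyDeg n ζ d).smul_mem c (ha g)

/-! ### Irreducible representations -/

/-- The two-dimensional representation `χ_k` on `ℂ b⁺ ⊕ ℂ b⁻`, for `k : ZMod n`:
`r b^± = ζ^{± k} b^±` and `s b^± = b^∓`. Coordinate `0` is that of `b⁺`. -/
def chiFun (ζ : rootsOfUnity n ℂ) (k : ZMod n) : DihedralGroup n → Matrix (Fin 2) (Fin 2) ℂ
  | .r i => !![zpw ζ (k * i), 0; 0, zpw ζ (-(k * i))]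
  | .sr i => !![0, zpw ζ (-(k * i)); zpw ζ (k * i), 0]

/-- The representation `χ_k`. -/
def chiRep (ζ : rootsOfUnity n ℂ) (k : ZMod n) :
    Representation ℂ (DihedralGroup n) (Fin 2 → ℂ) where
  toFun g := Matrix.toLin' (chiFun ζ k g)
  map_one' := by
    rw [DihedralGroup.one_def]
    simp [chiFun, zpw_zero, ← Matrix.one_fin_two]
    rfl
  map_mul' g h := by
    rw [Module.End.mul_eq_comp, ← Matrix.toLin'_mul]
    congr 1
    rcases g with a | a <;> rcases h with b | b <;>
      simp [chiFun, ← zpw_add, sub_eq_add_neg, mul_add, add_comm]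

/-- The trivial representation. -/
def trivRep (n : ℕ) : Representation ℂ (DihedralGroup n) (Fin 1 → ℂ) := 1

/-- The sign representation: `r` acts by `1` and `s` by `-1`. -/
def sgnRep (n : ℕ) : Representation ℂ (DihedralGroup n) (Fin 1 → ℂ) where
  toFun
    | .r _ => 1
    | .sr _ => -1
  map_one' := rfl
  map_mul' g h := by
    rcases g with a | a <;> rcases h with b | b <;> ext <;> simp

/-- The irreducible representation with index `l`. -/
def Irr.rep (ζ : rootsOfUnity n ℂ) :
    (l : Irr n) → Representation ℂ (DihedralGroup n) (Fin l.dim → ℂ)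
  | .triv => trivRep n
  | .sgn => sgnRep n
  | .chi i _ _ => chiRep ζ (i : ZMod n)

/-! ### Graded modules -/

/-- A finitely generated `ℤ`-graded left module over `A = S * W`. -/
structure GrMod (n : ℕ) (ζ : rootsOfUnity n ℂ) where
  carrier : Type
  [addCommGroup : AddCommGroup carrier]
  [moduleC : Module ℂ carrier]
  [moduleA : Module (SkewAlg n ζ) carrier]
  [tower : IsScalarTower ℂ (SkewAlg n ζ) carrier]
  [finite : Module.Finite (SkewAlg n ζ) carrier]
  /-- the homogeneous part of degree `i` -/
  gr : ℤ → Submodule ℂ carrier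
  isInternal : DirectSum.IsInternal gr
  smul_mem : ∀ (d : ℕ) (i : ℤ) (a : SkewAlg n ζ) (m : carrier),
    a ∈ algDeg n ζ d → m ∈ gr i → a • m ∈ gr (i + d)

namespace GrMod

attribute [instance] addCommGroup moduleC moduleA tower finite

/-- `f` is homogeneous of degree `d`: it maps `M_i` into `N_{i+d}`. -/
def IsHomDeg {M N : GrMod n ζ} (d : ℤ) (f : M.carrier →ₗ[SkewAlg n ζ] N.carrier) : Prop :=
  ∀ i, ∀ m ∈ M.gr i, f m ∈ N.gr (i + d)

/-- Isomorphism of graded modules, by a module isomorphism that respects the gradings. -/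
def Iso (M N : GrMod n ζ) : Prop :=
  ∃ e : M.carrier ≃ₗ[SkewAlg n ζ] N.carrier, ∀ i m, m ∈ M.gr i ↔ e m ∈ N.gr i

/-- The projection of `M` onto its homogeneous part of degree `i`. -/
def proj (M : GrMod n ζ) (i : ℤ) : M.carrier →ₗ[ℂ] M.carrier :=
  (M.gr i).subtype ∘ₗ DirectSum.component ℂ ℤ (fun i => M.gr i) i ∘ₗ
    (LinearEquiv.ofBijective (DirectSum.coeLinearMap M.gr) M.isInternal).symm.toLinearMap

theorem proj_of_mem (M : GrMod n ζ) {i : ℤ} {m : M.carrier} (h : m ∈ M.gr i) :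
    M.proj i m = m := by
  have := M.isInternal.ofBijective_coeLinearMap_of_mem h
  exact congrArg Subtype.val this

theorem proj_of_mem_ne (M : GrMod n ζ) {i j : ℤ} (hij : j ≠ i) {m : M.carrier}
    (h : m ∈ M.gr j) : M.proj i m = 0 := by
  have := M.isInternal.ofBijective_coeLinearMap_of_mem_ne hij h
  exact congrArg Subtype.val this

theorem induction {M : GrMod n ζ} {p : M.carrier → Prop} (h : ∀ i, ∀ m ∈ M.gr i, p m)
    (h0 : p 0) (hadd : ∀ x y, p x → p y → p (x + y)) (m : M.carrier) : p m := by
  have hm : m ∈ ⨆ i, M.gr i := by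
    rw [M.isInternal.submodule_iSup_eq_top]; trivial
  exact Submodule.iSup_induction _ (motive := p) hm h h0 hadd

theorem proj_map {M N : GrMod n ζ} {d : ℤ} {f : M.carrier →ₗ[SkewAlg n ζ] N.carrier}
    (hf : IsHomDeg d f) (i : ℤ) (m : M.carrier) : N.proj i (f m) = f (M.proj (i - d) m) := by
  induction m using GrMod.induction with
  | h j m hm =>
    by_cases hij : j = i - d
    · subst hij
      rw [M.proj_of_mem hm, N.proj_of_mem]
      simpa using hf _ _ hm
    · rw [M.proj_of_mem_ne hij hm, map_zero, N.proj_of_mem_ne _ (hf _ _ hm)]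
      omega
  | h0 => simp
  | hadd x y hx hy => simp [hx, hy]

/-- The quotient of a graded module by a submodule which contains the homogeneous components of
its elements, with the homogeneous parts `image of M_i`. -/
def quot (M : GrMod n ζ) (I : Submodule (SkewAlg n ζ) M.carrier)
    (hI : ∀ m ∈ I, ∀ i, M.proj i m ∈ I) : GrMod n ζ where
  carrier := M.carrier ⧸ I
  gr i := (M.gr i).map (I.mkQ.restrictScalars ℂ)
  isInternal := by
    rw [DirectSum.isInternal_submodule_iff_iSupIndep_and_iSup_eq_top]
    constructor
    · rw [iSupIndep_def]
      intro i
      rw [Submodule.disjoint_def]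
      rintro _ ⟨m, hm, rfl⟩ h
      simp only [← Submodule.map_iSup] at h
      obtain ⟨m', hm', h⟩ := h
      have h1 : m - m' ∈ I := by
        rw [← Submodule.Quotient.eq]
        exact h.symm
      have h2 : M.proj i m' = 0 := by
        have : (⨆ j, ⨆ (_ : j ≠ i), M.gr j) ≤ LinearMap.ker (M.proj i) :=
          iSup₂_le fun j hj x hx => M.proj_of_mem_ne hj hx
        exact this hm'
      have h3 := hI _ h1 i
      rw [map_sub, h2, sub_zero, M.proj_of_mem hm] at h3
      exact (Submodule.Quotient.mk_eq_zero I).2 h3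
    · rw [← Submodule.map_iSup, M.isInternal.submodule_iSup_eq_top, Submodule.map_top,
        LinearMap.range_eq_top]
      exact I.mkQ_surjective
  smul_mem := by
    rintro d i a _ ha ⟨m, hm, rfl⟩
    exact ⟨a • m, M.smul_mem d i a m ha hm, by simp⟩

/-! #### Multiplicities -/

theorem single_mem_algDeg (g : DihedralGroup n) {d : ℕ} {p : Poly n ζ} (hp : p ∈ polyDeg n ζ d) :
    (SkewMonoidAlgebra.single g p : SkewAlg n ζ) ∈ algDeg n ζ d := by
  classical
  intro h
  rw [SkewMonoidAlgebra.coeff_single_apply]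
  split_ifs
  · exact hp
  · exact zero_mem _

theorem one_mem_polyDeg : (1 : Poly n ζ) ∈ polyDeg n ζ 0 :=
  (MvPolynomial.mem_homogeneousSubmodule 0 _).2 (MvPolynomial.isHomogeneous_one (Fin 2) ℂ)

/-- The representation of the dihedral group on the homogeneous part `M_i`, through
`w ↦ 1 ⊗ w ∈ A_0`. -/
def grRep (M : GrMod n ζ) (i : ℤ) : Representation ℂ (DihedralGroup n) (M.gr i) where
  toFun w := (Algebra.lsmul ℂ ℂ M.carrier (SkewMonoidAlgebra.single w 1 : SkewAlg n ζ)).restrict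
    (fun m hm => by
      have := M.smul_mem 0 i _ m (single_mem_algDeg w one_mem_polyDeg) hm
      simpa using this)
  map_one' := by
    ext m
    simp
  map_mul' g h := by
    ext m
    simp [← mul_smul, SkewMonoidAlgebra.single_mul_single]

/-- The multiplicity `[M_i : l]` of an irreducible representation in `M_i`, which is the dimension
of the space of equivariant maps from it to `M_i`. -/
def mult (M : GrMod n ζ) (i : ℤ) (l : Irr n) : ℕ :=
  Module.finrank ℂ (Representation.IntertwiningMap (l.rep ζ) (M.grRep i))

theorem mem_iSup_algDeg (a : SkewAlg n ζ) : a ∈ ⨆ d, algDeg n ζ d := by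
  induction a using SkewMonoidAlgebra.induction_on with
  | zero => exact zero_mem _
  | single g p =>
    refine Submodule.iSup_induction _
      (motive := fun p : Poly n ζ =>
        (SkewMonoidAlgebra.single g p : SkewAlg n ζ) ∈ ⨆ d, algDeg n ζ d) (mem_iSup_polyDeg p)
      ?_ ?_ ?_
    · intro d p hp
      exact Submodule.mem_iSup_of_mem d (single_mem_algDeg g hp)
    · simp
    · intro p q hp hq
      rw [SkewMonoidAlgebra.single_add]
      exact add_mem hp hq
  | add a b ha hb => exact add_mem ha hb

theorem exists_lower_bound (M : GrMod n ζ) : ∃ d₀ : ℤ, ∀ i < d₀, M.gr i = ⊥ := by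
  let G : ℤ → Submodule ℂ M.carrier := fun d => ⨆ i, ⨆ (_ : d ≤ i), M.gr i
  have hG : ∀ {d d'}, d' ≤ d → G d ≤ G d' := fun {d d'} h =>
    iSup₂_le fun i hi => le_iSup₂_of_le i (h.trans hi) le_rfl
  have hsmul : ∀ d (a : SkewAlg n ζ), ∀ m ∈ G d, a • m ∈ G d := by
    intro d a m hm
    refine Submodule.iSup_induction _ (motive := fun a : SkewAlg n ζ => a • m ∈ G d)
      (mem_iSup_algDeg a) ?_ ?_ ?_
    · intro k a ha
      have : G d ≤ (G d).comap (Algebra.lsmul ℂ ℂ M.carrier a) :=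
        iSup₂_le fun i hi x hx => by
          have h1 := M.smul_mem k i a x ha hx
          exact Submodule.mem_iSup_of_mem (i + k)
            (Submodule.mem_iSup_of_mem (by omega) h1)
      exact this hm
    · simp
    · intro a b ha hb
      rw [add_smul]
      exact add_mem ha hb
  have hex : ∀ m : M.carrier, ∃ d, m ∈ G d := by
    intro m
    induction m using GrMod.induction with
    | h i m hm => exact ⟨i, Submodule.mem_iSup_of_mem i (Submodule.mem_iSup_of_mem le_rfl hm)⟩
    | h0 => exact ⟨0, zero_mem _⟩
    | hadd x y hx hy =>
      obtain ⟨d, hd⟩ := hx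
      obtain ⟨d', hd'⟩ := hy
      exact ⟨min d d', add_mem (hG (min_le_left _ _) hd) (hG (min_le_right _ _) hd')⟩
  have hfin : ∀ s : Finset M.carrier, ∃ d, ∀ m ∈ s, m ∈ G d := by
    classical
    intro s
    induction s using Finset.induction_on with
    | empty => exact ⟨0, by simp⟩
    | insert a s _ ih =>
      obtain ⟨d, hd⟩ := ih
      obtain ⟨d', hd'⟩ := hex a
      refine ⟨min d d', fun m hm => ?_⟩
      rcases Finset.mem_insert.1 hm with rfl | hm
      · exact hG (min_le_right _ _) hd'
      · exact hG (min_le_left _ _) (hd m hm)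
  obtain ⟨s, hs⟩ := (Module.Finite.fg_top : (⊤ : Submodule (SkewAlg n ζ) M.carrier).FG)
  obtain ⟨d, hd⟩ := hfin s
  refine ⟨d, fun i hi => (Submodule.eq_bot_iff _).2 fun m hm => ?_⟩
  have hmG : ∀ x, x ∈ G d := by
    intro x
    have : x ∈ Submodule.span (SkewAlg n ζ) (s : Set M.carrier) := by rw [hs]; trivial
    induction this using Submodule.span_induction with
    | mem x hx => exact hd x hx
    | zero => exact zero_mem _
    | add x y _ _ hx hy => exact add_mem hx hy
    | smul a x _ hx => exact hsmul d a x hx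
  have h0 : M.proj i m = 0 := by
    have : G d ≤ LinearMap.ker (M.proj i) :=
      iSup₂_le fun j hj x hx => M.proj_of_mem_ne (by omega) hx
    exact this (hmG m)
  rwa [M.proj_of_mem hm] at h0

theorem bddBelow_support_mult (M : GrMod n ζ) (l : Irr n) :
    BddBelow (Function.support fun i => (M.mult i l : ℤ)) := by
  obtain ⟨d, hd⟩ := M.exists_lower_bound
  refine ⟨d, fun i hi => ?_⟩
  by_contra! h
  apply hi
  have : Subsingleton (M.gr i) := by rw [hd i h]; infer_instance
  have : Subsingleton (Representation.IntertwiningMap (l.rep ζ) (M.grRep i)) :=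
    ⟨fun f g => by ext v; exact congrArg _ (Subsingleton.elim _ _)⟩
  simp [mult, Module.finrank_zero_of_subsingleton]

/-- The graded multiplicity `[M : L_l]_q = ∑ i, q ^ i [M_i : l]`, a formal Laurent series. -/
def gradedMult (M : GrMod n ζ) (l : Irr n) : LaurentSeries ℤ :=
  HahnSeries.ofSuppBddBelow (fun i => (M.mult i l : ℤ)) (M.bddBelow_support_mult l)

end GrMod

/-! ### The projective modules `P_l` and the simple modules `L_l` -/

/-- The part of `S` of degree `i`, for an integer `i`. -/
def polyDegZ (n : ℕ) (ζ : rootsOfUnity n ℂ) : ℤ → Submodule ℂ (Poly n ζ)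
  | .ofNat d => polyDeg n ζ d
  | .negSucc _ => ⊥

/-- The projection of `S` onto its part of degree `i`. -/
def polyProj (n : ℕ) (ζ : rootsOfUnity n ℂ) : ℤ → (Poly n ζ →ₗ[ℂ] Poly n ζ)
  | .ofNat d => (MvPolynomial.homogeneousComponent d :
      MvPolynomial (Fin 2) ℂ →ₗ[ℂ] MvPolynomial (Fin 2) ℂ)
  | .negSucc _ => 0

theorem polyProj_mem (i : ℤ) (p : Poly n ζ) : polyProj n ζ i p ∈ polyDegZ n ζ i := by
  cases i with
  | ofNat d => exact MvPolynomial.homogeneousComponent_mem d _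
  | negSucc d => exact zero_mem _

theorem polyProj_of_mem {i : ℤ} {p : Poly n ζ} (h : p ∈ polyDegZ n ζ i) :
    polyProj n ζ i p = p := by
  cases i with
  | ofNat d => exact (MvPolynomial.homogeneousComponent_of_mem h).trans (if_pos rfl)
  | negSucc d => exact ((Submodule.mem_bot ℂ).1 h).symm

theorem polyProj_of_mem_ne {i j : ℤ} (hij : i ≠ j) {p : Poly n ζ} (h : p ∈ polyDegZ n ζ j) :
    polyProj n ζ i p = 0 := by
  cases i with
  | negSucc d => rfl
  | ofNat d =>
    cases j with
    | negSucc e => rw [(Submodule.mem_bot ℂ).1 h, map_zero]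
    | ofNat e =>
      exact (MvPolynomial.homogeneousComponent_of_mem h).trans
        (if_neg fun h => hij (by rw [h]))

theorem smul_mem_polyDegZ (g : DihedralGroup n) {i : ℤ} {p : Poly n ζ}
    (hp : p ∈ polyDegZ n ζ i) : g • p ∈ polyDegZ n ζ i := by
  cases i with
  | ofNat d => exact smul_mem_polyDeg g hp
  | negSucc d => rw [(Submodule.mem_bot ℂ).1 hp, smul_zero]; exact zero_mem _

theorem mul_mem_polyDegZ {d : ℕ} {i : ℤ} {p q : Poly n ζ} (hp : p ∈ polyDeg n ζ d)
    (hq : q ∈ polyDegZ n ζ i) : p * q ∈ polyDegZ n ζ (i + d) := by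
  cases i with
  | ofNat e =>
    have h : (Int.ofNat e + d : ℤ) = Int.ofNat (d + e) := by simp [add_comm]
    rw [h]
    exact (MvPolynomial.mem_homogeneousSubmodule _ _).2
      (((MvPolynomial.mem_homogeneousSubmodule _ _).1 hp).mul
        ((MvPolynomial.mem_homogeneousSubmodule _ _).1 hq))
  | negSucc e => rw [(Submodule.mem_bot ℂ).1 hq, mul_zero]; exact zero_mem _

/-- The homogeneous part `S_i ⊗ V` of `S ⊗ V`. -/
def tensorDeg (n : ℕ) (ζ : rootsOfUnity n ℂ) (V : Type) [AddCommGroup V] [Module ℂ V] (i : ℤ) :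
    Submodule ℂ (Poly n ζ ⊗[ℂ] V) :=
  LinearMap.range ((polyDegZ n ζ i).subtype.rTensor V)

section

variable {V : Type} [AddCommGroup V] [Module ℂ V]

theorem tmul_mem_tensorDeg {i : ℤ} {p : Poly n ζ} (hp : p ∈ polyDegZ n ζ i) (v : V) :
    p ⊗ₜ[ℂ] v ∈ tensorDeg n ζ V i :=
  ⟨(⟨p, hp⟩ : polyDegZ n ζ i) ⊗ₜ v, by simp⟩

theorem tensorDeg_induction {i : ℤ} {p : Poly n ζ ⊗[ℂ] V → Prop}
    (h : ∀ s ∈ polyDegZ n ζ i, ∀ v : V, p (s ⊗ₜ v)) (h0 : p 0)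
    (hadd : ∀ x y, p x → p y → p (x + y)) (m : Poly n ζ ⊗[ℂ] V) (hm : m ∈ tensorDeg n ζ V i) :
    p m := by
  obtain ⟨x, rfl⟩ := hm
  induction x with
  | zero => simpa using h0
  | tmul s v => simpa using h s s.2 v
  | add x y hx hy => rw [map_add]; exact hadd _ _ hx hy

theorem tensorDeg_isInternal : DirectSum.IsInternal (tensorDeg n ζ V) := by
  rw [DirectSum.isInternal_submodule_iff_iSupIndep_and_iSup_eq_top]
  constructor
  · rw [iSupIndep_def]
    intro i
    rw [Submodule.disjoint_def]
    intro x hx hx'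
    have h1 : (polyProj n ζ i).rTensor V x = x := by
      refine tensorDeg_induction (p := fun x => (polyProj n ζ i).rTensor V x = x) ?_ ?_ ?_ x hx
      · intro s hs v
        simp [polyProj_of_mem hs]
      · simp
      · intro x y hx hy
        rw [map_add, hx, hy]
    have h2 : (⨆ j, ⨆ (_ : j ≠ i), tensorDeg n ζ V j) ≤
        LinearMap.ker ((polyProj n ζ i).rTensor V) := by
      refine iSup₂_le fun j hj x hx => ?_
      refine tensorDeg_induction (p := fun x => (polyProj n ζ i).rTensor V x = 0) ?_ ?_ ?_ x hx
      · intro s hs v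
        simp [polyProj_of_mem_ne hj.symm hs]
      · simp
      · intro x y hx hy
        rw [map_add, hx, hy, add_zero]
    rw [← h1]
    exact h2 hx'
  · rw [eq_top_iff]
    intro x _
    induction x with
    | zero => exact zero_mem _
    | add x y hx hy => exact add_mem (hx trivial) (hy trivial)
    | tmul s v =>
      refine Submodule.iSup_induction _
        (motive := fun s : Poly n ζ => s ⊗ₜ[ℂ] v ∈ ⨆ i, tensorDeg n ζ V i) (mem_iSup_polyDeg s)
        ?_ ?_ ?_
      · intro d p hp
        exact Submodule.mem_iSup_of_mem (Int.ofNat d) (tmul_mem_tensorDeg hp v)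
      · simp
      · intro p q hp hq
        rw [TensorProduct.add_tmul]
        exact add_mem hp hq

/-- Multiplication by polynomials on the first factor of `S ⊗ V`. -/
def tensorMul (n : ℕ) (ζ : rootsOfUnity n ℂ) (V : Type) [AddCommGroup V] [Module ℂ V] :
    Poly n ζ →ₐ[ℂ] Module.End ℂ (Poly n ζ ⊗[ℂ] V) :=
  (Module.End.rTensorAlgHom ℂ (Poly n ζ) V).comp (Algebra.lmul ℂ (Poly n ζ))

theorem tensorMul_tmul (p q : Poly n ζ) (v : V) :
    tensorMul n ζ V p (q ⊗ₜ v) = (p * q) ⊗ₜ v := rfl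

theorem tprod_tmul (ρ : Representation ℂ (DihedralGroup n) V) (g : DihedralGroup n)
    (q : Poly n ζ) (v : V) :
    ((polyRep n ζ).tprod ρ) g (q ⊗ₜ v) = (g • q) ⊗ₜ ρ g v := rfl

/-- The action of `A` on `S ⊗ V`: `(s ⊗ w) (p ⊗ v) = s w(p) ⊗ w v`. -/
def tensorAct (ρ : Representation ℂ (DihedralGroup n) V) :
    SkewAlg n ζ →ₐ[ℂ] Module.End ℂ (Poly n ζ ⊗[ℂ] V) :=
  SkewMonoidAlgebra.liftNCAlgHom (tensorMul n ζ V) ((polyRep n ζ).tprod ρ) (by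
    intro p g
    refine TensorProduct.ext' fun q v => ?_
    simp only [Module.End.mul_apply, tensorMul_tmul, tprod_tmul, smul_mul'])

theorem tensorAct_single (ρ : Representation ℂ (DihedralGroup n) V) (g : DihedralGroup n)
    (p q : Poly n ζ) (v : V) :
    tensorAct (ζ := ζ) ρ (SkewMonoidAlgebra.single g p) (q ⊗ₜ v) = (p * g • q) ⊗ₜ ρ g v := by
  have : tensorAct (ζ := ζ) ρ (SkewMonoidAlgebra.single g p) =
      tensorMul n ζ V p * (polyRep n ζ).tprod ρ g :=
    SkewMonoidAlgebra.liftNC_single _ _ _ _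
  rw [this, Module.End.mul_apply, tprod_tmul, tensorMul_tmul]

/-- The constant term of a polynomial. -/
def polyConst (n : ℕ) (ζ : rootsOfUnity n ℂ) : Poly n ζ →ₐ[ℂ] ℂ :=
  (MvPolynomial.aeval (fun _ => 0) : MvPolynomial (Fin 2) ℂ →ₐ[ℂ] ℂ)

theorem polyConst_smul (g : DihedralGroup n) (p : Poly n ζ) :
    polyConst n ζ (g • p) = polyConst n ζ p := by
  have : ((MvPolynomial.aeval (fun _ => 0) : MvPolynomial (Fin 2) ℂ →ₐ[ℂ] ℂ).comp (polyHom ζ g)) =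
      MvPolynomial.aeval (fun _ => 0) := by
    apply MvPolynomial.algHom_ext
    intro i
    rcases g with a | a <;> fin_cases i <;> simp [polyHom]
  exact congrArg (fun f : MvPolynomial (Fin 2) ℂ →ₐ[ℂ] ℂ => f p) this

theorem polyConst_of_mem {d : ℕ} (hd : d ≠ 0) {p : Poly n ζ} (hp : p ∈ polyDeg n ζ d) :
    polyConst n ζ p = 0 := by
  have h := (MvPolynomial.mem_homogeneousSubmodule _ _).1 hp
  have h1 := h.coeff_eq_zero (d := 0) (by simpa using hd.symm)
  have h2 : polyConst n ζ p = MvPolynomial.constantCoeff (p : MvPolynomial (Fin 2) ℂ) := by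
    exact MvPolynomial.aeval_zero' _
  rw [h2]
  exact h1

/-- The action of `A` on a representation `V` for which polynomials act through their constant
term: `(s ⊗ w) v = s(0) w v`. -/
def constAct (ρ : Representation ℂ (DihedralGroup n) V) :
    SkewAlg n ζ →ₐ[ℂ] Module.End ℂ V :=
  SkewMonoidAlgebra.liftNCAlgHom
    ((Algebra.ofId ℂ (Module.End ℂ V)).comp (polyConst n ζ)) ρ (by
    intro p g
    simp only [AlgHom.comp_apply, polyConst_smul, Algebra.ofId_apply]
    exact Algebra.commutes _ _)

theorem constAct_single (ρ : Representation ℂ (DihedralGroup n) V) (g : DihedralGroup n)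
    (p : Poly n ζ) (v : V) :
    constAct (ζ := ζ) ρ (SkewMonoidAlgebra.single g p) v = polyConst n ζ p • ρ g v := by
  have : constAct (ζ := ζ) ρ (SkewMonoidAlgebra.single g p) =
      ((Algebra.ofId ℂ (Module.End ℂ V)).comp (polyConst n ζ)) p * ρ g :=
    SkewMonoidAlgebra.liftNC_single _ _ _ _
  rw [this]
  simp [Algebra.ofId_apply, Module.algebraMap_end_apply]

theorem eq_sum_single (a : SkewAlg n ζ) :
    a = ∑ g ∈ a.support, SkewMonoidAlgebra.single g (a.coeff g) := by
  conv_lhs => rw [← a.sum_single]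
  rfl

end

/-- The graded module `P_l = S ⊗ V_l`, with `(P_l)_i = S_i ⊗ V_l`. -/
def projMod (ζ : rootsOfUnity n ℂ) (l : Irr n) : GrMod n ζ :=
  letI : Module (SkewAlg n ζ) (Poly n ζ ⊗[ℂ] (Fin l.dim → ℂ)) :=
    Module.compHom _ (tensorAct (ζ := ζ) (l.rep ζ)).toRingHom
  haveI : IsScalarTower ℂ (SkewAlg n ζ) (Poly n ζ ⊗[ℂ] (Fin l.dim → ℂ)) :=
    ⟨fun c a m => congrArg (fun f : Module.End ℂ (Poly n ζ ⊗[ℂ] (Fin l.dim → ℂ)) => f m)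
      (map_smul (tensorAct (ζ := ζ) (l.rep ζ)) c a)⟩
  { carrier := Poly n ζ ⊗[ℂ] (Fin l.dim → ℂ)
    finite := by
      classical
      refine ⟨⟨Finset.univ.image fun k => (1 : Poly n ζ) ⊗ₜ Pi.single k (1 : ℂ), ?_⟩⟩
      rw [eq_top_iff]
      intro x _
      induction x with
      | zero => exact zero_mem _
      | add x y hx hy => exact add_mem (hx trivial) (hy trivial)
      | tmul s v =>
        have hv : v = ∑ k, v k • Pi.single k (1 : ℂ) := by
          ext j; simp [Finset.sum_apply, Pi.single_apply]
        rw [hv, TensorProduct.tmul_sum]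
        refine Submodule.sum_mem _ fun k _ => ?_
        have h1 : s ⊗ₜ[ℂ] (v k • Pi.single k (1 : ℂ)) =
            (SkewMonoidAlgebra.single 1 (v k • s) : SkewAlg n ζ) •
              ((1 : Poly n ζ) ⊗ₜ[ℂ] (Pi.single k (1 : ℂ) : Fin l.dim → ℂ)) := by
          refine Eq.trans ?_ (tensorAct_single (l.rep ζ) 1 (v k • s) 1 (Pi.single k 1)).symm
          simp [TensorProduct.smul_tmul]
        rw [h1]
        exact Submodule.smul_mem _ _ (Submodule.subset_span (by simp))
    gr := tensorDeg n ζ (Fin l.dim → ℂ)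
    isInternal := tensorDeg_isInternal
    smul_mem := by
      intro d i a m ha hm
      change tensorAct (ζ := ζ) (l.rep ζ) a m ∈ _
      rw [eq_sum_single a, map_sum, LinearMap.sum_apply]
      refine Submodule.sum_mem _ fun g _ => ?_
      refine tensorDeg_induction (p := fun m => tensorAct (ζ := ζ) (l.rep ζ)
        (SkewMonoidAlgebra.single g (a.coeff g)) m ∈ tensorDeg n ζ (Fin l.dim → ℂ) (i + d))
        ?_ ?_ ?_ m hm
      · intro s hs v
        rw [tensorAct_single]
        exact tmul_mem_tensorDeg (mul_mem_polyDegZ (ha g) (smul_mem_polyDegZ g hs)) _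
      · rw [map_zero]; exact zero_mem _
      · intro x y hx hy
        rw [map_add]; exact add_mem hx hy }

/-- The simple graded module `L_l`: the representation `V_l` in degree `0`, on which polynomials
of positive degree act by zero. -/
def simpleMod (ζ : rootsOfUnity n ℂ) (l : Irr n) : GrMod n ζ :=
  letI : Module (SkewAlg n ζ) (Fin l.dim → ℂ) :=
    Module.compHom _ (constAct (ζ := ζ) (l.rep ζ)).toRingHom
  haveI : IsScalarTower ℂ (SkewAlg n ζ) (Fin l.dim → ℂ) :=
    ⟨fun c a m => congrArg (fun f : Module.End ℂ (Fin l.dim → ℂ) => f m)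
      (map_smul (constAct (ζ := ζ) (l.rep ζ)) c a)⟩
  { carrier := Fin l.dim → ℂ
    finite := Module.Finite.of_restrictScalars_finite ℂ _ _
    gr := fun i => if i = 0 then ⊤ else ⊥
    isInternal := by
      rw [DirectSum.isInternal_submodule_iff_iSupIndep_and_iSup_eq_top]
      constructor
      · rw [iSupIndep_def]
        intro i
        by_cases hi : i = 0
        · have : (⨆ j, ⨆ (_ : j ≠ i), if j = 0 then (⊤ : Submodule ℂ (Fin l.dim → ℂ)) else ⊥) = ⊥ := by
            rw [eq_bot_iff]
            refine iSup₂_le fun j hj => ?_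
            rw [if_neg (fun h => hj (h.trans hi.symm))]
          rw [this]
          exact disjoint_bot_right
        · rw [if_neg hi]
          exact disjoint_bot_left
      · rw [eq_top_iff]
        exact le_iSup_of_le 0 (by simp)
    smul_mem := by
      intro d i a m ha hm
      change constAct (ζ := ζ) (l.rep ζ) a m ∈ _
      by_cases hi : i = 0
      · subst hi
        by_cases hd : d = 0
        · subst hd
          simp
        · have : constAct (ζ := ζ) (l.rep ζ) a m = 0 := by
            rw [eq_sum_single a, map_sum, LinearMap.sum_apply]
            refine Finset.sum_eq_zero fun g _ => ?_
            rw [constAct_single, polyConst_of_mem hd (ha g), zero_smul]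
          rw [this]
          exact zero_mem _
      · rw [if_neg hi] at hm
        rw [(Submodule.mem_bot ℂ).1 hm, map_zero]
        exact zero_mem _ }

/-! ### Trace quotients -/

/-- The submodule `∑ im f` of `P_l`, over all `f : P_m → P_l` homogeneous of positive degree with
`m ∈ D`. -/
def traceSub (ζ : rootsOfUnity n ℂ) (l : Irr n) (D : Set (Irr n)) :
    Submodule (SkewAlg n ζ) (projMod ζ l).carrier :=
  sSup {N | ∃ m ∈ D, ∃ d : ℤ, 0 < d ∧
    ∃ f : (projMod ζ m).carrier →ₗ[SkewAlg n ζ] (projMod ζ l).carrier,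
      GrMod.IsHomDeg d f ∧ N = LinearMap.range f}

theorem proj_mem_traceSub (l : Irr n) (D : Set (Irr n)) :
    ∀ m ∈ traceSub ζ l D, ∀ i, (projMod ζ l).proj i m ∈ traceSub ζ l D := by
  intro m hm i
  have hm' := hm
  rw [traceSub, sSup_eq_iSup'] at hm'
  refine Submodule.iSup_induction _
    (motive := fun m => (projMod ζ l).proj i m ∈ traceSub ζ l D) hm' ?_ ?_ ?_
  · rintro ⟨N, hN⟩ x hx
    obtain ⟨k, hk, d, hd, f, hf, rfl⟩ := id hN
    obtain ⟨y, rfl⟩ := hx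
    rw [GrMod.proj_map hf]
    exact le_sSup hN ⟨_, rfl⟩
  · rw [map_zero]; exact zero_mem _
  · intro x y hx hy
    rw [map_add]; exact add_mem hx hy

/-- The graded module `F_l^D = P_l / ∑ im f`, the sum being over all `f : P_m → P_l` homogeneous of
positive degree with `m ∈ D`. -/
def traceQuot (ζ : rootsOfUnity n ℂ) (l : Irr n) (D : Set (Irr n)) : GrMod n ζ :=
  (projMod ζ l).quot (traceSub ζ l D) (proj_mem_traceSub l D)

/-- `K` is the family of trace quotient modules of the relation `R`:
`K_l ≅ P_l / ∑ im f`, over all `f : P_m → P_l` homogeneous of positive degree with `R l m`. -/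
def IsTraceQuotient (R : Irr n → Irr n → Prop) (K : Irr n → GrMod n ζ) : Prop :=
  ∀ l, (K l).Iso (traceQuot ζ l {m | R l m})

/-- The preorder `≾_K`: there is a chain `l = l_0, …, l_k = m` with
`Ext¹_A(K_{l_{i-1}}, L_{l_i}) ≠ 0` for all `i`. -/
def precK (K : Irr n → GrMod n ζ) : Irr n → Irr n → Prop :=
  Relation.ReflTransGen fun a b =>
    Nontrivial (CategoryTheory.Abelian.Ext (ModuleCat.of (SkewAlg n ζ) (K a).carrier)
      (ModuleCat.of (SkewAlg n ζ) (simpleMod ζ b).carrier) 1)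

/-- The equivalence relation `∼_K`. -/
def simK (K : Irr n → GrMod n ζ) (l m : Irr n) : Prop := precK K l m ∧ precK K m l

/-- The first family: `K_triv = F_triv^{χ_1}`, `K_sgn = F_sgn^{χ_1}`,
`K_{χ_1} = F_{χ_1}^{triv, sgn, χ_2}` and `K_{χ_i} = F_{χ_i}^{χ_{i-1}, χ_{i+1}}` for `2 ≤ i ≤ C`. -/
def IsFirstFamily (hn : Odd n) (h3 : 3 ≤ n) (K : Irr n → GrMod n ζ) : Prop :=
  (K .triv).Iso (traceQuot ζ .triv {chiIdx hn 1 (by omega) (by omega)}) ∧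
  (K .sgn).Iso (traceQuot ζ .sgn {chiIdx hn 1 (by omega) (by omega)}) ∧
  (K (chiIdx hn 1 (by omega) (by omega))).Iso
    (traceQuot ζ (chiIdx hn 1 (by omega) (by omega))
      {.triv, .sgn, chiIdx hn 2 (by omega) (by omega)}) ∧
  ∀ i, ∀ (h2 : 2 ≤ i) (hC : i ≤ (n - 1) / 2),
    (K (chiIdx hn i (by omega) (by omega))).Iso
      (traceQuot ζ (chiIdx hn i (by omega) (by omega))
        {chiIdx hn (i - 1) (by omega) (by omega), chiIdx hn (i + 1) (by omega) (by omega)})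

/-- The second kind of family: `K_triv = F_triv^{χ_1}`, `K_sgn = F_sgn^{sgn}`,
`K_{χ_1} = F_{χ_1}^{triv, sgn, χ_2}` or `F_{χ_1}^{sgn, χ_2}`, and
`K_{χ_i} = F_{χ_i}^{χ_{i-1}, χ_{i+1}}` or `F_{χ_i}^{sgn, χ_{i+1}}` for `2 ≤ i ≤ C`. -/
def IsSecondFamily (hn : Odd n) (h3 : 3 ≤ n) (K : Irr n → GrMod n ζ) : Prop :=
  (K .triv).Iso (traceQuot ζ .triv {chiIdx hn 1 (by omega) (by omega)}) ∧
  (K .sgn).Iso (traceQuot ζ .sgn {.sgn}) ∧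
  ((K (chiIdx hn 1 (by omega) (by omega))).Iso
      (traceQuot ζ (chiIdx hn 1 (by omega) (by omega))
        {.triv, .sgn, chiIdx hn 2 (by omega) (by omega)}) ∨
    (K (chiIdx hn 1 (by omega) (by omega))).Iso
      (traceQuot ζ (chiIdx hn 1 (by omega) (by omega))
        {.sgn, chiIdx hn 2 (by omega) (by omega)})) ∧
  ∀ i, ∀ (h2 : 2 ≤ i) (hC : i ≤ (n - 1) / 2),
    (K (chiIdx hn i (by omega) (by omega))).Iso
        (traceQuot ζ (chiIdx hn i (by omega) (by omega))
          {chiIdx hn (i - 1) (by omega) (by omega), chiIdx hn (i + 1) (by omega) (by omega)}) ∨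
      (K (chiIdx hn i (by omega) (by omega))).Iso
        (traceQuot ζ (chiIdx hn i (by omega) (by omega))
          {.sgn, chiIdx hn (i + 1) (by omega) (by omega)})

end

end DihedralSpringer

open DihedralSpringer

/-! Write K_l = P_l / I_l with I_l the trace submodule. An A-map out of P_m is the same as a
W-equivariant map out of the representation m (`exists_hom_of_equivariant`). Hence P_m is projective
by averaging over W, and I_l is generated by the copies of representations m ∈ D in positive degrees
of P_l. Since I_l has no component in degree 0, every map P_l → L_b vanishes on it, so Ext¹(K_l,
L_b) = Hom_A(I_l, L_b). In particular it is nonzero only for b ∈ D (`mem_of_nontrivial_ext`), and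
nonvanishing is shown by exhibiting a functional on I_l that kills X I_l and Y I_l.

Three shapes of K_l occur. If D contains all constituents of S_1 ⊗ l, then I_l is the whole positive
part and K_l is simple. The module F_{χ_i}^{sgn, χ_{i+1}} ("tall") is spanned by the Y^a b⁺ and X^a
b⁻ with a ≤ i, subject to X^i b⁻ = Y^i b⁺; its layers are χ_i, …, χ_1, triv. The module F_sgn^{sgn}
is the coinvariant algebra twisted by sgn and contains every irreducible representation.

The extensions give triv ≾ χ_1 ≾ … ≾ χ_C and χ_1 ≾ sgn. If K_{χ_i} is simple they also give χ_i ≾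
χ_{i-1}, or χ_1 ≾ triv when i = 1. Descending from χ_i, one either reaches triv, and then χ_i ≾ m
for all m, or stops at a tall χ_s with s ≤ i and χ_s ∼ χ_i. In the second case a representation m
with χ_i ⋠ m is triv or some χ_j with j < s, and these are composition factors of K_{χ_s}. This,
with the remark on K_sgn, proves (a) (`exists_gradedMult_ne_zero`).

For (b), replacing D by {m | l ≾ m} does not change I_l. A simple K_l already has the largest
possible I_l; for a tall χ_i the representations above it are sgn and χ_j with j ≥ i, which produce
no relations beyond the given ones; for a tall sgn the set is {sgn} itself. Conversely, let R be a
preorder with trace quotients K. Nonzero Ext¹ implies R, so ≾ is contained in R. If R l m but not l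
≾ m, then (a) gives l' ∼ l and m' ∼ m with m' in K_{l'}. Now R l' m', so m' can occur in K_{l'} only
in degree 0, whence m' = l' and l ∼ m, a contradiction. -/

namespace DihedralSpringer

noncomputable section

/-! ### First extensions of a quotient of a projective module -/

section Extensions

open CategoryTheory CategoryTheory.Abelian

variable {R : Type} [Ring R] {P K L : Type} [AddCommGroup P] [AddCommGroup K] [AddCommGroup L]
  [Module R P] [Module R K] [Module R L]

theorem shortExact_ker (π : P →ₗ[R] K) (hπ : Function.Surjective π) :
    π.shortComplexKer.ShortExact :=
  LinearMap.shortExact_shortComplexKer hπ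

/-- In the long exact sequence Ext¹(P, L) vanishes, so every class in Ext¹(K, L) comes from a map on
the kernel through the connecting homomorphism. -/
theorem exists_hom_ker_ne_zero_of_nontrivial_ext [Module.Projective R P] (π : P →ₗ[R] K)
    (hπ : Function.Surjective π)
    (h : Nontrivial (Ext (ModuleCat.of R K) (ModuleCat.of R L) 1)) :
    ∃ f : LinearMap.ker π →ₗ[R] L, f ≠ 0 := by
  obtain ⟨x, hx⟩ := exists_ne (0 : Ext (ModuleCat.of R K) (ModuleCat.of R L) 1)
  have hS := shortExact_ker π hπ
  have : Projective π.shortComplexKer.X₂ :=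
    inferInstanceAs (Projective (ModuleCat.of R P))
  obtain ⟨y, hy⟩ := Ext.contravariant_sequence_exact₃ hS (ModuleCat.of R L) (n₁ := 1) x
    (Ext.eq_zero_of_projective _) (n₀ := 0) rfl
  obtain ⟨f, rfl⟩ := Ext.addEquiv₀.symm.surjective y
  refine ⟨f.hom, fun h0 => hx ?_⟩
  have : f = 0 := ModuleCat.hom_ext h0
  rw [← hy, this]
  simp

/-- The connecting homomorphism kills only the restrictions of maps P → L. This direction does not
need P to be projective. -/
theorem nontrivial_ext_of_not_extend (π : P →ₗ[R] K) (hπ : Function.Surjective π)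
    (f : LinearMap.ker π →ₗ[R] L)
    (hf : ¬ ∃ g : P →ₗ[R] L, g ∘ₗ (LinearMap.ker π).subtype = f) :
    Nontrivial (Ext (ModuleCat.of R K) (ModuleCat.of R L) 1) := by
  by_contra hn
  rw [not_nontrivial_iff_subsingleton] at hn
  have hS := shortExact_ker π hπ
  obtain ⟨y, hy⟩ := Ext.contravariant_sequence_exact₁ hS (ModuleCat.of R L)
    (Ext.mk₀ (ModuleCat.ofHom f : π.shortComplexKer.X₁ ⟶ ModuleCat.of R L)) (n₁ := 1) rfl
    (hn.elim _ _)
  obtain ⟨g, rfl⟩ := Ext.addEquiv₀.symm.surjective y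
  refine hf ⟨g.hom, ?_⟩
  have h2 : π.shortComplexKer.f ≫ g = ModuleCat.ofHom f := by
    apply Ext.addEquiv₀.symm.injective
    simpa using hy
  exact congrArg ModuleCat.Hom.hom h2

end Extensions

/-! ### Averaging -/

/-- Averaging a linear map over a finite group. -/
theorem exists_equivariant_lift {G U V W : Type} [Group G] [Finite G] [AddCommGroup U]
    [AddCommGroup V] [AddCommGroup W] [Module ℂ U] [Module ℂ V] [Module ℂ W]
    (ρ : Representation ℂ G U) (σ : Representation ℂ G V) (τ : Representation ℂ G W)
    (p : V →ₗ[ℂ] W) (hp : ∀ g v, p (σ g v) = τ g (p v)) (f : U →ₗ[ℂ] W)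
    (hf : ∀ g u, f (ρ g u) = τ g (f u)) (hfp : LinearMap.range f ≤ LinearMap.range p) :
    ∃ h : U →ₗ[ℂ] V, (∀ g u, h (ρ g u) = σ g (h u)) ∧ ∀ u, p (h u) = f u := by
  classical
  have := Fintype.ofFinite G
  -- A merely linear lift exists over a field. Averaging makes it equivariant and keeps p ∘ h = f,
  -- because p and f are already equivariant.
  obtain ⟨h₀, h₀p⟩ : ∃ h₀ : U →ₗ[ℂ] V, p ∘ₗ h₀ = f := by
    obtain ⟨h₀, h⟩ := Module.projective_lifting_property p.rangeRestrict
      (f.codRestrict (LinearMap.range p) fun u => hfp ⟨u, rfl⟩) p.surjective_rangeRestrict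
    refine ⟨h₀, LinearMap.ext fun u => ?_⟩
    exact congrArg Subtype.val (LinearMap.congr_fun h u)
  have h₀p' : ∀ u, p (h₀ u) = f u := fun u => LinearMap.congr_fun h₀p u
  refine ⟨(Fintype.card G : ℂ)⁻¹ • ∑ g : G, σ g ∘ₗ h₀ ∘ₗ ρ g⁻¹, ?_, ?_⟩
  · intro g u
    simp only [LinearMap.smul_apply, LinearMap.sum_apply, LinearMap.comp_apply, map_smul, map_sum]
    congr 1
    refine Fintype.sum_equiv (Equiv.mulLeft g⁻¹) _ _ fun k => ?_
    simp only [Equiv.coe_mulLeft, ← Module.End.mul_apply, ← map_mul, mul_inv_rev, inv_inv,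
      mul_inv_cancel_left]
  · intro u
    simp only [LinearMap.smul_apply, LinearMap.sum_apply, LinearMap.comp_apply, map_smul, map_sum,
      hp, h₀p', hf]
    simp only [← Module.End.mul_apply, ← map_mul, mul_inv_cancel, map_one, Module.End.one_apply,
      Finset.sum_const, Finset.card_univ, ← Nat.cast_smul_eq_nsmul ℂ]
    rw [inv_smul_smul₀]
    exact_mod_cast Fintype.card_ne_zero

variable {n : ℕ} {ζ : rootsOfUnity n ℂ}

/-! ### Generators of the skew group algebra -/

/-- The variable `X`. -/
def pX : Poly n ζ := (MvPolynomial.X 0 : MvPolynomial (Fin 2) ℂ)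

/-- The variable `Y`. -/
def pY : Poly n ζ := (MvPolynomial.X 1 : MvPolynomial (Fin 2) ℂ)

/-- The element `p ⊗ 1` of the skew group algebra. -/
def pAct (p : Poly n ζ) : SkewAlg n ζ := SkewMonoidAlgebra.single 1 p

/-- The element `1 ⊗ g` of the skew group algebra. -/
def gAct (g : DihedralGroup n) : SkewAlg n ζ := SkewMonoidAlgebra.single g 1

theorem pAct_mul (p q : Poly n ζ) : pAct (p * q) = pAct p * pAct q := by
  simp [pAct, SkewMonoidAlgebra.single_mul_single]

theorem pAct_add (p q : Poly n ζ) : pAct (p + q) = pAct p + pAct q :=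
  SkewMonoidAlgebra.single_add _ _ _

theorem pAct_smul (c : ℂ) (p : Poly n ζ) : pAct (c • p) = c • pAct p :=
  (SkewMonoidAlgebra.smul_single c 1 p).symm

theorem gAct_mul (g h : DihedralGroup n) : (gAct (g * h) : SkewAlg n ζ) = gAct g * gAct h := by
  simp [gAct, SkewMonoidAlgebra.single_mul_single]

theorem gAct_one : (gAct 1 : SkewAlg n ζ) = 1 := rfl

theorem single_eq_mul (g : DihedralGroup n) (p : Poly n ζ) :
    (SkewMonoidAlgebra.single g p : SkewAlg n ζ) = pAct p * gAct g := by
  simp [pAct, gAct, SkewMonoidAlgebra.single_mul_single]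

theorem gAct_mul_pAct (g : DihedralGroup n) (p : Poly n ζ) :
    gAct g * pAct p = pAct (g • p) * gAct g := by
  simp [pAct, gAct, SkewMonoidAlgebra.single_mul_single]

theorem smul_poly_def (g : DihedralGroup n) (p : Poly n ζ) : g • p = polyHom ζ g p := rfl

theorem s_smul_pX : (DihedralGroup.sr 0 : DihedralGroup n) • (pX : Poly n ζ) = pY := by
  rw [smul_poly_def]
  simp [polyHom, pX, pY, zpw_zero]
  rfl

/-- Since Y = s X s in the skew group algebra, stability and linearity need only be checked on X, on
the rotations and on s. -/
theorem pAct_pY : (pAct pY : SkewAlg n ζ) =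
    gAct (DihedralGroup.sr 0) * pAct pX * gAct (DihedralGroup.sr 0) := by
  rw [gAct_mul_pAct, s_smul_pX, mul_assoc, ← gAct_mul, DihedralGroup.sr_mul_self, gAct_one,
    mul_one]

theorem poly_induction {P : Poly n ζ → Prop} (h1 : P 1) (hadd : ∀ p q, P p → P q → P (p + q))
    (hsmul : ∀ (c : ℂ) p, P p → P (c • p)) (hX : ∀ p, P p → P (p * pX))
    (hY : ∀ p, P p → P (p * pY)) (p : Poly n ζ) : P p := by
  refine MvPolynomial.induction_on (motive := fun p : MvPolynomial (Fin 2) ℂ => P p) p ?_ hadd ?_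
  · intro c
    have h := hsmul c 1 h1
    have e : (c • (1 : MvPolynomial (Fin 2) ℂ)) = MvPolynomial.C c := by
      rw [MvPolynomial.smul_eq_C_mul, mul_one]
    exact e ▸ h
  · intro p i hp
    fin_cases i
    · exact hX p hp
    · exact hY p hp

/-- A property of elements of the skew group algebra may be checked on generators. -/
theorem skewAlg_induction {P : SkewAlg n ζ → Prop} (h1 : P 1)
    (hadd : ∀ a b, P a → P b → P (a + b)) (hsmul : ∀ (c : ℂ) a, P a → P (c • a))
    (hmul : ∀ a b, P a → P b → P (a * b)) (hX : P (pAct pX))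
    (hr : ∀ i, P (gAct (DihedralGroup.r i))) (hs : P (gAct (DihedralGroup.sr 0)))
    (a : SkewAlg n ζ) : P a := by
  have hY : P (pAct pY) := by
    rw [pAct_pY]
    exact hmul _ _ (hmul _ _ hs hX) hs
  induction a using SkewMonoidAlgebra.induction_on with
  | zero => simpa using hsmul 0 1 h1
  | add a b ha hb => exact hadd a b ha hb
  | single g p =>
    rw [single_eq_mul]
    refine hmul _ _ ?_ ?_
    · induction p using poly_induction with
      | h1 => exact h1
      | hadd p q hp hq => rw [pAct_add]; exact hadd _ _ hp hq
      | hsmul c p hp => rw [pAct_smul]; exact hsmul _ _ hp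
      | hX p hp => rw [pAct_mul]; exact hmul _ _ hp hX
      | hY p hp => rw [pAct_mul]; exact hmul _ _ hp hY
    · rcases g with i | i
      · exact hr i
      · have : (DihedralGroup.sr i : DihedralGroup n) =
            DihedralGroup.sr 0 * DihedralGroup.r i := by simp
        rw [this, gAct_mul]
        exact hmul _ _ hs (hr i)

section Modules

variable {M N : Type} [AddCommGroup M] [Module ℂ M] [Module (SkewAlg n ζ) M]
  [IsScalarTower ℂ (SkewAlg n ζ) M] [AddCommGroup N] [Module ℂ N] [Module (SkewAlg n ζ) N]
  [IsScalarTower ℂ (SkewAlg n ζ) N]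

/-- The submodule of a module over the skew group algebra given by a subspace which is stable
under the generators. -/
def stableSubmodule (U : Submodule ℂ M)
    (hX : ∀ x ∈ U, (pAct pX : SkewAlg n ζ) • x ∈ U)
    (hr : ∀ i, ∀ x ∈ U, (gAct (DihedralGroup.r i) : SkewAlg n ζ) • x ∈ U)
    (hs : ∀ x ∈ U, (gAct (DihedralGroup.sr 0) : SkewAlg n ζ) • x ∈ U) :
    Submodule (SkewAlg n ζ) M where
  carrier := U
  add_mem' := U.add_mem
  zero_mem' := U.zero_mem
  smul_mem' a := by
    induction a using skewAlg_induction with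
    | h1 => intro x hx; rwa [one_smul]
    | hadd a b ha hb => intro x hx; rw [add_smul]; exact U.add_mem (ha hx) (hb hx)
    | hsmul c a ha => intro x hx; rw [smul_assoc]; exact U.smul_mem c (ha hx)
    | hmul a b ha hb => intro x hx; rw [mul_smul]; exact ha (hb hx)
    | hX => exact fun {x} => hX x
    | hr i => exact fun {x} => hr i x
    | hs => exact fun {x} => hs x

/-- A `ℂ`-linear map which commutes with the generators is linear over the skew group algebra. -/
def linearOfGenerators (f : M →ₗ[ℂ] N)
    (hX : ∀ x, f ((pAct pX : SkewAlg n ζ) • x) = (pAct pX : SkewAlg n ζ) • f x)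
    (hr : ∀ i x, f ((gAct (DihedralGroup.r i) : SkewAlg n ζ) • x) =
      (gAct (DihedralGroup.r i) : SkewAlg n ζ) • f x)
    (hs : ∀ x, f ((gAct (DihedralGroup.sr 0) : SkewAlg n ζ) • x) =
      (gAct (DihedralGroup.sr 0) : SkewAlg n ζ) • f x) :
    M →ₗ[SkewAlg n ζ] N where
  toFun := f
  map_add' := map_add f
  map_smul' a := by
    simp only [RingHom.id_apply]
    induction a using skewAlg_induction with
    | h1 => simp
    | hadd a b ha hb => intro x; rw [add_smul, add_smul, map_add, ha, hb]
    | hsmul c a ha => intro x; rw [smul_assoc, smul_assoc, map_smul, ha]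
    | hmul a b ha hb => intro x; rw [mul_smul, mul_smul, ha, hb]
    | hX => exact hX
    | hr i => exact hr i
    | hs => exact hs

variable (n ζ M) in
/-- The representation of the dihedral group on a module over the skew group algebra. -/
def modRep : Representation ℂ (DihedralGroup n) M where
  toFun g := Algebra.lsmul ℂ ℂ M (gAct g : SkewAlg n ζ)
  map_one' := by rw [gAct_one, map_one]
  map_mul' g h := by rw [gAct_mul, map_mul]

end Modules

theorem equivariant_of_generators {M V : Type} [AddCommGroup M] [Module ℂ M]
    [Module (SkewAlg n ζ) M] [AddCommGroup V] [Module ℂ V]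
    (ρ : Representation ℂ (DihedralGroup n) V) (σ : V →ₗ[ℂ] M)
    (hr : ∀ i v, σ (ρ (DihedralGroup.r i) v) = (gAct (DihedralGroup.r i) : SkewAlg n ζ) • σ v)
    (hs : ∀ v, σ (ρ (DihedralGroup.sr 0) v) = (gAct (DihedralGroup.sr 0) : SkewAlg n ζ) • σ v)
    (g : DihedralGroup n) (v : V) : σ (ρ g v) = (gAct g : SkewAlg n ζ) • σ v := by
  rcases g with i | i
  · exact hr i v
  · have : (DihedralGroup.sr i : DihedralGroup n) =
        DihedralGroup.sr 0 * DihedralGroup.r i := by simp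
    rw [this, gAct_mul, map_mul, mul_smul, Module.End.mul_apply, hs, hr]

/-! ### Monomials and coefficients -/

/-- The monomial `X ^ a * Y ^ b`. -/
def mono (a b : ℕ) : Poly n ζ := pX ^ a * pY ^ b

theorem mono_zero_zero : (mono 0 0 : Poly n ζ) = 1 := by simp [mono]

theorem pX_mul_mono (a b : ℕ) : (pX : Poly n ζ) * mono a b = mono (a + 1) b := by
  simp only [mono]; ring

theorem pY_mul_mono (a b : ℕ) : (pY : Poly n ζ) * mono a b = mono a (b + 1) := by
  simp only [mono]; ring

theorem mono_eq_monomial (a b : ℕ) : (mono a b : Poly n ζ) =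
    (MvPolynomial.monomial (Finsupp.single 0 a + Finsupp.single 1 b) (1 : ℂ) :
      MvPolynomial (Fin 2) ℂ) := by
  rw [MvPolynomial.monomial_eq, MvPolynomial.C_1, one_mul, Finsupp.prod_fintype _ _ (by simp)]
  simp [mono, pX, pY]
  rfl

theorem mono_mem (a b : ℕ) : (mono a b : Poly n ζ) ∈ polyDeg n ζ (a + b) := by
  rw [mono_eq_monomial]
  exact (MvPolynomial.mem_homogeneousSubmodule _ _).2
    (MvPolynomial.isHomogeneous_monomial _ (by simp [map_add, Finsupp.degree_single]))

theorem span_mono : Submodule.span ℂ (Set.range fun ab : ℕ × ℕ => (mono ab.1 ab.2 : Poly n ζ)) =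
    ⊤ := by
  rw [Submodule.eq_top_iff']
  intro p
  have key : ∀ a b c d : ℕ, (mono a b : Poly n ζ) * mono c d = mono (a + c) (b + d) := by
    intro a b c d; simp only [mono]; ring
  induction p using poly_induction with
  | h1 => exact Submodule.subset_span ⟨(0, 0), mono_zero_zero⟩
  | hadd p q hp hq => exact add_mem hp hq
  | hsmul c p hp => exact Submodule.smul_mem _ _ hp
  | hX p hp =>
    induction hp using Submodule.span_induction with
    | mem x hx =>
      obtain ⟨⟨a, b⟩, rfl⟩ := hx
      exact Submodule.subset_span ⟨(a + 1, b), by simp only [← pX_mul_mono, mul_comm]⟩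
    | zero => simp
    | add x y _ _ hx hy =>
      rw [add_mul]; exact add_mem hx hy
    | smul c x _ hx => rw [smul_mul_assoc]; exact Submodule.smul_mem _ _ hx
  | hY p hp =>
    induction hp using Submodule.span_induction with
    | mem x hx =>
      obtain ⟨⟨a, b⟩, rfl⟩ := hx
      exact Submodule.subset_span ⟨(a, b + 1), by simp only [← pY_mul_mono, mul_comm]⟩
    | zero => simp
    | add x y _ _ hx hy =>
      rw [add_mul]; exact add_mem hx hy
    | smul c x _ hx => rw [smul_mul_assoc]; exact Submodule.smul_mem _ _ hx

/-- The coefficient of `X ^ a * Y ^ b`. -/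
def polyCoeff (a b : ℕ) : Poly n ζ →ₗ[ℂ] ℂ :=
  (MvPolynomial.lcoeff ℂ (Finsupp.single 0 a + Finsupp.single 1 b) :
    MvPolynomial (Fin 2) ℂ →ₗ[ℂ] ℂ)

theorem polyCoeff_mono (a b c d : ℕ) :
    polyCoeff a b (mono c d : Poly n ζ) = if c = a ∧ d = b then 1 else 0 := by
  rw [mono_eq_monomial]
  refine (MvPolynomial.coeff_monomial _ _ _).trans ?_
  refine if_congr ?_ rfl rfl
  constructor
  · intro h
    have h0 := DFunLike.congr_fun h 0
    have h1 := DFunLike.congr_fun h 1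
    simp at h0 h1
    exact ⟨h0, h1⟩
  · rintro ⟨rfl, rfl⟩; rfl

theorem polyCoeff_of_mem {a b d : ℕ} (h : a + b ≠ d) {p : Poly n ζ} (hp : p ∈ polyDeg n ζ d) :
    polyCoeff a b p = 0 := by
  refine MvPolynomial.IsHomogeneous.coeff_eq_zero
    ((MvPolynomial.mem_homogeneousSubmodule _ _).1 hp) ?_
  simpa [map_add, Finsupp.degree_single] using h

theorem zpw_natCast_mul (a : ℕ) (i : ZMod n) : zpw ζ (a * i) = zpw ζ i ^ a := by
  induction a with
  | zero => simp [zpw_zero]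
  | succ a ih => rw [Nat.cast_succ, add_mul, one_mul, zpw_add, ih, pow_succ]

theorem r_smul_mono (i : ZMod n) (a b : ℕ) :
    (DihedralGroup.r i) • (mono a b : Poly n ζ) =
      zpw ζ (((a : ZMod n) - b) * i) • (mono a b : Poly n ζ) := by
  have h : (a - b : ZMod n) * i = a * i + b * (-i) := by ring
  have hX : DihedralGroup.r i • (pX : Poly n ζ) = zpw ζ i • (pX : Poly n ζ) := by
    rw [smul_poly_def]
    refine (MvPolynomial.aeval_X _ _).trans ?_
    exact (MvPolynomial.smul_eq_C_mul _ _).symm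
  have hY : DihedralGroup.r i • (pY : Poly n ζ) = zpw ζ (-i) • (pY : Poly n ζ) := by
    rw [smul_poly_def]
    refine (MvPolynomial.aeval_X _ _).trans ?_
    exact (MvPolynomial.smul_eq_C_mul _ _).symm
  rw [mono, smul_mul', smul_pow', smul_pow', hX, hY, smul_pow, smul_pow, smul_mul_smul_comm, h,
    zpw_add, zpw_natCast_mul, zpw_natCast_mul]

theorem s_smul_mono (a b : ℕ) :
    (DihedralGroup.sr 0 : DihedralGroup n) • (mono a b : Poly n ζ) = mono b a := by
  have hY : (DihedralGroup.sr 0 : DihedralGroup n) • (pY : Poly n ζ) = pX := by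
    rw [← s_smul_pX, ← mul_smul, DihedralGroup.sr_mul_self, one_smul]
  rw [mono, smul_mul', smul_pow', smul_pow', s_smul_pX, hY, mul_comm, mono]

/-! ### Standard bases of the irreducible representations -/

/-- The weight of a standard basis vector: `r` acts on it by the power of `ζ` given by it. -/
def Irr.wt : (l : Irr n) → Fin l.dim → ZMod n
  | .triv => fun _ => 0
  | .sgn => fun _ => 0
  | .chi i _ _ => (![(i : ZMod n), -(i : ZMod n)] : Fin 2 → ZMod n)

/-- The index of the image of a standard basis vector under `s`. -/
def Irr.flip : (l : Irr n) → Fin l.dim → Fin l.dim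
  | .triv => id
  | .sgn => id
  | .chi _ _ _ => (![1, 0] : Fin 2 → Fin 2)

/-- The sign with which `s` permutes the standard basis vectors. -/
def Irr.sign : Irr n → ℂ
  | .triv => 1
  | .sgn => -1
  | .chi _ _ _ => 1

theorem Irr.rep_r (l : Irr n) (i : ZMod n) (k : Fin l.dim) :
    l.rep ζ (DihedralGroup.r i) (Pi.single k 1) = zpw ζ (l.wt k * i) • Pi.single k 1 := by
  rcases l with _ | _ | ⟨j, h1, h2⟩
  · change (Pi.single k 1 : Fin 1 → ℂ) = zpw ζ (0 * i) • Pi.single k 1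
    rw [zero_mul, zpw_zero]
    exact (one_smul ℂ (Pi.single (M := fun _ : Fin 1 => ℂ) k 1)).symm
  · change (Pi.single k 1 : Fin 1 → ℂ) = zpw ζ (0 * i) • Pi.single k 1
    rw [zero_mul, zpw_zero]
    exact (one_smul ℂ (Pi.single (M := fun _ : Fin 1 => ℂ) k 1)).symm
  · have key : ∀ k : Fin 2, Matrix.toLin' (chiFun ζ j (DihedralGroup.r i)) (Pi.single k 1) =
        zpw ζ ((![(j : ZMod n), -j] : Fin 2 → ZMod n) k * i) • (Pi.single k 1 : Fin 2 → ℂ) := by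
      intro k
      ext t
      fin_cases k <;> fin_cases t <;> simp [chiFun]
    exact key k

theorem Irr.rep_s (l : Irr n) (k : Fin l.dim) :
    l.rep ζ (DihedralGroup.sr 0) (Pi.single k 1) = l.sign • Pi.single (l.flip k) 1 := by
  rcases l with _ | _ | ⟨j, h1, h2⟩
  · change (Pi.single k 1 : Fin 1 → ℂ) = (1 : ℂ) • Pi.single k 1
    exact (one_smul ℂ (Pi.single (M := fun _ : Fin 1 => ℂ) k 1)).symm
  · change -(Pi.single k 1 : Fin 1 → ℂ) = (-1 : ℂ) • Pi.single k 1
    exact (neg_one_smul ℂ (Pi.single (M := fun _ : Fin 1 => ℂ) k 1)).symm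
  · have key : ∀ k : Fin 2, Matrix.toLin' (chiFun ζ j (DihedralGroup.sr 0)) (Pi.single k 1) =
        (1 : ℂ) • (Pi.single ((![1, 0] : Fin 2 → Fin 2) k) 1 : Fin 2 → ℂ) := by
      intro k
      ext t
      fin_cases k <;> fin_cases t <;> simp [chiFun, zpw_zero]
    exact key k

theorem Irr.flip_flip (l : Irr n) (k : Fin l.dim) : l.flip (l.flip k) = k := by
  rcases l with _ | _ | ⟨j, h1, h2⟩
  · rfl
  · rfl
  · have key : ∀ k : Fin 2, (![1, 0] : Fin 2 → Fin 2) ((![1, 0] : Fin 2 → Fin 2) k) = k := by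
      decide
    exact key k

/-- The index of the basis vector `b⁺` of `χ_i`. -/
def Irr.pos (i : ℕ) (h1 : 1 ≤ i) (h2 : i ≤ (n - 1) / 2) : Fin (Irr.chi i h1 h2).dim :=
  (0 : Fin 2)

/-- The index of the basis vector `b⁻` of `χ_i`. -/
def Irr.neg (i : ℕ) (h1 : 1 ≤ i) (h2 : i ≤ (n - 1) / 2) : Fin (Irr.chi i h1 h2).dim :=
  (1 : Fin 2)

section Chi

variable {i : ℕ} {h1 : 1 ≤ i} {h2 : i ≤ (n - 1) / 2}

/-- The index type is `Fin 2` only after unfolding `Irr.dim`, so case splits go through `Irr.pos`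
and `Irr.neg` instead of numerals. -/
theorem Irr.forall_chi {P : Fin (Irr.chi i h1 h2).dim → Prop} (hp : P (Irr.pos i h1 h2))
    (hn : P (Irr.neg i h1 h2)) (k : Fin (Irr.chi i h1 h2).dim) : P k :=
  (Fin.forall_fin_two (p := P)).2 ⟨hp, hn⟩ k

theorem Irr.wt_pos : (Irr.chi i h1 h2).wt (Irr.pos i h1 h2) = i := rfl

theorem Irr.wt_neg : (Irr.chi i h1 h2).wt (Irr.neg i h1 h2) = -i := rfl

theorem Irr.flip_pos : (Irr.chi i h1 h2).flip (Irr.pos i h1 h2) = Irr.neg i h1 h2 := rfl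

theorem Irr.flip_neg : (Irr.chi i h1 h2).flip (Irr.neg i h1 h2) = Irr.pos i h1 h2 := rfl

theorem Irr.sign_chi : (Irr.chi i h1 h2).sign = 1 := rfl

theorem Irr.pos_ne_neg : Irr.pos i h1 h2 ≠ Irr.neg i h1 h2 := Fin.zero_ne_one (n := 0)

end Chi

/-! ### Coordinates on the projective modules -/

/-- The element `p ⊗ v` of `P_l`. -/
def ptm (l : Irr n) (p : Poly n ζ) (v : Fin l.dim → ℂ) : (projMod ζ l).carrier :=
  p ⊗ₜ[ℂ] v

/-- The element `X ^ a Y ^ b ⊗ e_k` of `P_l`. -/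
def bas (l : Irr n) (a b : ℕ) (k : Fin l.dim) : (projMod ζ l).carrier :=
  ptm l (mono a b) (Pi.single k 1)

/-- The inclusion of `V_l` into `P_l`. -/
def vec (l : Irr n) : (Fin l.dim → ℂ) →ₗ[ℂ] (projMod ζ l).carrier :=
  (TensorProduct.mk ℂ (Poly n ζ) (Fin l.dim → ℂ) 1 :)

theorem vec_apply (l : Irr n) (v : Fin l.dim → ℂ) : vec (ζ := ζ) l v = ptm l 1 v := rfl

theorem single_smul_ptm (l : Irr n) (g : DihedralGroup n) (p q : Poly n ζ)
    (v : Fin l.dim → ℂ) :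
    (SkewMonoidAlgebra.single g p : SkewAlg n ζ) • ptm l q v = ptm l (p * g • q) (l.rep ζ g v) :=
  tensorAct_single (l.rep ζ) g p q v

theorem pAct_smul_ptm (l : Irr n) (p q : Poly n ζ) (v : Fin l.dim → ℂ) :
    (pAct p : SkewAlg n ζ) • ptm l q v = ptm l (p * q) v := by
  rw [pAct, single_smul_ptm, one_smul, map_one, Module.End.one_apply]

theorem gAct_smul_ptm (l : Irr n) (g : DihedralGroup n) (q : Poly n ζ) (v : Fin l.dim → ℂ) :
    (gAct g : SkewAlg n ζ) • ptm l q v = ptm l (g • q) (l.rep ζ g v) := by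
  rw [gAct, single_smul_ptm, one_mul]

theorem ptm_smul_left (l : Irr n) (c : ℂ) (q : Poly n ζ) (v : Fin l.dim → ℂ) :
    ptm l (c • q) v = c • ptm l q v := TensorProduct.smul_tmul' c q v

theorem ptm_smul_right (l : Irr n) (c : ℂ) (q : Poly n ζ) (v : Fin l.dim → ℂ) :
    ptm l q (c • v) = c • ptm l q v := TensorProduct.tmul_smul c q v

theorem pX_smul_bas (l : Irr n) (a b : ℕ) (k : Fin l.dim) :
    (pAct pX : SkewAlg n ζ) • bas (ζ := ζ) l a b k = bas l (a + 1) b k := by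
  rw [bas, pAct_smul_ptm, pX_mul_mono, bas]

theorem mono_smul_bas (l : Irr n) (a b c d : ℕ) (k : Fin l.dim) :
    (pAct (mono a b) : SkewAlg n ζ) • bas (ζ := ζ) l c d k = bas l (a + c) (b + d) k := by
  rw [bas, pAct_smul_ptm, bas]
  congr 1
  simp only [mono]; ring

theorem r_smul_bas (l : Irr n) (i : ZMod n) (a b : ℕ) (k : Fin l.dim) :
    (gAct (DihedralGroup.r i) : SkewAlg n ζ) • bas (ζ := ζ) l a b k =
      zpw ζ (((a : ZMod n) - b + l.wt k) * i) • bas (ζ := ζ) l a b k := by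
  rw [bas, gAct_smul_ptm, r_smul_mono, Irr.rep_r, ptm_smul_left, ptm_smul_right, smul_smul,
    ← zpw_add, ← add_mul]

theorem s_smul_bas (l : Irr n) (a b : ℕ) (k : Fin l.dim) :
    (gAct (DihedralGroup.sr 0) : SkewAlg n ζ) • bas (ζ := ζ) l a b k = l.sign • bas l b a (l.flip k) := by
  rw [bas, gAct_smul_ptm, s_smul_mono, Irr.rep_s, ptm_smul_right, bas]

theorem bas_mem (l : Irr n) (a b : ℕ) (k : Fin l.dim) :
    bas (ζ := ζ) l a b k ∈ (projMod ζ l).gr ((a + b : ℕ) : ℤ) :=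
  tmul_mem_tensorDeg (i := ((a + b : ℕ) : ℤ)) (mono_mem a b) _

theorem span_bas (l : Irr n) : Submodule.span ℂ
    (Set.range fun x : ℕ × ℕ × Fin l.dim => bas (ζ := ζ) l x.1 x.2.1 x.2.2) = ⊤ := by
  rw [eq_top_iff]
  intro x _
  have hv : ∀ v : Fin l.dim → ℂ, v = ∑ k, v k • Pi.single k (1 : ℂ) := by
    intro v; ext j; simp [Finset.sum_apply, Pi.single_apply]
  have h2 : ∀ (p : Poly n ζ) (v : Fin l.dim → ℂ), ptm l p v ∈ Submodule.span ℂ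
      (Set.range fun x : ℕ × ℕ × Fin l.dim => bas (ζ := ζ) l x.1 x.2.1 x.2.2) := by
    intro p v
    have hp : p ∈ Submodule.span ℂ
        (Set.range fun ab : ℕ × ℕ => (mono ab.1 ab.2 : Poly n ζ)) := by
      rw [span_mono]; trivial
    induction hp using Submodule.span_induction with
    | mem x hx =>
      obtain ⟨⟨a, b⟩, rfl⟩ := hx
      rw [hv v]
      have : ptm l (mono a b : Poly n ζ) (∑ k, v k • Pi.single k (1 : ℂ)) =
          ∑ k, v k • bas (ζ := ζ) l a b k := by
        refine (TensorProduct.tmul_sum _ _ _).trans ?_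
        exact Finset.sum_congr rfl fun k _ => ptm_smul_right l _ _ _
      rw [this]
      exact Submodule.sum_mem _ fun k _ => Submodule.smul_mem _ _
        (Submodule.subset_span ⟨(a, b, k), rfl⟩)
    | zero =>
      have : ptm l (0 : Poly n ζ) v = 0 := TensorProduct.zero_tmul _ _
      rw [this]; exact zero_mem _
    | add x y _ _ hx hy =>
      have : ptm l (x + y) v = ptm l x v + ptm l y v := TensorProduct.add_tmul _ _ _
      rw [this]; exact add_mem hx hy
    | smul c x _ hx => rw [ptm_smul_left]; exact Submodule.smul_mem _ _ hx
  exact TensorProduct.induction_on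
    (motive := fun x : Poly n ζ ⊗[ℂ] (Fin l.dim → ℂ) => (show (projMod ζ l).carrier from x) ∈ Submodule.span ℂ
      (Set.range fun x : ℕ × ℕ × Fin l.dim => bas (ζ := ζ) l x.1 x.2.1 x.2.2)) x
    (zero_mem _) (fun p v => h2 p v) (fun _ _ hx hy => add_mem hx hy)

theorem linearMap_ext_bas {l : Irr n} {N : Type} [AddCommGroup N] [Module ℂ N]
    {f g : (projMod ζ l).carrier →ₗ[ℂ] N} (h : ∀ a b k, f (bas l a b k) = g (bas l a b k)) :
    f = g :=
  LinearMap.ext_on_range (span_bas l) fun x => h x.1 x.2.1 x.2.2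

/-- The coefficient of `X ^ a Y ^ b ⊗ e_k`. -/
def coef (l : Irr n) (a b : ℕ) (k : Fin l.dim) : (projMod ζ l).carrier →ₗ[ℂ] ℂ :=
  (TensorProduct.lift ((LinearMap.mul ℂ ℂ).compl₁₂ (polyCoeff a b)
    (LinearMap.proj k : (Fin l.dim → ℂ) →ₗ[ℂ] ℂ)) : Poly n ζ ⊗[ℂ] (Fin l.dim → ℂ) →ₗ[ℂ] ℂ)

theorem coef_ptm (l : Irr n) (a b : ℕ) (k : Fin l.dim) (p : Poly n ζ) (v : Fin l.dim → ℂ) :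
    coef l a b k (ptm l p v) = polyCoeff a b p * v k := by
  refine (TensorProduct.lift.tmul _ _).trans ?_
  simp

theorem coef_bas (l : Irr n) (a b : ℕ) (k : Fin l.dim) (c d : ℕ) (j : Fin l.dim) :
    coef (ζ := ζ) l a b k (bas l c d j) = if c = a ∧ d = b ∧ j = k then 1 else 0 := by
  rw [bas, coef_ptm, polyCoeff_mono, Pi.single_apply]
  by_cases h1 : c = a <;> by_cases h2 : d = b <;> by_cases h3 : k = j <;>
    simp [h1, h2, h3, eq_comm]

theorem coef_of_mem (l : Irr n) {a b : ℕ} {k : Fin l.dim} {d : ℤ} (h : ((a + b : ℕ) : ℤ) ≠ d)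
    {x : (projMod ζ l).carrier} (hx : x ∈ (projMod ζ l).gr d) : coef l a b k x = 0 := by
  refine tensorDeg_induction (p := fun x => coef (ζ := ζ) l a b k x = 0) ?_ ?_ ?_ x hx
  · intro p hp v
    refine (coef_ptm l a b k p v).trans ?_
    cases d with
    | ofNat d => rw [polyCoeff_of_mem (fun e => h (by simp [← e])) hp, zero_mul]
    | negSucc d => rw [(Submodule.mem_bot ℂ).1 hp, map_zero, zero_mul]
  · exact map_zero (coef (ζ := ζ) l a b k)
  · intro x y hx hy
    exact (map_add (coef (ζ := ζ) l a b k) x y).trans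
      ((congrArg₂ (· + ·) hx hy).trans (add_zero 0))

/-- These formulas for the coordinates of X x, r x and s x allow submodules of P_l to be cut out by
linear equations on coefficients. -/
theorem coef_pX_succ (l : Irr n) (a b : ℕ) (k : Fin l.dim) (x : (projMod ζ l).carrier) :
    coef l (a + 1) b k ((pAct pX : SkewAlg n ζ) • x) = coef l a b k x := by
  suffices h : coef (ζ := ζ) l (a + 1) b k ∘ₗ
      Algebra.lsmul ℂ ℂ (projMod ζ l).carrier (pAct pX : SkewAlg n ζ) = coef l a b k from
    LinearMap.congr_fun h x
  refine linearMap_ext_bas fun c d j => ?_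
  simp [pX_smul_bas, coef_bas]

theorem coef_pX_zero (l : Irr n) (b : ℕ) (k : Fin l.dim) (x : (projMod ζ l).carrier) :
    coef l 0 b k ((pAct pX : SkewAlg n ζ) • x) = 0 := by
  suffices h : coef (ζ := ζ) l 0 b k ∘ₗ
      Algebra.lsmul ℂ ℂ (projMod ζ l).carrier (pAct pX : SkewAlg n ζ) = 0 from
    LinearMap.congr_fun h x
  refine linearMap_ext_bas fun c d j => ?_
  simp [pX_smul_bas, coef_bas]

theorem coef_r (l : Irr n) (i : ZMod n) (a b : ℕ) (k : Fin l.dim) (x : (projMod ζ l).carrier) :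
    coef l a b k ((gAct (DihedralGroup.r i) : SkewAlg n ζ) • x) =
      zpw ζ (((a : ZMod n) - b + l.wt k) * i) * coef l a b k x := by
  suffices h : coef (ζ := ζ) l a b k ∘ₗ
      Algebra.lsmul ℂ ℂ (projMod ζ l).carrier (gAct (DihedralGroup.r i) : SkewAlg n ζ) =
      zpw ζ (((a : ZMod n) - b + l.wt k) * i) • coef l a b k from LinearMap.congr_fun h x
  refine linearMap_ext_bas fun c d j => ?_
  simp only [LinearMap.comp_apply, Algebra.lsmul_coe, r_smul_bas, map_smul, LinearMap.smul_apply,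
    coef_bas]
  split_ifs with h
  · obtain ⟨rfl, rfl, rfl⟩ := h; rfl
  · simp

theorem coef_s (l : Irr n) (a b : ℕ) (k : Fin l.dim) (x : (projMod ζ l).carrier) :
    coef l a b k ((gAct (DihedralGroup.sr 0) : SkewAlg n ζ) • x) =
      l.sign * coef l b a (l.flip k) x := by
  suffices h : coef (ζ := ζ) l a b k ∘ₗ
      Algebra.lsmul ℂ ℂ (projMod ζ l).carrier (gAct (DihedralGroup.sr 0) : SkewAlg n ζ) =
      l.sign • coef l b a (l.flip k) from LinearMap.congr_fun h x
  refine linearMap_ext_bas fun c d j => ?_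
  have e : (l.flip j = k) ↔ (j = l.flip k) :=
    ⟨fun h => by rw [← h, l.flip_flip], fun h => by rw [h, l.flip_flip]⟩
  simp only [LinearMap.comp_apply, Algebra.lsmul_coe, s_smul_bas, map_smul, LinearMap.smul_apply,
    coef_bas, e]
  congr 2
  rw [eq_iff_iff]
  tauto

/-! ### Homomorphisms from the projective modules -/

section Universal

variable {M : Type} [AddCommGroup M] [Module ℂ M] [Module (SkewAlg n ζ) M]

variable (ζ) in
/-- Equivariant maps from an irreducible representation to a module over the skew group algebra. -/
def Equivariant (l : Irr n) (σ : (Fin l.dim → ℂ) →ₗ[ℂ] M) : Prop :=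
  ∀ g v, σ (l.rep ζ g v) = (gAct g : SkewAlg n ζ) • σ v

theorem vec_equivariant (l : Irr n) : Equivariant ζ l (vec (ζ := ζ) l) := by
  intro g v
  rw [vec_apply, vec_apply, gAct_smul_ptm, smul_one]

theorem bas_eq_smul_vec (l : Irr n) (a b : ℕ) (k : Fin l.dim) :
    bas (ζ := ζ) l a b k = (pAct (mono a b) : SkewAlg n ζ) • vec l (Pi.single k 1) := by
  rw [vec_apply, pAct_smul_ptm, mul_one, bas]

theorem submodule_eq_top_of_vec_mem (l : Irr n)
    (U : Submodule (SkewAlg n ζ) (projMod ζ l).carrier) (h : ∀ v, vec l v ∈ U) : U = ⊤ := by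
  rw [Submodule.eq_top_iff']
  intro x
  have hx : x ∈ Submodule.span ℂ
      (Set.range fun x : ℕ × ℕ × Fin l.dim => bas (ζ := ζ) l x.1 x.2.1 x.2.2) := by
    rw [span_bas]; trivial
  have : Submodule.span ℂ
      (Set.range fun x : ℕ × ℕ × Fin l.dim => bas (ζ := ζ) l x.1 x.2.1 x.2.2) ≤
      U.restrictScalars ℂ := by
    rw [Submodule.span_le]
    rintro _ ⟨⟨a, b, k⟩, rfl⟩
    change bas l a b k ∈ U
    rw [bas_eq_smul_vec]
    exact U.smul_mem _ (h _)
  exact this hx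

variable [IsScalarTower ℂ (SkewAlg n ζ) M]

/-- P_l is induced from W to A, and this is Frobenius reciprocity. The map p ⊗ v ↦ p σ(v) commutes
with W because g p = g(p) g in A. -/
theorem exists_hom_of_equivariant {l : Irr n} {σ : (Fin l.dim → ℂ) →ₗ[ℂ] M}
    (hσ : Equivariant ζ l σ) :
    ∃ f : (projMod ζ l).carrier →ₗ[SkewAlg n ζ] M,
      ∀ p v, f (ptm l p v) = (pAct p : SkewAlg n ζ) • σ v := by
  let f₀ : (projMod ζ l).carrier →ₗ[ℂ] M :=
    (TensorProduct.lift (LinearMap.mk₂ ℂ (fun (p : Poly n ζ) v => (pAct p : SkewAlg n ζ) • σ v)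
      (fun p q v => by rw [pAct_add, add_smul])
      (fun c p v => by rw [pAct_smul, smul_assoc])
      (fun p v w => by rw [map_add, smul_add])
      (fun c p v => by rw [map_smul, smul_algebra_smul_comm])) :
      Poly n ζ ⊗[ℂ] (Fin l.dim → ℂ) →ₗ[ℂ] M)
  have hf₀ : ∀ p v, f₀ (ptm l p v) = (pAct p : SkewAlg n ζ) • σ v := fun p v =>
    TensorProduct.lift.tmul _ _
  have hg : ∀ g x, f₀ ((gAct g : SkewAlg n ζ) • x) = (gAct g : SkewAlg n ζ) • f₀ x := by
    intro g x
    suffices h : f₀ ∘ₗ Algebra.lsmul ℂ ℂ (projMod ζ l).carrier (gAct g : SkewAlg n ζ) =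
        Algebra.lsmul ℂ ℂ M (gAct g : SkewAlg n ζ) ∘ₗ f₀ from LinearMap.congr_fun h x
    refine linearMap_ext_bas fun a b k => ?_
    simp only [LinearMap.comp_apply, Algebra.lsmul_coe, bas, gAct_smul_ptm, hf₀]
    rw [hσ, ← mul_smul, ← mul_smul, gAct_mul_pAct]
  refine ⟨linearOfGenerators f₀ ?_ (fun i => hg _) (hg _), hf₀⟩
  intro x
  suffices h : f₀ ∘ₗ Algebra.lsmul ℂ ℂ (projMod ζ l).carrier (pAct pX : SkewAlg n ζ) =
      Algebra.lsmul ℂ ℂ M (pAct pX : SkewAlg n ζ) ∘ₗ f₀ from LinearMap.congr_fun h x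
  refine linearMap_ext_bas fun a b k => ?_
  simp only [LinearMap.comp_apply, Algebra.lsmul_coe, bas, pAct_smul_ptm, hf₀]
  rw [pAct_mul, mul_smul]

end Universal

theorem hom_ext_vec {M : Type} [AddCommGroup M] [Module (SkewAlg n ζ) M] {l : Irr n}
    {f g : (projMod ζ l).carrier →ₗ[SkewAlg n ζ] M}
    (h : ∀ v, f (vec l v) = g (vec l v)) : f = g := by
  have := submodule_eq_top_of_vec_mem l (LinearMap.eqLocus f g) h
  exact LinearMap.ext fun x => by
    have hx : x ∈ LinearMap.eqLocus f g := by rw [this]; trivial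
    exact hx

/-- A section of a surjection onto P_l amounts to an equivariant lift of the inclusion of V_l, and
averaging over W supplies one. -/
instance projMod_projective [NeZero n] (l : Irr n) :
    Module.Projective (SkewAlg n ζ) (projMod ζ l).carrier := by
  refine Module.Projective.of_lifting_property'' fun f hf => ?_
  obtain ⟨σ, hσ, hσf⟩ := exists_equivariant_lift (l.rep ζ)
    (modRep n ζ ((projMod ζ l).carrier →₀ SkewAlg n ζ)) (modRep n ζ (projMod ζ l).carrier)
    (f.restrictScalars ℂ) (fun g v => map_smul f (gAct g) v) (vec l) (vec_equivariant l)
    (by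
      rintro _ ⟨v, rfl⟩
      obtain ⟨y, hy⟩ := hf (vec l v)
      exact ⟨y, hy⟩)
  obtain ⟨h, hh⟩ := exists_hom_of_equivariant (M := (projMod ζ l).carrier →₀ SkewAlg n ζ) hσ
  refine ⟨h, hom_ext_vec fun v => ?_⟩
  have h1 : h (vec l v) = σ v := by
    rw [vec_apply, hh]
    exact one_smul _ _
  exact (congrArg f h1).trans (hσf v)

/-! ### Trace submodules -/

/-- Together with `traceSub_le`, this replaces the homomorphisms P_m → P_l in the definition of the
trace by equivariant maps from m into positive degrees of P_l. -/
theorem mem_traceSub_of_equivariant {l m : Irr n} {D : Set (Irr n)} (hm : m ∈ D) {d : ℤ}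
    (hd : 0 < d) {σ : (Fin m.dim → ℂ) →ₗ[ℂ] (projMod ζ l).carrier} (hσ : Equivariant ζ m σ)
    (hgr : ∀ v, σ v ∈ (projMod ζ l).gr d) (v : Fin m.dim → ℂ) : σ v ∈ traceSub ζ l D := by
  obtain ⟨f, hf⟩ := exists_hom_of_equivariant hσ
  have hdeg : GrMod.IsHomDeg d f := by
    intro i x hx
    refine tensorDeg_induction (p := fun x => f x ∈ (projMod ζ l).gr (i + d)) ?_ ?_ ?_ x hx
    · intro p hp v
      have h1 : f (ptm m p v) ∈ (projMod ζ l).gr (i + d) := by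
        rw [hf]
        -- In negative degrees the only polynomial is 0.
        cases i with
        | ofNat e =>
          rw [add_comm]
          exact (projMod ζ l).smul_mem e d _ _ (GrMod.single_mem_algDeg 1 hp) (hgr v)
        | negSucc e =>
          rw [(Submodule.mem_bot ℂ).1 hp]
          have : (pAct 0 : SkewAlg n ζ) = 0 := SkewMonoidAlgebra.single_zero _
          rw [this, zero_smul]
          exact zero_mem _
      exact h1
    · have h1 : f 0 ∈ (projMod ζ l).gr (i + d) := by rw [map_zero]; exact zero_mem _
      exact h1
    · intro x y hx hy
      have h1 := add_mem hx hy
      exact (map_add f x y).symm ▸ h1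
  have h1 : f (vec m v) = σ v := by
    rw [vec_apply, hf]
    exact one_smul _ _
  rw [← h1]
  have h2 : LinearMap.range f ≤ traceSub ζ l D := le_sSup ⟨m, hm, d, hd, f, hdeg, rfl⟩
  exact h2 ⟨_, rfl⟩

theorem vec_mem (l : Irr n) (v : Fin l.dim → ℂ) : vec (ζ := ζ) l v ∈ (projMod ζ l).gr 0 :=
  tmul_mem_tensorDeg (i := 0) GrMod.one_mem_polyDeg v

theorem traceSub_le {l : Irr n} {D : Set (Irr n)}
    {N : Submodule (SkewAlg n ζ) (projMod ζ l).carrier}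
    (h : ∀ m ∈ D, ∀ d : ℤ, 0 < d → ∀ σ : (Fin m.dim → ℂ) →ₗ[ℂ] (projMod ζ l).carrier,
      Equivariant ζ m σ → (∀ v, σ v ∈ (projMod ζ l).gr d) → ∀ v, σ v ∈ N) :
    traceSub ζ l D ≤ N := by
  refine sSup_le ?_
  rintro _ ⟨m, hm, d, hd, f, hf, rfl⟩
  have h1 : N.comap f = ⊤ := by
    refine submodule_eq_top_of_vec_mem m _ fun v => ?_
    refine h m hm d hd (f.restrictScalars ℂ ∘ₗ vec m) ?_ ?_ v
    · intro g v
      exact (congrArg f (vec_equivariant m g v)).trans (map_smul f _ _)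
    · intro v
      have := hf 0 _ (vec_mem m v)
      rwa [zero_add] at this
  rintro _ ⟨x, rfl⟩
  have hx : x ∈ N.comap f := by rw [h1]; trivial
  exact hx

/-! ### Weights -/

theorem zpw_eq_one_iff (hζ : IsPrimitiveRoot ((ζ : ℂˣ) : ℂ) n) (c : ZMod n) :
    zpw ζ c = 1 ↔ c = 0 := by
  obtain ⟨k, rfl⟩ := ZMod.intCast_surjective c
  rw [zpw_intCast, ZMod.intCast_zmod_eq_zero_iff_dvd, ← hζ.zpow_eq_one_iff_dvd]
  simp

theorem zpw_ne_zero (c : ZMod n) : zpw ζ c ≠ 0 := Units.ne_zero _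

theorem zpw_injective (hζ : IsPrimitiveRoot ((ζ : ℂˣ) : ℂ) n) : Function.Injective (zpw ζ) := by
  intro a b h
  rw [← sub_eq_zero, ← zpw_eq_one_iff hζ]
  have h1 := zpw_add ζ (a - b) b
  rw [sub_add_cancel, h] at h1
  exact mul_right_cancel₀ (zpw_ne_zero b) (by rw [one_mul, ← h1])

theorem Equivariant.r_smul {M : Type} [AddCommGroup M] [Module ℂ M] [Module (SkewAlg n ζ) M]
    {m : Irr n} {σ : (Fin m.dim → ℂ) →ₗ[ℂ] M} (hσ : Equivariant ζ m σ) (i : ZMod n)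
    (k : Fin m.dim) : (gAct (DihedralGroup.r i) : SkewAlg n ζ) • σ (Pi.single k 1) =
      zpw ζ (m.wt k * i) • σ (Pi.single k 1) := by
  rw [← hσ, Irr.rep_r, map_smul]

theorem Equivariant.s_smul {M : Type} [AddCommGroup M] [Module ℂ M] [Module (SkewAlg n ζ) M]
    {m : Irr n} {σ : (Fin m.dim → ℂ) →ₗ[ℂ] M} (hσ : Equivariant ζ m σ)
    (k : Fin m.dim) : (gAct (DihedralGroup.sr 0) : SkewAlg n ζ) • σ (Pi.single k 1) =
      m.sign • σ (Pi.single (m.flip k) 1) := by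
  rw [← hσ, Irr.rep_s, map_smul]

/-- The rotation r multiplies X^a Y^b ⊗ e_k by ζ to the power a - b + wt k. As ζ is primitive, a
vector of a given weight involves only monomials of that weight. -/
theorem wt_eq_of_coef_ne_zero (hζ : IsPrimitiveRoot ((ζ : ℂˣ) : ℂ) n) {l m : Irr n}
    {σ : (Fin m.dim → ℂ) →ₗ[ℂ] (projMod ζ l).carrier} (hσ : Equivariant ζ m σ)
    {a b : ℕ} {k : Fin l.dim} {j : Fin m.dim} (h : coef l a b k (σ (Pi.single j 1)) ≠ 0) :
    (a : ZMod n) - b + l.wt k = m.wt j := by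
  have h1 := congrArg (coef l a b k) (hσ.r_smul 1 j)
  rw [coef_r, map_smul, smul_eq_mul, mul_one, mul_one] at h1
  exact zpw_injective hζ (mul_right_cancel₀ h h1)

/-- For 1 ≤ i, j ≤ C one has 0 < i + j < n, so i and j are nonzero modulo n and i ≡ ±j forces i = j.
Weights cannot separate triv from sgn; that is left to the action of s. -/
theorem Irr.eq_or_of_wt_eq {l m : Irr n} {k : Fin l.dim} {j : Fin m.dim}
    (h : l.wt k = m.wt j) :
    l = m ∨ (l = .triv ∧ m = .sgn) ∨ (l = .sgn ∧ m = .triv) := by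
  have h0 : ∀ i : ℕ, 1 ≤ i → i ≤ (n - 1) / 2 → (i : ZMod n) ≠ 0 := by
    intro i h1 h2 h3
    rw [ZMod.natCast_eq_zero_iff] at h3
    have := Nat.le_of_dvd (by omega) h3
    omega
  have hadd : ∀ i j : ℕ, 1 ≤ i → i ≤ (n - 1) / 2 → j ≤ (n - 1) / 2 → (i : ZMod n) + j ≠ 0 := by
    intro i j h1 h2 h3 h4
    rw [← Nat.cast_add, ZMod.natCast_eq_zero_iff] at h4
    have := Nat.le_of_dvd (by omega) h4
    omega
  have heq : ∀ i j : ℕ, 1 ≤ i → i ≤ (n - 1) / 2 → j ≤ (n - 1) / 2 → (i : ZMod n) = j → i = j := by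
    intro i j h1 h2 h3 h4
    rw [ZMod.natCast_eq_natCast_iff] at h4
    exact Nat.ModEq.eq_of_lt_of_lt h4 (by omega) (by omega)
  have hc : ∀ (i : ℕ) (h1 : 1 ≤ i) (h2 : i ≤ (n - 1) / 2) (k : Fin 2),
      (Irr.chi i h1 h2).wt k = i ∨ (Irr.chi i h1 h2).wt k = -i := by
    intro i h1 h2 k
    fin_cases k
    · exact Or.inl rfl
    · exact Or.inr rfl
  rcases l with _ | _ | ⟨i, h1, h2⟩ <;> rcases m with _ | _ | ⟨i', h1', h2'⟩
  · exact Or.inl rfl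
  · exact Or.inr (Or.inl ⟨rfl, rfl⟩)
  · exfalso
    rcases hc i' h1' h2' j with e | e
    · exact h0 i' h1' h2' (e.symm.trans h.symm)
    · exact h0 i' h1' h2' (neg_eq_zero.1 (e.symm.trans h.symm))
  · exact Or.inr (Or.inr ⟨rfl, rfl⟩)
  · exact Or.inl rfl
  · exfalso
    rcases hc i' h1' h2' j with e | e
    · exact h0 i' h1' h2' (e.symm.trans h.symm)
    · exact h0 i' h1' h2' (neg_eq_zero.1 (e.symm.trans h.symm))
  · exfalso
    rcases hc i h1 h2 k with e | e
    · exact h0 i h1 h2 (e.symm.trans h)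
    · exact h0 i h1 h2 (neg_eq_zero.1 (e.symm.trans h))
  · exfalso
    rcases hc i h1 h2 k with e | e
    · exact h0 i h1 h2 (e.symm.trans h)
    · exact h0 i h1 h2 (neg_eq_zero.1 (e.symm.trans h))
  · left
    have : i = i' := by
      rcases hc i h1 h2 k with e | e <;> rcases hc i' h1' h2' j with e' | e' <;> rw [e, e'] at h
      · exact heq i i' h1 h2 h2' h
      · exact absurd (by rw [h, neg_add_cancel]) (hadd i i' h1 h2 h2')
      · exact absurd (by rw [← h, add_neg_cancel]) (hadd i i' h1 h2 h2')
      · exact heq i i' h1 h2 h2' (neg_injective h)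
    subst this
    rfl

/-! ### Schur's lemma and detection of elements by their coefficients. -/

theorem linearMap_eq_zero_of_single {m : Irr n} {M : Type} [AddCommGroup M] [Module ℂ M]
    {σ : (Fin m.dim → ℂ) →ₗ[ℂ] M} (h : ∀ k, σ (Pi.single k 1) = 0) : σ = 0 := by
  refine (Pi.basisFun ℂ (Fin m.dim)).ext fun k => ?_
  rw [Pi.basisFun_apply, h, LinearMap.zero_apply]

theorem Irr.rep_r_apply (l : Irr n) (i : ZMod n) (v : Fin l.dim → ℂ) (k : Fin l.dim) :
    l.rep ζ (DihedralGroup.r i) v k = zpw ζ (l.wt k * i) * v k := by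
  suffices h : LinearMap.proj k ∘ₗ l.rep ζ (DihedralGroup.r i) =
      zpw ζ (l.wt k * i) • (LinearMap.proj k : (Fin l.dim → ℂ) →ₗ[ℂ] ℂ) from
    LinearMap.congr_fun h v
  refine (Pi.basisFun ℂ (Fin l.dim)).ext fun j => ?_
  simp only [Pi.basisFun_apply, LinearMap.comp_apply, Irr.rep_r, LinearMap.proj_apply,
    LinearMap.smul_apply, Pi.smul_apply, smul_eq_mul]
  by_cases h : k = j
  · rw [h]
  · simp [h]

theorem Irr.rep_s_apply (l : Irr n) (v : Fin l.dim → ℂ) (k : Fin l.dim) :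
    l.rep ζ (DihedralGroup.sr 0) v k = l.sign * v (l.flip k) := by
  suffices h : LinearMap.proj k ∘ₗ l.rep ζ (DihedralGroup.sr 0) =
      l.sign • (LinearMap.proj (l.flip k) : (Fin l.dim → ℂ) →ₗ[ℂ] ℂ) from
    LinearMap.congr_fun h v
  refine (Pi.basisFun ℂ (Fin l.dim)).ext fun j => ?_
  simp only [Pi.basisFun_apply, LinearMap.comp_apply, Irr.rep_s, LinearMap.proj_apply,
    LinearMap.smul_apply, Pi.smul_apply, smul_eq_mul, Pi.single_apply]
  congr 2
  exact eq_iff_iff.2 ⟨fun h => by rw [h, l.flip_flip], fun h => by rw [← h, l.flip_flip]⟩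

/-- Schur's lemma: there are no nonzero equivariant maps between distinct irreducible
representations. -/
theorem Irr.eq_of_hom_ne_zero (hζ : IsPrimitiveRoot ((ζ : ℂˣ) : ℂ) n) {l m : Irr n}
    {σ : (Fin m.dim → ℂ) →ₗ[ℂ] (Fin l.dim → ℂ)}
    (hσ : ∀ g v, σ (m.rep ζ g v) = l.rep ζ g (σ v)) (h : σ ≠ 0) : m = l := by
  have h1 : ∃ j k, σ (Pi.single j 1) k ≠ 0 := by
    by_contra! hc
    exact h (linearMap_eq_zero_of_single fun j => funext (hc j))
  obtain ⟨j, k, hjk⟩ := h1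
  have h2 : m.wt j = l.wt k := by
    have h3 := congrFun (hσ (DihedralGroup.r 1) (Pi.single j 1)) k
    rw [Irr.rep_r, map_smul, Irr.rep_r_apply, Pi.smul_apply, smul_eq_mul, mul_one, mul_one] at h3
    exact zpw_injective hζ (mul_right_cancel₀ hjk h3)
  -- Equal weights leave only the confusion of triv with sgn, which the eigenvalue of s rules out.
  have h4 := congrFun (hσ (DihedralGroup.sr 0) (Pi.single j 1)) k
  rw [Irr.rep_s, map_smul, Irr.rep_s_apply, Pi.smul_apply, smul_eq_mul] at h4
  rcases Irr.eq_or_of_wt_eq h2 with h5 | ⟨rfl, rfl⟩ | ⟨rfl, rfl⟩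
  · exact h5
  · exfalso
    change (1 : ℂ) * σ (Pi.single j 1) k = -1 * σ (Pi.single j 1) k at h4
    exact hjk (by linear_combination h4 / 2)
  · exfalso
    change (-1 : ℂ) * σ (Pi.single j 1) k = 1 * σ (Pi.single j 1) k at h4
    exact hjk (by linear_combination -h4 / 2)

theorem eq_zero_of_coef_eq_zero {l : Irr n} {x : (projMod ζ l).carrier}
    (h : ∀ a b k, coef l a b k x = 0) : x = 0 := by
  have hx : x ∈ Submodule.span ℂ
      (Set.range fun x : ℕ × ℕ × Fin l.dim => bas (ζ := ζ) l x.1 x.2.1 x.2.2) := by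
    rw [span_bas]; trivial
  rw [Finsupp.mem_span_range_iff_exists_finsupp] at hx
  obtain ⟨c, rfl⟩ := hx
  refine Finset.sum_eq_zero fun t _ => ?_
  have h1 := h t.1 t.2.1 t.2.2
  rw [Finsupp.sum, map_sum, Finset.sum_eq_single t] at h1
  · rw [map_smul, coef_bas, if_pos ⟨rfl, rfl, rfl⟩, smul_eq_mul, mul_one] at h1
    change c t • _ = _
    rw [h1, zero_smul]
  · rintro ⟨a, b, k⟩ _ hne
    rw [map_smul, coef_bas, if_neg, smul_zero]
    rintro ⟨rfl, rfl, rfl⟩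
    exact hne rfl
  · intro ht
    rw [Finsupp.notMem_support_iff.1 ht, zero_smul, map_zero]

/-! ### Graded presentations -/

/-- `π` presents the graded module `K` as the quotient of `P_l` by `I`. -/
structure IsPresentation (K : GrMod n ζ) (l : Irr n)
    (I : Submodule (SkewAlg n ζ) (projMod ζ l).carrier)
    (π : (projMod ζ l).carrier →ₗ[SkewAlg n ζ] K.carrier) : Prop where
  surjective : Function.Surjective π
  ker_eq : LinearMap.ker π = I
  gr_eq : ∀ i, K.gr i = ((projMod ζ l).gr i).map (π.restrictScalars ℂ)

theorem exists_isPresentation {K : GrMod n ζ} {l : Irr n} {D : Set (Irr n)}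
    (h : K.Iso (traceQuot ζ l D)) : ∃ π, IsPresentation K l (traceSub ζ l D) π := by
  obtain ⟨e, he⟩ := h
  let q : (projMod ζ l).carrier →ₗ[SkewAlg n ζ] (traceQuot ζ l D).carrier :=
    (traceSub ζ l D).mkQ
  refine ⟨e.symm.toLinearMap ∘ₗ q, ?_, ?_, ?_⟩
  · exact e.symm.surjective.comp (traceSub ζ l D).mkQ_surjective
  · rw [LinearMap.ker_comp, LinearEquiv.ker, Submodule.comap_bot]
    exact Submodule.ker_mkQ _
  · intro i
    ext x
    rw [he]
    constructor
    · rintro ⟨y, hy, hyx⟩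
      refine ⟨y, hy, ?_⟩
      change e.symm (q y) = x
      rw [LinearEquiv.symm_apply_eq]
      exact hyx
    · rintro ⟨y, hy, rfl⟩
      refine ⟨y, hy, ?_⟩
      exact (e.apply_symm_apply _).symm

theorem traceQuot_congr {l : Irr n} {D D' : Set (Irr n)}
    (h : traceSub ζ l D = traceSub ζ l D') : traceQuot ζ l D = traceQuot ζ l D' := by
  unfold traceQuot
  congr 1

/-! ### First extensions by simple modules -/

theorem pAct_smul_simpleMod (b : Irr n) (p : Poly n ζ) (v : (simpleMod ζ b).carrier) :
    (pAct p : SkewAlg n ζ) • v = polyConst n ζ p • v := by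
  refine (constAct_single (b.rep ζ) 1 p v).trans ?_
  rw [map_one]
  rfl

theorem gAct_smul_simpleMod (b : Irr n) (g : DihedralGroup n) (v : (simpleMod ζ b).carrier) :
    (gAct g : SkewAlg n ζ) • v = b.rep ζ g v := by
  refine (constAct_single (b.rep ζ) g 1 v).trans ?_
  rw [map_one]
  exact one_smul _ _

/-- A nonzero class gives a nonzero map f from the trace submodule to L_b. Composing f with an
equivariant map from m ∈ D into the trace gives an equivariant map m → b, zero by Schur unless m =
b. If b ∉ D, then f kills all generators. -/
theorem mem_of_nontrivial_ext [NeZero n] (hζ : IsPrimitiveRoot ((ζ : ℂˣ) : ℂ) n)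
    {K : GrMod n ζ} {a b : Irr n} {D : Set (Irr n)} (hK : K.Iso (traceQuot ζ a D))
    (h : Nontrivial (CategoryTheory.Abelian.Ext (ModuleCat.of (SkewAlg n ζ) K.carrier)
      (ModuleCat.of (SkewAlg n ζ) (simpleMod ζ b).carrier) 1)) : b ∈ D := by
  obtain ⟨π, hπ⟩ := exists_isPresentation hK
  obtain ⟨f, hf⟩ := exists_hom_ker_ne_zero_of_nontrivial_ext π hπ.surjective h
  by_contra hb
  refine hf (LinearMap.ext fun x => ?_)
  have hle : traceSub ζ a D ≤ (LinearMap.ker f).map (LinearMap.ker π).subtype := by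
    refine traceSub_le fun m hm d hd σ hσ hgr v => ?_
    have hker : ∀ v, σ v ∈ LinearMap.ker π := fun v => by
      rw [hπ.ker_eq]; exact mem_traceSub_of_equivariant hm hd hσ hgr v
    let τ : (Fin m.dim → ℂ) →ₗ[ℂ] (Fin b.dim → ℂ) :=
      (f.restrictScalars ℂ) ∘ₗ σ.codRestrict ((LinearMap.ker π).restrictScalars ℂ) hker
    have hτ : τ = 0 := by
      by_contra hne
      refine hb ((Irr.eq_of_hom_ne_zero hζ (σ := τ) ?_ hne) ▸ hm)
      intro g v
      have h1 : (⟨σ (m.rep ζ g v), hker _⟩ : LinearMap.ker π) =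
          (gAct g : SkewAlg n ζ) • ⟨σ v, hker v⟩ := Subtype.ext (hσ g v)
      refine (congrArg f h1).trans ((map_smul f _ _).trans ?_)
      exact gAct_smul_simpleMod b g _
    exact ⟨⟨σ v, hker v⟩, LinearMap.congr_fun hτ v, rfl⟩
  have hx : (x : (projMod ζ a).carrier) ∈ traceSub ζ a D := by rw [← hπ.ker_eq]; exact x.2
  obtain ⟨y, hy, hyx⟩ := hle hx
  rw [← Subtype.ext (a1 := y) (a2 := x) hyx]
  exact hy

theorem polyConst_mono {a b : ℕ} (h : a + b ≠ 0) : polyConst n ζ (mono a b) = 0 :=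
  polyConst_of_mem h (mono_mem a b)

/-- Monomials of positive degree act on L_b through their constant term, which is 0, so a map P_a →
L_b depends only on the degree-zero component. -/
theorem hom_simpleMod_eq_zero {a b : Irr n}
    (g : (projMod ζ a).carrier →ₗ[SkewAlg n ζ] (simpleMod ζ b).carrier)
    {x : (projMod ζ a).carrier} (hx : ∀ k, coef a 0 0 k x = 0) : g x = 0 := by
  have h : g.restrictScalars ℂ =
      ∑ k, (coef a 0 0 k).smulRight (g (bas a 0 0 k)) := by
    refine linearMap_ext_bas fun c d j => ?_
    simp only [LinearMap.restrictScalars_apply, LinearMap.sum_apply, LinearMap.smulRight_apply,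
      coef_bas]
    by_cases hcd : c + d = 0
    · obtain ⟨rfl, rfl⟩ : c = 0 ∧ d = 0 := by omega
      simp
    · rw [bas_eq_smul_vec, map_smul, pAct_smul_simpleMod, polyConst_mono hcd, zero_smul]
      refine (Finset.sum_eq_zero fun k _ => ?_).symm
      rw [if_neg (by omega), zero_smul]
  refine (LinearMap.congr_fun h x).trans ?_
  simp [hx]

/-- The map φ need not be A-linear on P_a. It is W-equivariant and kills X I for the trace submodule
I, so its restriction to I is A-linear. It does not extend A-linearly to P_a, since every A-map P_a
→ L_b vanishes at x. -/
theorem nontrivial_ext_of_map {K : GrMod n ζ} {a b : Irr n} {D : Set (Irr n)}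
    (hK : K.Iso (traceQuot ζ a D)) (φ : (projMod ζ a).carrier →ₗ[ℂ] (Fin b.dim → ℂ))
    (hr : ∀ i x, φ ((gAct (DihedralGroup.r i) : SkewAlg n ζ) • x) =
      b.rep ζ (DihedralGroup.r i) (φ x))
    (hs : ∀ x, φ ((gAct (DihedralGroup.sr 0) : SkewAlg n ζ) • x) =
      b.rep ζ (DihedralGroup.sr 0) (φ x))
    (hX : ∀ x ∈ traceSub ζ a D, φ ((pAct pX : SkewAlg n ζ) • x) = 0)
    {x : (projMod ζ a).carrier} (hx : x ∈ traceSub ζ a D) (hx0 : ∀ k, coef a 0 0 k x = 0)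
    (hφ : φ x ≠ 0) :
    Nontrivial (CategoryTheory.Abelian.Ext (ModuleCat.of (SkewAlg n ζ) K.carrier)
      (ModuleCat.of (SkewAlg n ζ) (simpleMod ζ b).carrier) 1) := by
  obtain ⟨π, hπ⟩ := exists_isPresentation hK
  have hφ' : ∀ y, φ y = (show (simpleMod ζ b).carrier from φ y) := fun _ => rfl
  let φ' : LinearMap.ker π →ₗ[ℂ] (simpleMod ζ b).carrier :=
    (show (projMod ζ a).carrier →ₗ[ℂ] (simpleMod ζ b).carrier from φ) ∘ₗ
      ((LinearMap.ker π).restrictScalars ℂ).subtype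
  have hpX : polyConst n ζ pX = 0 := by
    have := polyConst_mono (n := n) (ζ := ζ) (a := 1) (b := 0) (by simp)
    simpa [mono] using this
  let f : LinearMap.ker π →ₗ[SkewAlg n ζ] (simpleMod ζ b).carrier := linearOfGenerators φ'
    (fun y => by
      rw [pAct_smul_simpleMod, hpX, zero_smul]
      exact hX y (by rw [← hπ.ker_eq]; exact y.2))
    (fun i y => by rw [gAct_smul_simpleMod]; exact hr i y)
    (fun y => by rw [gAct_smul_simpleMod]; exact hs y)
  refine nontrivial_ext_of_not_extend π hπ.surjective f ?_
  rintro ⟨g, hg⟩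
  have hxk : x ∈ LinearMap.ker π := by rw [hπ.ker_eq]; exact hx
  have h1 : g x = φ x := LinearMap.congr_fun hg ⟨x, hxk⟩
  exact hφ (h1.symm.trans (hom_simpleMod_eq_zero g hx0))

/-- A functional ψ of weight j induces the equivariant map (ψ, ψ ∘ s) to χ_j. Its second coordinate
kills X I because s X = Y s and ψ kills Y I. -/
theorem nontrivial_ext_chi {K : GrMod n ζ} {a : Irr n} {D : Set (Irr n)}
    (hK : K.Iso (traceQuot ζ a D)) {j : ℕ} (h1 : 1 ≤ j) (h2 : j ≤ (n - 1) / 2)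
    (ψ : (projMod ζ a).carrier →ₗ[ℂ] ℂ)
    (hr : ∀ i x, ψ ((gAct (DihedralGroup.r i) : SkewAlg n ζ) • x) = zpw ζ (j * i) * ψ x)
    (hX : ∀ x ∈ traceSub ζ a D, ψ ((pAct pX : SkewAlg n ζ) • x) = 0)
    (hY : ∀ x ∈ traceSub ζ a D, ψ ((pAct pY : SkewAlg n ζ) • x) = 0)
    {x : (projMod ζ a).carrier} (hx : x ∈ traceSub ζ a D) (hx0 : ∀ k, coef a 0 0 k x = 0)
    (hψ : ψ x ≠ 0) :
    Nontrivial (CategoryTheory.Abelian.Ext (ModuleCat.of (SkewAlg n ζ) K.carrier)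
      (ModuleCat.of (SkewAlg n ζ) (simpleMod ζ (.chi j h1 h2)).carrier) 1) := by
  have hss : ∀ y : (projMod ζ a).carrier, (gAct (DihedralGroup.sr 0) : SkewAlg n ζ) •
      (gAct (DihedralGroup.sr 0) : SkewAlg n ζ) • y = y := by
    intro y
    rw [← mul_smul, ← gAct_mul, DihedralGroup.sr_mul_self, gAct_one, one_smul]
  let φ : (projMod ζ a).carrier →ₗ[ℂ] (Fin (Irr.chi j h1 h2).dim → ℂ) :=
    (LinearMap.pi ![ψ, ψ ∘ₗ Algebra.lsmul ℂ ℂ (projMod ζ a).carrier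
      (gAct (DihedralGroup.sr 0) : SkewAlg n ζ)] : _ →ₗ[ℂ] (Fin 2 → ℂ))
  have e0 : ∀ y, φ y (Irr.pos j h1 h2) = ψ y := fun _ => rfl
  have e1 : ∀ y, φ y (Irr.neg j h1 h2) =
      ψ ((gAct (DihedralGroup.sr 0) : SkewAlg n ζ) • y) := fun _ => rfl
  refine nontrivial_ext_of_map hK φ ?_ ?_ ?_ hx hx0
    (fun h => hψ (congrFun h (Irr.pos j h1 h2)))
  · intro i y
    refine funext (Irr.forall_chi ?_ ?_)
    · rw [Irr.rep_r_apply, e0, e0, hr, Irr.wt_pos]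
    · have hc : (DihedralGroup.sr 0 : DihedralGroup n) * DihedralGroup.r i =
          DihedralGroup.r (-i) * DihedralGroup.sr 0 := by simp
      rw [Irr.rep_r_apply, e1, e1, ← mul_smul, ← gAct_mul, hc, gAct_mul, mul_smul, hr, mul_neg,
        ← neg_mul, Irr.wt_neg]
  · intro y
    refine funext (Irr.forall_chi ?_ ?_)
    · rw [Irr.rep_s_apply, Irr.flip_pos, e0, e1, Irr.sign_chi, one_mul]
    · rw [Irr.rep_s_apply, Irr.flip_neg, e0, e1, hss, Irr.sign_chi, one_mul]
  · intro y hy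
    refine funext (Irr.forall_chi (hX y hy) ?_)
    have h3 : (gAct (DihedralGroup.sr 0) : SkewAlg n ζ) • (pAct pX : SkewAlg n ζ) • y =
        (pAct pY : SkewAlg n ζ) • (gAct (DihedralGroup.sr 0) : SkewAlg n ζ) • y := by
      rw [← mul_smul, gAct_mul_pAct, s_smul_pX, mul_smul]
    rw [e1, h3]
    exact hY _ (Submodule.smul_mem _ _ hy)

theorem nontrivial_ext_one_dim {K : GrMod n ζ} {a b : Irr n} {D : Set (Irr n)}
    (hK : K.Iso (traceQuot ζ a D)) (hb : b = .triv ∨ b = .sgn)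
    (ψ : (projMod ζ a).carrier →ₗ[ℂ] ℂ)
    (hr : ∀ i x, ψ ((gAct (DihedralGroup.r i) : SkewAlg n ζ) • x) = ψ x)
    (hs : ∀ x, ψ ((gAct (DihedralGroup.sr 0) : SkewAlg n ζ) • x) = b.sign * ψ x)
    (hX : ∀ x ∈ traceSub ζ a D, ψ ((pAct pX : SkewAlg n ζ) • x) = 0)
    {x : (projMod ζ a).carrier} (hx : x ∈ traceSub ζ a D) (hx0 : ∀ k, coef a 0 0 k x = 0)
    (hψ : ψ x ≠ 0) :
    Nontrivial (CategoryTheory.Abelian.Ext (ModuleCat.of (SkewAlg n ζ) K.carrier)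
      (ModuleCat.of (SkewAlg n ζ) (simpleMod ζ b).carrier) 1) := by
  have hdim : 0 < b.dim := by rcases hb with rfl | rfl <;> exact Nat.one_pos
  have hwt : ∀ k, b.wt k = 0 := by rcases hb with rfl | rfl <;> exact fun _ => rfl
  refine nontrivial_ext_of_map (b := b) hK (LinearMap.pi fun _ => ψ) ?_ ?_ ?_ hx hx0
    (fun h => hψ (congrFun h ⟨0, hdim⟩))
  · intro i y
    funext k
    rw [Irr.rep_r_apply, hwt, zero_mul, zpw_zero, one_mul]
    exact hr i y
  · intro y
    funext k
    rw [Irr.rep_s_apply]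
    exact hs y
  · intro y hy
    funext k
    exact hX y hy

/-! ### Multiplicities -/

theorem GrMod.gradedMult_ne_zero_iff (M : GrMod n ζ) (l : Irr n) :
    M.gradedMult l ≠ 0 ↔ ∃ i, M.mult i l ≠ 0 := by
  rw [not_iff_comm, not_exists]
  simp only [not_not]
  constructor
  · intro h
    ext i
    exact congrArg (Nat.cast : ℕ → ℤ) (h i)
  · intro h i
    have h1 := congrArg (fun f : LaurentSeries ℤ => f.coeff i) h
    have h2 : (M.mult i l : ℤ) = 0 := h1
    exact_mod_cast h2

/-- A copy of m in degree i of K lifts equivariantly to degree i of P_l by averaging. If i > 0, the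
lift lies in the trace submodule and dies in K. Hence i ≤ 0, where P_l consists of l in degree 0,
and Schur's lemma applies. -/
theorem eq_of_mult_ne_zero [NeZero n] (hζ : IsPrimitiveRoot ((ζ : ℂˣ) : ℂ) n)
    {K : GrMod n ζ} {l m : Irr n} {D : Set (Irr n)} (hK : K.Iso (traceQuot ζ l D))
    (hm : m ∈ D) (h : K.gradedMult m ≠ 0) : m = l := by
  obtain ⟨i, hi⟩ := (K.gradedMult_ne_zero_iff m).1 h
  obtain ⟨π, hπ⟩ := exists_isPresentation hK
  obtain ⟨τ, hτ⟩ : ∃ τ : Representation.IntertwiningMap (m.rep ζ) (K.grRep i), τ ≠ 0 := by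
    by_contra! hc
    have : Subsingleton (Representation.IntertwiningMap (m.rep ζ) (K.grRep i)) :=
      ⟨fun f g => by rw [hc f, hc g]⟩
    exact hi Module.finrank_zero_of_subsingleton
  let τ' : (Fin m.dim → ℂ) →ₗ[ℂ] K.carrier := (K.gr i).subtype ∘ₗ τ.toLinearMap
  have hτ' : ∀ g v, τ' (m.rep ζ g v) = modRep n ζ K.carrier g (τ' v) := fun g v =>
    congrArg Subtype.val
    (Representation.IntertwiningMap.isIntertwining (m.rep ζ) (K.grRep i) τ g v)
  obtain ⟨σ, hσ, hσπ⟩ := exists_equivariant_lift (m.rep ζ) ((projMod ζ l).grRep i)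
    (modRep n ζ K.carrier) (π.restrictScalars ℂ ∘ₗ ((projMod ζ l).gr i).subtype)
    (fun g v => map_smul π (gAct g) (v : (projMod ζ l).carrier)) τ' hτ' (by
      rintro _ ⟨v, rfl⟩
      have h1 : τ' v ∈ K.gr i := (τ v).2
      rw [hπ.gr_eq] at h1
      obtain ⟨y, hy, hy2⟩ := h1
      exact ⟨⟨y, hy⟩, hy2⟩)
  let σ' : (Fin m.dim → ℂ) →ₗ[ℂ] (projMod ζ l).carrier := ((projMod ζ l).gr i).subtype ∘ₗ σ
  have hσ' : Equivariant ζ m σ' := fun g v => congrArg Subtype.val (hσ g v)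
  have hne : ∃ v, π (σ' v) ≠ 0 := by
    by_contra! hc
    refine hτ (Representation.IntertwiningMap.ext (LinearMap.ext fun v => Subtype.ext ?_))
    exact (hσπ v).symm.trans (hc v)
  obtain ⟨v, hv⟩ := hne
  have hi0 : i ≤ 0 := by
    by_contra! hpos
    have h1 : σ' v ∈ traceSub ζ l D :=
      mem_traceSub_of_equivariant hm hpos hσ' (fun v => (σ v).2) v
    rw [← hπ.ker_eq] at h1
    exact hv h1
  let κ : (Fin m.dim → ℂ) →ₗ[ℂ] (Fin l.dim → ℂ) := LinearMap.pi (fun k => coef l 0 0 k) ∘ₗ σ'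
  have hκ : ∀ g v, κ (m.rep ζ g v) = l.rep ζ g (κ v) := by
    have hκr : ∀ i v, κ (m.rep ζ (DihedralGroup.r i) v) =
        l.rep ζ (DihedralGroup.r i) (κ v) := by
      intro i v
      funext k
      rw [Irr.rep_r_apply]
      change coef l 0 0 k (σ' _) = _ * coef l 0 0 k (σ' v)
      rw [hσ', coef_r]
      simp
    have hκs : ∀ v, κ (m.rep ζ (DihedralGroup.sr 0) v) =
        l.rep ζ (DihedralGroup.sr 0) (κ v) := by
      intro v
      funext k
      rw [Irr.rep_s_apply]
      change coef l 0 0 k (σ' _) = _ * coef l 0 0 _ (σ' v)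
      rw [hσ', coef_s]
    intro g v
    -- The target representation is viewed as the module L_l, so that equivariance need only be
    -- checked on the rotations and on s.
    have h0 : ∀ w : (simpleMod ζ l).carrier, l.rep ζ g w = (gAct g : SkewAlg n ζ) • w := fun w =>
      (gAct_smul_simpleMod l g w).symm
    refine (equivariant_of_generators (M := (simpleMod ζ l).carrier) (m.rep ζ) κ ?_ ?_ g v).trans
      (h0 _).symm
    · intro i v; rw [gAct_smul_simpleMod]; exact hκr i v
    · intro v; rw [gAct_smul_simpleMod]; exact hκs v
  refine Irr.eq_of_hom_ne_zero hζ hκ fun h0 => hv ?_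
  have h1 : σ' v = 0 := by
    refine eq_zero_of_coef_eq_zero fun a b k => ?_
    by_cases hab : a + b = 0
    · obtain ⟨rfl, rfl⟩ : a = 0 ∧ b = 0 := by omega
      exact congrFun (LinearMap.congr_fun h0 v) k
    · exact coef_of_mem l (by omega) (σ v).2
  rw [h1, map_zero]

/-- Multiplicities are given by `finrank`, which is 0 on infinite-dimensional spaces, so proving
them nonzero requires finite-dimensional homogeneous parts. -/
instance finite_projMod_gr (l : Irr n) (i : ℤ) : Module.Finite ℂ ((projMod ζ l).gr i) := by
  have : Module.Finite ℂ (polyDegZ n ζ i) := by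
    cases i with
    | ofNat d =>
      exact Module.Finite.iff_fg.2 (MvPolynomial.homogeneousSubmodule_fg (σ := Fin 2) (R := ℂ) d)
    | negSucc d => exact inferInstanceAs (Module.Finite ℂ (⊥ : Submodule ℂ (Poly n ζ)))
  exact inferInstanceAs (Module.Finite ℂ
    (LinearMap.range ((polyDegZ n ζ i).subtype.rTensor (Fin l.dim → ℂ))))

theorem gradedMult_ne_zero_of_equivariant {K : GrMod n ζ} {l m : Irr n} {D : Set (Irr n)}
    (hK : K.Iso (traceQuot ζ l D)) {i : ℤ}
    {σ : (Fin m.dim → ℂ) →ₗ[ℂ] (projMod ζ l).carrier} (hσ : Equivariant ζ m σ)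
    (hgr : ∀ v, σ v ∈ (projMod ζ l).gr i) {v : Fin m.dim → ℂ} (hv : σ v ∉ traceSub ζ l D) :
    K.gradedMult m ≠ 0 := by
  obtain ⟨π, hπ⟩ := exists_isPresentation hK
  refine (K.gradedMult_ne_zero_iff m).2 ⟨i, ?_⟩
  have hfin : Module.Finite ℂ (K.gr i) := by
    rw [hπ.gr_eq]
    exact inferInstance
  have hgr' : ∀ v, π (σ v) ∈ K.gr i := fun v => by
    rw [hπ.gr_eq]; exact ⟨σ v, hgr v, rfl⟩
  let τ : Representation.IntertwiningMap (m.rep ζ) (K.grRep i) :=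
    { toLinearMap := (π.restrictScalars ℂ ∘ₗ σ).codRestrict (K.gr i) hgr'
      isIntertwining' := fun g => LinearMap.ext fun v => Subtype.ext
        ((congrArg π (hσ g v)).trans (map_smul π (gAct g) (σ v))) }
  have hτ : τ ≠ 0 := by
    intro h0
    have h1 : π (σ v) = 0 := congrArg (fun f : Representation.IntertwiningMap (m.rep ζ)
      (K.grRep i) => ((f v : K.gr i) : K.carrier)) h0
    exact hv (by rw [← hπ.ker_eq]; exact h1)
  let Φ : Representation.IntertwiningMap (m.rep ζ) (K.grRep i) →ₗ[ℂ]
      ((Fin m.dim → ℂ) →ₗ[ℂ] K.gr i) :=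
    { toFun := fun f => f.toLinearMap
      map_add' := fun _ _ => rfl
      map_smul' := fun _ _ => rfl }
  have : Module.Finite ℂ (Representation.IntertwiningMap (m.rep ζ) (K.grRep i)) :=
    Module.Finite.of_injective Φ (fun f g h => Representation.IntertwiningMap.ext h)
  have : Nontrivial (Representation.IntertwiningMap (m.rep ζ) (K.grRep i)) := ⟨τ, 0, hτ⟩
  exact (Module.finrank_pos (R := ℂ)).ne'

/-! ### Elements of trace submodules -/

theorem linearMap_mem_of_bas {l : Irr n} {M : Type} [AddCommGroup M] [Module ℂ M]
    (f : (projMod ζ l).carrier →ₗ[ℂ] M) (U : Submodule ℂ M)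
    (h : ∀ a b k, f (bas l a b k) ∈ U) (x : (projMod ζ l).carrier) : f x ∈ U := by
  have h1 : Submodule.span ℂ
      (Set.range fun x : ℕ × ℕ × Fin l.dim => bas (ζ := ζ) l x.1 x.2.1 x.2.2) ≤ U.comap f := by
    rw [Submodule.span_le]
    rintro _ ⟨⟨a, b, k⟩, rfl⟩
    exact h a b k
  rw [span_bas] at h1
  exact h1 trivial

theorem gAct_smul_mem_gr (M : GrMod n ζ) (g : DihedralGroup n) {d : ℤ} {x : M.carrier}
    (hx : x ∈ M.gr d) : (gAct g : SkewAlg n ζ) • x ∈ M.gr d := by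
  simpa only [gAct, Nat.cast_zero, add_zero] using
    M.smul_mem 0 d _ x (GrMod.single_mem_algDeg g GrMod.one_mem_polyDeg) hx

/-- The map sends b⁺ to x and b⁻ to s x, which has weight -j because r s = s r⁻¹. The last clause
confines the image to any subspace containing both. -/
theorem exists_equivariant_chi {M : Type} [AddCommGroup M] [Module ℂ M]
    [Module (SkewAlg n ζ) M] [IsScalarTower ℂ (SkewAlg n ζ) M] {j : ℕ} (h1 : 1 ≤ j)
    (h2 : j ≤ (n - 1) / 2) {x : M}
    (hr : ∀ i, (gAct (DihedralGroup.r i) : SkewAlg n ζ) • x = zpw ζ (j * i) • x) :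
    ∃ σ : (Fin (Irr.chi j h1 h2).dim → ℂ) →ₗ[ℂ] M, Equivariant ζ (.chi j h1 h2) σ ∧
      σ (Pi.single (Irr.pos j h1 h2) 1) = x ∧ ∀ U : Submodule ℂ M, x ∈ U →
        (gAct (DihedralGroup.sr 0) : SkewAlg n ζ) • x ∈ U → ∀ v, σ v ∈ U := by
  let y := (gAct (DihedralGroup.sr 0) : SkewAlg n ζ) • x
  let σ : (Fin (Irr.chi j h1 h2).dim → ℂ) →ₗ[ℂ] M :=
    (LinearMap.proj (Irr.pos j h1 h2)).smulRight x + (LinearMap.proj (Irr.neg j h1 h2)).smulRight y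
  have hσ : ∀ v, σ v = v (Irr.pos j h1 h2) • x + v (Irr.neg j h1 h2) • y := fun _ => rfl
  refine ⟨σ, equivariant_of_generators _ σ ?_ ?_, ?_, ?_⟩
  · intro i v
    have hc : (DihedralGroup.r i : DihedralGroup n) * DihedralGroup.sr 0 =
        DihedralGroup.sr 0 * DihedralGroup.r (-i) := by simp
    have hy : (gAct (DihedralGroup.r i) : SkewAlg n ζ) • y = zpw ζ (-j * i) • y := by
      rw [← mul_smul, ← gAct_mul, hc, gAct_mul, mul_smul, hr, smul_algebra_smul_comm, mul_neg,
        neg_mul]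
    rw [hσ, hσ, Irr.rep_r_apply, Irr.rep_r_apply, Irr.wt_pos, Irr.wt_neg, smul_add,
      smul_algebra_smul_comm, smul_algebra_smul_comm, hr, hy, smul_smul, smul_smul,
      mul_comm (v (Irr.pos _ _ _)), mul_comm (v (Irr.neg _ _ _))]
  · intro v
    have hy : (gAct (DihedralGroup.sr 0) : SkewAlg n ζ) • y = x := by
      rw [← mul_smul, ← gAct_mul, DihedralGroup.sr_mul_self, gAct_one, one_smul]
    rw [hσ, hσ, Irr.rep_s_apply, Irr.rep_s_apply, Irr.flip_pos, Irr.flip_neg, Irr.sign_chi,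
      one_mul, one_mul, smul_add, smul_algebra_smul_comm, smul_algebra_smul_comm, hy, add_comm]
  · rw [hσ, Pi.single_eq_same, Pi.single_eq_of_ne Irr.pos_ne_neg.symm, one_smul, zero_smul,
      add_zero]
  · intro U hx hy v
    rw [hσ]
    exact U.add_mem (U.smul_mem _ hx) (U.smul_mem _ hy)

theorem Irr.eq_of_one_dim {m : Irr n} (hm : m = .triv ∨ m = .sgn) (k j : Fin m.dim) : k = j := by
  rcases hm with rfl | rfl
  · exact Subsingleton.elim (α := Fin 1) k j
  · exact Subsingleton.elim (α := Fin 1) k j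

theorem exists_equivariant_one_dim {M : Type} [AddCommGroup M] [Module ℂ M]
    [Module (SkewAlg n ζ) M] [IsScalarTower ℂ (SkewAlg n ζ) M] {m : Irr n}
    (hm : m = .triv ∨ m = .sgn) {x : M}
    (hr : ∀ i, (gAct (DihedralGroup.r i) : SkewAlg n ζ) • x = x)
    (hs : (gAct (DihedralGroup.sr 0) : SkewAlg n ζ) • x = m.sign • x) :
    ∃ (σ : (Fin m.dim → ℂ) →ₗ[ℂ] M) (k : Fin m.dim), Equivariant ζ m σ ∧
      (∀ v, σ v = v k • x) := by
  have hdim : 0 < m.dim := by rcases hm with rfl | rfl <;> exact Nat.one_pos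
  have hwt : ∀ k, m.wt k = 0 := by rcases hm with rfl | rfl <;> exact fun _ => rfl
  let k : Fin m.dim := ⟨0, hdim⟩
  let σ : (Fin m.dim → ℂ) →ₗ[ℂ] M := (LinearMap.proj k).smulRight x
  have hσ : ∀ v, σ v = v k • x := fun _ => rfl
  refine ⟨σ, k, equivariant_of_generators _ σ ?_ ?_, hσ⟩
  · intro i v
    rw [hσ, hσ, Irr.rep_r_apply, hwt, zero_mul, zpw_zero, one_mul, smul_algebra_smul_comm, hr]
  · intro v
    rw [hσ, hσ, Irr.rep_s_apply, Irr.eq_of_one_dim hm (m.flip k) k, smul_algebra_smul_comm, hs,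
      smul_smul, mul_comm]

theorem mem_traceSub_of_weight {l : Irr n} {D : Set (Irr n)} {d : ℤ} (hd : 0 < d)
    {x : (projMod ζ l).carrier} (hx : x ∈ (projMod ζ l).gr d) (hn : Odd n) {j : ℕ} (h0 : 0 < j)
    (hj : j < n) (hD : chiIdx hn j h0 hj ∈ D)
    (hr : ∀ i, (gAct (DihedralGroup.r i) : SkewAlg n ζ) • x = zpw ζ (j * i) • x) :
    x ∈ traceSub ζ l D := by
  by_cases h2 : j ≤ (n - 1) / 2
  · rw [chiIdx, dif_pos h2] at hD
    obtain ⟨σ, hσ, hσx, hU⟩ := exists_equivariant_chi h0 h2 hr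
    rw [← hσx]
    exact mem_traceSub_of_equivariant hD hd hσ
      (hU _ hx (gAct_smul_mem_gr (projMod ζ l) _ hx)) _
  -- For j > C the representation is χ_{n-j}. The vector s x has weight -j = n - j, so the argument
  -- applies to s x, and a second application of s returns x.
  · rw [chiIdx, dif_neg h2] at hD
    have hc : ∀ i, (DihedralGroup.r i : DihedralGroup n) * DihedralGroup.sr 0 =
        DihedralGroup.sr 0 * DihedralGroup.r (-i) := by simp
    have hr' : ∀ i, (gAct (DihedralGroup.r i) : SkewAlg n ζ) •
        ((gAct (DihedralGroup.sr 0) : SkewAlg n ζ) • x) =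
        zpw ζ ((n - j : ℕ) * i) • ((gAct (DihedralGroup.sr 0) : SkewAlg n ζ) • x) := by
      intro i
      rw [← mul_smul, ← gAct_mul, hc, gAct_mul, mul_smul, hr, smul_algebra_smul_comm,
        Nat.cast_sub hj.le, ZMod.natCast_self, zero_sub, mul_neg, neg_mul]
    obtain ⟨σ, hσ, hσx, hU⟩ := exists_equivariant_chi _ _ hr'
    have h3 := mem_traceSub_of_equivariant hD hd hσ
      (hU _ (gAct_smul_mem_gr (projMod ζ l) _ hx)
        (gAct_smul_mem_gr (projMod ζ l) _ (gAct_smul_mem_gr (projMod ζ l) _ hx)))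
      (Pi.single (Irr.pos _ _ _) 1)
    rw [hσx] at h3
    have h4 := (traceSub ζ l D).smul_mem (gAct (DihedralGroup.sr 0) : SkewAlg n ζ) h3
    rwa [← mul_smul, ← gAct_mul, DihedralGroup.sr_mul_self, gAct_one, one_smul] at h4

theorem mem_traceSub_of_one_dim {l : Irr n} {D : Set (Irr n)} {d : ℤ} (hd : 0 < d)
    {x : (projMod ζ l).carrier} (hx : x ∈ (projMod ζ l).gr d) {m : Irr n}
    (hm : m = .triv ∨ m = .sgn) (hD : m ∈ D)
    (hr : ∀ i, (gAct (DihedralGroup.r i) : SkewAlg n ζ) • x = x)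
    (hs : (gAct (DihedralGroup.sr 0) : SkewAlg n ζ) • x = m.sign • x) :
    x ∈ traceSub ζ l D := by
  obtain ⟨σ, k, hσ, hσx⟩ := exists_equivariant_one_dim hm hr hs
  have h1 := mem_traceSub_of_equivariant hD hd hσ
    (fun v => by rw [hσx]; exact Submodule.smul_mem _ _ hx) (Pi.single k 1)
  rwa [hσx, Pi.single_eq_same, one_smul] at h1

theorem mem_of_single_mem {m : Irr n} {M : Type} [AddCommGroup M] [Module ℂ M]
    {σ : (Fin m.dim → ℂ) →ₗ[ℂ] M} {U : Submodule ℂ M} (h : ∀ k, σ (Pi.single k 1) ∈ U)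
    (v : Fin m.dim → ℂ) : σ v ∈ U := by
  have h1 : U.mkQ ∘ₗ σ = 0 := linearMap_eq_zero_of_single fun k => by
    rw [LinearMap.comp_apply, Submodule.mkQ_apply, Submodule.Quotient.mk_eq_zero]
    exact h k
  have h2 := LinearMap.congr_fun h1 v
  rwa [LinearMap.comp_apply, Submodule.mkQ_apply, LinearMap.zero_apply,
    Submodule.Quotient.mk_eq_zero] at h2

/-! ### The submodule of elements of positive degree -/

theorem coef_pY_zero (l : Irr n) (a : ℕ) (k : Fin l.dim) (x : (projMod ζ l).carrier) :
    coef l a 0 k ((pAct pY : SkewAlg n ζ) • x) = 0 := by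
  rw [pAct_pY, mul_smul, mul_smul, coef_s, coef_pX_zero, mul_zero]

theorem coef_pY_succ (l : Irr n) (a b : ℕ) (k : Fin l.dim) (x : (projMod ζ l).carrier) :
    coef l a (b + 1) k ((pAct pY : SkewAlg n ζ) • x) = coef l a b k x := by
  have hs : l.sign * l.sign = 1 := by rcases l with _ | _ | _ <;> simp [Irr.sign]
  rw [pAct_pY, mul_smul, mul_smul, coef_s, coef_pX_succ, coef_s, Irr.flip_flip, ← mul_assoc, hs,
    one_mul]

variable (ζ) in
/-- The elements of `P_l` without component in degree `0`. -/
def augSub (l : Irr n) : Submodule (SkewAlg n ζ) (projMod ζ l).carrier :=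
  stableSubmodule (⨅ k, LinearMap.ker (coef l 0 0 k))
    (fun x _ => by simp [coef_pX_zero])
    (fun i x hx => by
      simp only [Submodule.mem_iInf, LinearMap.mem_ker] at hx ⊢
      intro k; rw [coef_r, hx, mul_zero])
    (fun x hx => by
      simp only [Submodule.mem_iInf, LinearMap.mem_ker] at hx ⊢
      intro k; rw [coef_s, hx, mul_zero])

theorem mem_augSub {l : Irr n} {x : (projMod ζ l).carrier} :
    x ∈ augSub ζ l ↔ ∀ k, coef l 0 0 k x = 0 := by
  change x ∈ (⨅ k, LinearMap.ker (coef (ζ := ζ) l 0 0 k)) ↔ _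
  simp only [Submodule.mem_iInf, LinearMap.mem_ker]

theorem traceSub_le_augSub (l : Irr n) (D : Set (Irr n)) : traceSub ζ l D ≤ augSub ζ l :=
  traceSub_le fun _ _ _ hd _ _ hgr v => mem_augSub.2 fun _ => coef_of_mem l (by omega) (hgr v)

theorem bas_mem_of_pX_bas_mem {l : Irr n} {U : Submodule (SkewAlg n ζ) (projMod ζ l).carrier}
    {k : Fin l.dim} (h : bas l 1 0 k ∈ U) {a : ℕ} (ha : a ≠ 0) (b : ℕ) : bas l a b k ∈ U := by
  have h1 := U.smul_mem (pAct (mono (a - 1) b)) h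
  rwa [mono_smul_bas, Nat.sub_add_cancel (by omega), add_zero] at h1

theorem bas_mem_of_flip {l : Irr n} {U : Submodule (SkewAlg n ζ) (projMod ζ l).carrier}
    {k : Fin l.dim} {a b : ℕ} (h : bas l b a (l.flip k) ∈ U) : bas l a b k ∈ U := by
  have hs : l.sign * l.sign = 1 := by rcases l with _ | _ | _ <;> simp [Irr.sign]
  have h1 : l.sign • (gAct (DihedralGroup.sr 0) : SkewAlg n ζ) • bas (ζ := ζ) l b a (l.flip k) ∈
      U.restrictScalars ℂ :=
    Submodule.smul_mem _ _ (U.smul_mem _ h)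
  rwa [s_smul_bas, smul_smul, hs, one_smul, Irr.flip_flip] at h1

/-- The positive part is generated by degree one, and s exchanges the Y e_k with the X e_k up to
sign. -/
theorem augSub_le {l : Irr n} {U : Submodule (SkewAlg n ζ) (projMod ζ l).carrier}
    (h : ∀ k, bas l 1 0 k ∈ U) : augSub ζ l ≤ U := by
  intro x hx
  -- Removing the degree-zero part is a linear map that sends every basis vector into U, and it
  -- fixes x.
  have h1 := linearMap_mem_of_bas (LinearMap.id - ∑ k, (coef l 0 0 k).smulRight (bas l 0 0 k))
    (U.restrictScalars ℂ) (fun a b k => by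
      simp only [LinearMap.sub_apply, LinearMap.id_apply, LinearMap.sum_apply,
        LinearMap.smulRight_apply, coef_bas]
      by_cases ha : a = 0
      · by_cases hb : b = 0
        · subst ha; subst hb; simp
        · simp only [hb, false_and, and_false, if_false, zero_smul, Finset.sum_const_zero, sub_zero]
          exact bas_mem_of_flip (bas_mem_of_pX_bas_mem (h _) hb a)
      · simp only [ha, false_and, if_false, zero_smul, Finset.sum_const_zero, sub_zero]
        exact bas_mem_of_pX_bas_mem (h k) ha b) x
  rw [mem_augSub] at hx
  simpa [hx] using h1

theorem traceSub_eq_augSub {l : Irr n} {D : Set (Irr n)}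
    (h : ∀ k, bas l 1 0 k ∈ traceSub ζ l D) : traceSub ζ l D = augSub ζ l :=
  le_antisymm (traceSub_le_augSub l D) (augSub_le h)

theorem pX_bas_mem_traceSub {l : Irr n} {D : Set (Irr n)} (hn : Odd n) {j : ℕ} (h0 : 0 < j)
    (hj : j < n) (hD : chiIdx hn j h0 hj ∈ D) {k : Fin l.dim} (hk : 1 + l.wt k = j) :
    bas l 1 0 k ∈ traceSub ζ l D := by
  refine mem_traceSub_of_weight (d := 1) one_pos (bas_mem l 1 0 k) hn h0 hj hD fun i => ?_
  rw [r_smul_bas, ← hk, Nat.cast_one, Nat.cast_zero, sub_zero]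

theorem traceSub_triv_eq_augSub {D : Set (Irr n)} (hn : Odd n) (h1 : 1 < n)
    (hD : chiIdx hn 1 one_pos h1 ∈ D) : traceSub ζ .triv D = augSub ζ .triv :=
  traceSub_eq_augSub fun _ => pX_bas_mem_traceSub hn one_pos h1 hD (by simp [Irr.wt])

theorem traceSub_sgn_eq_augSub {D : Set (Irr n)} (hn : Odd n) (h1 : 1 < n)
    (hD : chiIdx hn 1 one_pos h1 ∈ D) : traceSub ζ .sgn D = augSub ζ .sgn :=
  traceSub_eq_augSub fun _ => pX_bas_mem_traceSub hn one_pos h1 hD (by simp [Irr.wt])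

/-! ### Trace submodules of P_{χ_i}: when they are the whole positive part. -/

section Chi

variable {i : ℕ} {h1 : 1 ≤ i} {h2 : i ≤ (n - 1) / 2}

theorem pX_bas_pos_mem_traceSub {D : Set (Irr n)} (hn : Odd n) (hi : i + 1 < n)
    (hD : chiIdx hn (i + 1) i.succ_pos hi ∈ D) :
    bas (.chi i h1 h2) 1 0 (Irr.pos i h1 h2) ∈ traceSub ζ (.chi i h1 h2) D :=
  pX_bas_mem_traceSub hn _ _ hD (by rw [Irr.wt_pos, add_comm, Nat.cast_succ])

/-- Here S_1 ⊗ χ_i = χ_{i+1} ⊕ χ_{i-1}: X b⁺ has weight i + 1, Y b⁺ has weight i - 1, and s supplies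
the other two basis vectors. -/
theorem traceSub_chi_eq_augSub {D : Set (Irr n)} (hn : Odd n) (hi : i + 1 < n) (hi2 : 2 ≤ i)
    (hD : chiIdx hn (i + 1) i.succ_pos hi ∈ D)
    (hD' : chiIdx hn (i - 1) (by omega) (by omega) ∈ D) :
    traceSub ζ (.chi i h1 h2) D = augSub ζ (.chi i h1 h2) := by
  refine traceSub_eq_augSub (Irr.forall_chi (pX_bas_pos_mem_traceSub hn hi hD) ?_)
  refine bas_mem_of_flip ?_
  rw [Irr.flip_neg]
  refine mem_traceSub_of_weight (d := 1) one_pos (bas_mem (.chi i h1 h2) 0 1 _) hn _ _ hD'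
    fun t => ?_
  rw [r_smul_bas, Irr.wt_pos, Nat.cast_sub (by omega)]
  congr 2
  push_cast
  ring

/-- Both terms have weight 0 and s exchanges them, so their difference spans a copy of sgn, and
their sum a copy of triv. -/
theorem antisymm_bas_mem_traceSub {D : Set (Irr n)} (hD : .sgn ∈ D) :
    bas (.chi i h1 h2) i 0 (Irr.neg i h1 h2) - bas (.chi i h1 h2) 0 i (Irr.pos i h1 h2) ∈
      traceSub ζ (.chi i h1 h2) D := by
  refine mem_traceSub_of_one_dim (d := i) (by omega) ?_ (Or.inr rfl) hD (fun t => ?_) ?_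
  · exact sub_mem (bas_mem (.chi i h1 h2) i 0 _) (by
      have := bas_mem (ζ := ζ) (.chi i h1 h2) 0 i (Irr.pos i h1 h2)
      rwa [zero_add] at this)
  · rw [smul_sub, r_smul_bas, r_smul_bas, Irr.wt_pos, Irr.wt_neg]
    simp [zpw_zero]
  · rw [smul_sub, s_smul_bas, s_smul_bas, Irr.flip_pos, Irr.flip_neg, Irr.sign_chi]
    simp [Irr.sign]

theorem symm_bas_r (t : ZMod n) : (gAct (DihedralGroup.r t) : SkewAlg n ζ) •
    (bas (ζ := ζ) (.chi i h1 h2) i 0 (Irr.neg i h1 h2) +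
      bas (ζ := ζ) (.chi i h1 h2) 0 i (Irr.pos i h1 h2)) =
    bas (.chi i h1 h2) i 0 (Irr.neg i h1 h2) + bas (.chi i h1 h2) 0 i (Irr.pos i h1 h2) := by
  rw [smul_add, r_smul_bas, r_smul_bas, Irr.wt_pos, Irr.wt_neg]
  simp [zpw_zero]

theorem symm_bas_s : (gAct (DihedralGroup.sr 0) : SkewAlg n ζ) •
    (bas (ζ := ζ) (.chi i h1 h2) i 0 (Irr.neg i h1 h2) +
      bas (ζ := ζ) (.chi i h1 h2) 0 i (Irr.pos i h1 h2)) =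
    (Irr.triv : Irr n).sign •
    (bas (.chi i h1 h2) i 0 (Irr.neg i h1 h2) + bas (.chi i h1 h2) 0 i (Irr.pos i h1 h2)) := by
  rw [smul_add, s_smul_bas, s_smul_bas, Irr.flip_pos, Irr.flip_neg, Irr.sign_chi]
  simp [Irr.sign, add_comm]

theorem symm_bas_mem_gr :
    bas (ζ := ζ) (.chi i h1 h2) i 0 (Irr.neg i h1 h2) +
      bas (.chi i h1 h2) 0 i (Irr.pos i h1 h2) ∈ (projMod ζ (.chi i h1 h2)).gr i :=
  add_mem (bas_mem (.chi i h1 h2) i 0 _) (by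
    have := bas_mem (ζ := ζ) (.chi i h1 h2) 0 i (Irr.pos i h1 h2)
    rwa [zero_add] at this)

/-- Here S_1 ⊗ χ_1 = χ_2 ⊕ triv ⊕ sgn, and X b⁻ is half the sum of the vectors spanning triv and
sgn. -/
theorem traceSub_chi_one_eq_augSub {h1 : 1 ≤ 1} {h2 : 1 ≤ (n - 1) / 2} {D : Set (Irr n)}
    (hn : Odd n) (hi : 2 < n) (hD : chiIdx hn 2 two_pos hi ∈ D) (ht : .triv ∈ D)
    (hs : .sgn ∈ D) : traceSub ζ (.chi 1 h1 h2) D = augSub ζ (.chi 1 h1 h2) := by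
  refine traceSub_eq_augSub (Irr.forall_chi (pX_bas_pos_mem_traceSub hn hi hD) ?_)
  have e1 := antisymm_bas_mem_traceSub (ζ := ζ) (h1 := h1) (h2 := h2) hs
  have e2 := mem_traceSub_of_one_dim (d := (1 : ℕ)) (by omega) symm_bas_mem_gr (Or.inl rfl) ht
    (symm_bas_r (ζ := ζ) (h1 := h1) (h2 := h2)) symm_bas_s
  have e3 : (2⁻¹ : ℂ) • (bas (.chi 1 h1 h2) 1 0 (Irr.neg 1 h1 h2) -
      bas (.chi 1 h1 h2) 0 1 (Irr.pos 1 h1 h2) + (bas (.chi 1 h1 h2) 1 0 (Irr.neg 1 h1 h2) +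
      bas (.chi 1 h1 h2) 0 1 (Irr.pos 1 h1 h2))) ∈
      (traceSub ζ (.chi 1 h1 h2) D).restrictScalars ℂ :=
    Submodule.smul_mem _ _ (add_mem e1 e2)
  rwa [sub_add_add_cancel, ← two_smul ℂ, smul_smul, inv_mul_cancel₀ two_ne_zero, one_smul] at e3

/-! ### The trace submodules of the uniserial quotients of `P_{χ_i}` -/

variable (ζ h1 h2) in
/-- The submodule of `P_{χ_i}` generated by `X b⁺`, `Y b⁻` and `X ^ i b⁻ - Y ^ i b⁺`. -/
def chiSub : Submodule (SkewAlg n ζ) (projMod ζ (.chi i h1 h2)).carrier :=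
  stableSubmodule
    ((⨅ a : Fin i, LinearMap.ker (coef (.chi i h1 h2) a 0 (Irr.neg i h1 h2))) ⊓
      (⨅ a : Fin i, LinearMap.ker (coef (.chi i h1 h2) 0 a (Irr.pos i h1 h2))) ⊓
      LinearMap.ker (coef (.chi i h1 h2) i 0 (Irr.neg i h1 h2) +
        coef (.chi i h1 h2) 0 i (Irr.pos i h1 h2)))
    (fun x hx => by
      simp only [Submodule.mem_inf, Submodule.mem_iInf, LinearMap.mem_ker, LinearMap.add_apply,
        Fin.forall_iff] at hx ⊢
      -- The range includes a = i: the coefficient of X^i b⁻ in X x is that of X^(i-1) b⁻ in x,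
      -- which vanishes. This also gives the equation linking the two coefficients of degree i.
      have key : ∀ a < i + 1,
          coef (.chi i h1 h2) a 0 (Irr.neg i h1 h2) ((pAct pX : SkewAlg n ζ) • x) = 0 := by
        intro a ha
        cases a with
        | zero => exact coef_pX_zero _ _ _ _
        | succ a => rw [coef_pX_succ]; exact hx.1.1 a (by omega)
      refine ⟨⟨fun a ha => key a (by omega), fun a ha => coef_pX_zero _ _ _ _⟩, ?_⟩
      rw [key i (by omega), coef_pX_zero, add_zero])
    (fun t x hx => by
      simp only [Submodule.mem_inf, Submodule.mem_iInf, LinearMap.mem_ker, LinearMap.add_apply,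
        Fin.forall_iff, coef_r, Irr.wt_pos, Irr.wt_neg] at hx ⊢
      refine ⟨⟨fun a ha => by rw [hx.1.1 a ha, mul_zero],
        fun a ha => by rw [hx.1.2 a ha, mul_zero]⟩, ?_⟩
      simpa [zpw_zero] using hx.2)
    (fun x hx => by
      simp only [Submodule.mem_inf, Submodule.mem_iInf, LinearMap.mem_ker, LinearMap.add_apply,
        Fin.forall_iff, coef_s, Irr.flip_pos, Irr.flip_neg, Irr.sign_chi, one_mul] at hx ⊢
      exact ⟨⟨hx.1.2, hx.1.1⟩, by rw [add_comm]; exact hx.2⟩)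

theorem mem_chiSub {x : (projMod ζ (.chi i h1 h2)).carrier} : x ∈ chiSub ζ h1 h2 ↔
    (∀ a < i, coef (.chi i h1 h2) a 0 (Irr.neg i h1 h2) x = 0) ∧
    (∀ a < i, coef (.chi i h1 h2) 0 a (Irr.pos i h1 h2) x = 0) ∧
    coef (.chi i h1 h2) i 0 (Irr.neg i h1 h2) x +
        coef (.chi i h1 h2) 0 i (Irr.pos i h1 h2) x = 0 := by
  change x ∈ ((⨅ a : Fin i, LinearMap.ker (coef (ζ := ζ) (.chi i h1 h2) a 0 (Irr.neg i h1 h2))) ⊓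
      (⨅ a : Fin i, LinearMap.ker (coef (ζ := ζ) (.chi i h1 h2) 0 a (Irr.pos i h1 h2))) ⊓
      LinearMap.ker (coef (ζ := ζ) (.chi i h1 h2) i 0 (Irr.neg i h1 h2) +
        coef (.chi i h1 h2) 0 i (Irr.pos i h1 h2))) ↔ _
  simp only [Submodule.mem_inf, Submodule.mem_iInf, LinearMap.mem_ker, LinearMap.add_apply,
    Fin.forall_iff, and_assoc]

/-- Modulo U every basis vector vanishes except X^a b⁻ and Y^a b⁺ with a ≤ i, and the equations of
`chiSub` leave only a multiple of X^i b⁻ - Y^i b⁺. -/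
theorem chiSub_le {U : Submodule (SkewAlg n ζ) (projMod ζ (.chi i h1 h2)).carrier}
    (hU : bas (.chi i h1 h2) 1 0 (Irr.pos i h1 h2) ∈ U)
    (hU' : bas (.chi i h1 h2) i 0 (Irr.neg i h1 h2) -
      bas (.chi i h1 h2) 0 i (Irr.pos i h1 h2) ∈ U) : chiSub ζ h1 h2 ≤ U := by
  have hp : ∀ a b, a ≠ 0 → bas (.chi i h1 h2) a b (Irr.pos i h1 h2) ∈ U := fun a b ha =>
    bas_mem_of_pX_bas_mem hU ha b
  have hm : ∀ a b, b ≠ 0 → bas (.chi i h1 h2) a b (Irr.neg i h1 h2) ∈ U := fun a b hb =>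
    bas_mem_of_flip (hp b a hb)
  -- Multiplying X^i b⁻ - Y^i b⁺ by Y^(b-i) gives X^i Y^(b-i) b⁻ - Y^b b⁺, whose first term lies in
  -- U because b - i > 0.
  have hp' : ∀ b, i < b → bas (.chi i h1 h2) 0 b (Irr.pos i h1 h2) ∈ U := by
    intro b hb
    have e := U.smul_mem (pAct (mono 0 (b - i))) hU'
    rw [smul_sub, mono_smul_bas, mono_smul_bas, Nat.sub_add_cancel hb.le] at e
    have e2 := U.sub_mem (hm (0 + i) (b - i + 0) (by omega)) e
    rwa [sub_sub_cancel] at e2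
  have hm' : ∀ a, i < a → bas (.chi i h1 h2) a 0 (Irr.neg i h1 h2) ∈ U := fun a ha =>
    bas_mem_of_flip (hp' a ha)
  intro x hx
  have key := linearMap_mem_of_bas (LinearMap.id -
      ∑ a ∈ Finset.range (i + 1), (coef (.chi i h1 h2) a 0 (Irr.neg i h1 h2)).smulRight
        (bas (.chi i h1 h2) a 0 (Irr.neg i h1 h2)) -
      ∑ a ∈ Finset.range (i + 1), (coef (.chi i h1 h2) 0 a (Irr.pos i h1 h2)).smulRight
        (bas (.chi i h1 h2) 0 a (Irr.pos i h1 h2)))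
    (U.restrictScalars ℂ) (fun a b => by
      simp only [LinearMap.sub_apply, LinearMap.id_apply, LinearMap.sum_apply,
        LinearMap.smulRight_apply, coef_bas]
      refine Irr.forall_chi ?_ ?_
      · simp only [Irr.pos_ne_neg, and_false, if_false, zero_smul, Finset.sum_const_zero, sub_zero,
          and_true]
        by_cases ha : a = 0
        · by_cases hb : b < i + 1
          · subst ha
            simp [Finset.sum_ite_eq, ite_smul, hb]
          · subst ha
            simp only [true_and, ite_smul, one_smul, zero_smul, Finset.sum_ite_eq,
              Finset.mem_range, hb, if_false, sub_zero]
            exact hp' b (by omega)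
        · simp only [ha, false_and, if_false, zero_smul, Finset.sum_const_zero, sub_zero]
          exact hp a b ha
      · simp only [Irr.pos_ne_neg.symm, and_false, if_false, zero_smul, Finset.sum_const_zero,
          sub_zero, and_true]
        by_cases hb : b = 0
        · by_cases ha : a < i + 1
          · subst hb
            simp [Finset.sum_ite_eq, ite_smul, ha]
          · subst hb
            simp only [and_true, ite_smul, one_smul, zero_smul, Finset.sum_ite_eq,
              Finset.mem_range, ha, if_false, sub_zero]
            exact hm' a (by omega)
        · simp only [hb, and_false, if_false, zero_smul, Finset.sum_const_zero, sub_zero]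
          exact hm a b hb) x
  -- The coefficients with a < i vanish and the two with a = i are opposite, so both sums collapse
  -- to a multiple of the second generator.
  rw [mem_chiSub] at hx
  obtain ⟨x1, x2, x3⟩ := hx
  simp only [LinearMap.sub_apply, LinearMap.id_apply, LinearMap.sum_apply,
    LinearMap.smulRight_apply] at key
  rw [Finset.sum_range_succ, Finset.sum_range_succ, Finset.sum_eq_zero (fun a ha => by rw [x1 a (Finset.mem_range.1 ha), zero_smul]),
    Finset.sum_eq_zero (fun a ha => by rw [x2 a (Finset.mem_range.1 ha), zero_smul]), zero_add,
    zero_add, eq_neg_of_add_eq_zero_right x3, neg_smul, sub_neg_eq_add, sub_add, ← smul_sub] at key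
  have e := add_mem key ((U.restrictScalars ℂ).smul_mem
    (coef (.chi i h1 h2) i 0 (Irr.neg i h1 h2) x) hU')
  rwa [sub_add_cancel] at e

theorem natCast_inj_of_lt {a b : ℕ} (ha : a < n) (hb : b < n) (h : (a : ZMod n) = b) : a = b := by
  rw [ZMod.natCast_eq_natCast_iff] at h
  exact Nat.ModEq.eq_of_lt_of_lt h ha hb

/-- The argument compares weights: X^a b⁻ has weight a - i, and Y^a b⁺ the opposite. Weight 0 with a
≤ i forces a = i, where the sign of s gives the last equation. Weight ±j with j ≥ i and 0 < a ≤ i is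
impossible, since i + j < n excludes a ≡ i + j and a + j > i excludes a + j ≡ i. -/
theorem traceSub_le_chiSub (hζ : IsPrimitiveRoot ((ζ : ℂˣ) : ℂ) n) {D : Set (Irr n)}
    (hD : ∀ m ∈ D, m = .sgn ∨ ∃ j h1 h2, i ≤ j ∧ m = .chi j h1 h2) :
    traceSub ζ (.chi i h1 h2) D ≤ chiSub ζ h1 h2 := by
  refine traceSub_le fun m hm d hd σ hσ hgr v => ?_
  refine mem_of_single_mem (U := (chiSub ζ h1 h2).restrictScalars ℂ) (fun k => ?_) v
  change σ _ ∈ chiSub ζ h1 h2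
  have hwt1 : ∀ a, coef (.chi i h1 h2) a 0 (Irr.neg i h1 h2) (σ (Pi.single k 1)) ≠ 0 →
      a ≠ 0 ∧ (a : ZMod n) = m.wt k + i := by
    intro a ha
    constructor
    · rintro rfl
      exact ha (coef_of_mem _ (by omega) (hgr _))
    · have e := wt_eq_of_coef_ne_zero hζ hσ ha
      rw [Irr.wt_neg, Nat.cast_zero, sub_zero] at e
      rw [← e]; ring
  have hwt2 : ∀ a, coef (.chi i h1 h2) 0 a (Irr.pos i h1 h2) (σ (Pi.single k 1)) ≠ 0 →
      a ≠ 0 ∧ (a : ZMod n) = -m.wt k + i := by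
    intro a ha
    constructor
    · rintro rfl
      exact ha (coef_of_mem _ (by omega) (hgr _))
    · have e := wt_eq_of_coef_ne_zero hζ hσ ha
      rw [Irr.wt_pos, Nat.cast_zero] at e
      rw [← e]; ring
  rw [mem_chiSub]
  rcases hD m hm with rfl | ⟨j, hj1, hj2, hij, rfl⟩
  · have hw : ∀ a < i, (a : ZMod n) ≠ i := fun a ha e =>
      ha.ne (natCast_inj_of_lt (by omega) (by omega) e)
    have hwk : (Irr.sgn : Irr n).wt k = 0 := rfl
    refine ⟨fun a ha => ?_, fun a ha => ?_, ?_⟩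
    · by_contra hne
      exact hw a ha (by simpa [hwk] using (hwt1 a hne).2)
    · by_contra hne
      exact hw a ha (by simpa [hwk] using (hwt2 a hne).2)
    · have e := congrArg (coef (.chi i h1 h2) i 0 (Irr.neg i h1 h2)) (hσ.s_smul k)
      rw [coef_s, Irr.flip_neg, Irr.sign_chi, one_mul, map_smul] at e
      have hf : (Irr.sgn : Irr n).flip k = k := rfl
      have hs : (Irr.sgn : Irr n).sign = -1 := rfl
      rw [hf, hs, neg_one_smul] at e
      rw [e, add_neg_cancel]
  · have hw1 : ∀ a ≤ i, a ≠ 0 → (a : ZMod n) ≠ j + i := by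
      intro a ha ha0 e
      have := natCast_inj_of_lt (n := n) (a := a) (b := j + i) (by omega) (by omega)
        (by push_cast; exact e)
      omega
    have hw2 : ∀ a ≤ i, a ≠ 0 → (a : ZMod n) ≠ -j + i := by
      intro a ha ha0 e
      have := natCast_inj_of_lt (n := n) (a := a + j) (b := i) (by omega) (by omega)
        (by push_cast; rw [e]; ring)
      omega
    have hk : (Irr.chi j hj1 hj2).wt k = j ∨ (Irr.chi j hj1 hj2).wt k = -j := by
      refine Irr.forall_chi (P := fun k => (Irr.chi j hj1 hj2).wt k = j ∨
        (Irr.chi j hj1 hj2).wt k = -j) (Or.inl rfl) (Or.inr rfl) k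
    have z1 : ∀ a ≤ i, coef (.chi i h1 h2) a 0 (Irr.neg i h1 h2) (σ (Pi.single k 1)) = 0 := by
      intro a ha
      by_contra hne
      obtain ⟨e0, e⟩ := hwt1 a hne
      rcases hk with hk | hk <;> rw [hk] at e
      · exact hw1 a ha e0 e
      · exact hw2 a ha e0 e
    have z2 : ∀ a ≤ i, coef (.chi i h1 h2) 0 a (Irr.pos i h1 h2) (σ (Pi.single k 1)) = 0 := by
      intro a ha
      by_contra hne
      obtain ⟨e0, e⟩ := hwt2 a hne
      rcases hk with hk | hk <;> rw [hk] at e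
      · exact hw2 a ha e0 e
      · rw [neg_neg] at e; exact hw1 a ha e0 e
    exact ⟨fun a ha => z1 a ha.le, fun a ha => z2 a ha.le,
      by rw [z1 i le_rfl, z2 i le_rfl, add_zero]⟩

theorem traceSub_eq_chiSub (hζ : IsPrimitiveRoot ((ζ : ℂˣ) : ℂ) n) {D : Set (Irr n)} (hn : Odd n)
    (hi : i + 1 < n) (hD : chiIdx hn (i + 1) i.succ_pos hi ∈ D) (hs : .sgn ∈ D)
    (hD' : ∀ m ∈ D, m = .sgn ∨ ∃ j h1 h2, i ≤ j ∧ m = .chi j h1 h2) :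
    traceSub ζ (.chi i h1 h2) D = chiSub ζ h1 h2 :=
  le_antisymm (traceSub_le_chiSub hζ hD')
    (chiSub_le (pX_bas_pos_mem_traceSub hn hi hD) (antisymm_bas_mem_traceSub hs))

end Chi

/-! ### The coinvariant algebra twisted by the sign -/

variable (ζ) in
/-- The submodule of `P_sgn` generated by `X Y` and `X ^ n + Y ^ n`. -/
def sgnSub [NeZero n] : Submodule (SkewAlg n ζ) (projMod ζ (.sgn : Irr n)).carrier :=
  stableSubmodule
    ((⨅ a, ⨅ _ : a < n, ⨅ k, LinearMap.ker (coef .sgn a 0 k)) ⊓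
      (⨅ a, ⨅ _ : a < n, ⨅ k, LinearMap.ker (coef .sgn 0 a k)) ⊓
      ⨅ k, LinearMap.ker (coef .sgn n 0 k - coef .sgn 0 n k))
    (fun x hx => by
      simp only [Submodule.mem_inf, Submodule.mem_iInf, LinearMap.mem_ker, LinearMap.sub_apply] at hx ⊢
      have key : ∀ a < n + 1, ∀ k, coef .sgn a 0 k ((pAct pX : SkewAlg n ζ) • x) = 0 := by
        intro a ha k
        cases a with
        | zero => exact coef_pX_zero _ _ _ _
        | succ a => rw [coef_pX_succ]; exact hx.1.1 a (by omega) k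
      refine ⟨⟨fun a ha k => key a (by omega) k, fun a ha k => coef_pX_zero _ _ _ _⟩, fun k => ?_⟩
      rw [key n (by omega), coef_pX_zero, sub_zero])
    (fun t x hx => by
      simp only [Submodule.mem_inf, Submodule.mem_iInf, LinearMap.mem_ker, LinearMap.sub_apply,
        coef_r] at hx ⊢
      refine ⟨⟨fun a ha k => by rw [hx.1.1 a ha, mul_zero],
        fun a ha k => by rw [hx.1.2 a ha, mul_zero]⟩, fun k => ?_⟩
      simpa [zpw_zero, Irr.wt] using hx.2 k)
    (fun x hx => by
      simp only [Submodule.mem_inf, Submodule.mem_iInf, LinearMap.mem_ker, LinearMap.sub_apply,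
        coef_s] at hx ⊢
      refine ⟨⟨fun a ha k => by rw [hx.1.2 a ha, mul_zero],
        fun a ha k => by rw [hx.1.1 a ha, mul_zero]⟩, fun k => ?_⟩
      have e := hx.2 ((Irr.sgn : Irr n).flip k)
      rw [← mul_sub, ← neg_sub, e, neg_zero, mul_zero])

theorem mem_sgnSub [NeZero n] {x : (projMod ζ (.sgn : Irr n)).carrier} : x ∈ sgnSub ζ ↔
    (∀ a < n, ∀ k, coef .sgn a 0 k x = 0) ∧ (∀ a < n, ∀ k, coef .sgn 0 a k x = 0) ∧
    ∀ k, coef .sgn n 0 k x - coef .sgn 0 n k x = 0 := by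
  change x ∈ ((⨅ a, ⨅ _ : a < n, ⨅ k, LinearMap.ker (coef (ζ := ζ) .sgn a 0 k)) ⊓
      (⨅ a, ⨅ _ : a < n, ⨅ k, LinearMap.ker (coef (ζ := ζ) .sgn 0 a k)) ⊓
      ⨅ k, LinearMap.ker (coef (ζ := ζ) .sgn n 0 k - coef .sgn 0 n k)) ↔ _
  simp only [Submodule.mem_inf, Submodule.mem_iInf, LinearMap.mem_ker, LinearMap.sub_apply,
    and_assoc]

/-- For 0 < a < n the powers X^a and Y^a have nonzero weight, and in degree n an element of type sgn
in P_sgn has equal coefficients at X^n and Y^n. This inclusion suffices, as it is used only to show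
that elements survive in K_sgn. -/
theorem traceSub_le_sgnSub [NeZero n] (hζ : IsPrimitiveRoot ((ζ : ℂˣ) : ℂ) n) :
    traceSub ζ .sgn {.sgn} ≤ sgnSub ζ := by
  refine traceSub_le fun m hm d hd σ hσ hgr v => ?_
  obtain rfl : m = .sgn := hm
  refine mem_of_single_mem (U := (sgnSub ζ).restrictScalars ℂ) (fun k => ?_) v
  change σ _ ∈ sgnSub ζ
  have hn : n ≠ 0 := NeZero.ne n
  have hw : ∀ a < n, a ≠ 0 → (a : ZMod n) ≠ 0 := fun a ha ha0 e =>
    ha0 (natCast_inj_of_lt (n := n) ha (by omega) (by rw [e, Nat.cast_zero]))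
  rw [mem_sgnSub]
  refine ⟨fun a ha j => ?_, fun a ha j => ?_, fun j => ?_⟩
  · by_contra hne
    refine hw a ha ?_ (by simpa [Irr.wt] using wt_eq_of_coef_ne_zero hζ hσ hne)
    rintro rfl
    exact hne (coef_of_mem _ (by omega) (hgr _))
  · by_contra hne
    refine hw a ha ?_ (by simpa [Irr.wt] using wt_eq_of_coef_ne_zero hζ hσ hne)
    rintro rfl
    exact hne (coef_of_mem _ (by omega) (hgr _))
  · have e := congrArg (coef .sgn n 0 j) (hσ.s_smul k)
    have hf : ∀ k, (Irr.sgn : Irr n).flip k = k := fun _ => rfl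
    have hs : (Irr.sgn : Irr n).sign = -1 := rfl
    rw [coef_s, map_smul, hf, hf, hs, smul_eq_mul] at e
    linear_combination e

/-! ### Nonvanishing extensions -/

/-- The relation `Ext¹_A(K_a, L_b) ≠ 0`, whose reflexive transitive closure is `≾_K`. -/
def ExtRel (K : Irr n → GrMod n ζ) (a b : Irr n) : Prop :=
  Nontrivial (CategoryTheory.Abelian.Ext (ModuleCat.of (SkewAlg n ζ) (K a).carrier)
    (ModuleCat.of (SkewAlg n ζ) (simpleMod ζ b).carrier) 1)

variable {K : Irr n → GrMod n ζ}

/-- The trace submodule lies in positive degree, so its products with X and Y have no component in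
degree one, and a degree-one coefficient is a functional killing them. -/
theorem extRel_chi {a : Irr n} {D : Set (Irr n)} (hK : (K a).Iso (traceQuot ζ a D)) {c d : ℕ}
    (hcd : c + d = 1) {k : Fin a.dim} {j : ℕ} (h1 : 1 ≤ j) (h2 : j ≤ (n - 1) / 2)
    (hw : (c : ZMod n) - d + a.wt k = j) (hb : bas a c d k ∈ traceSub ζ a D) :
    ExtRel K a (.chi j h1 h2) := by
  have haug : ∀ x ∈ traceSub ζ a D, coef a 0 0 k x = 0 := fun x hx =>
    mem_augSub.1 (traceSub_le_augSub a D hx) k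
  refine nontrivial_ext_chi hK h1 h2 (coef a c d k) (fun i x => ?_) (fun x hx => ?_)
    (fun x hx => ?_) hb (mem_augSub.1 (traceSub_le_augSub a D hb)) ?_
  · rw [coef_r, hw]
  · obtain ⟨rfl, rfl⟩ | ⟨rfl, rfl⟩ : (c = 0 ∧ d = 1) ∨ (c = 1 ∧ d = 0) := by omega
    · exact coef_pX_zero _ _ _ _
    · rw [coef_pX_succ, haug x hx]
  · obtain ⟨rfl, rfl⟩ | ⟨rfl, rfl⟩ : (c = 0 ∧ d = 1) ∨ (c = 1 ∧ d = 0) := by omega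
    · rw [coef_pY_succ, haug x hx]
    · exact coef_pY_zero _ _ _ _
  · simp [coef_bas]

theorem extRel_chi_one {a : Irr n} {D : Set (Irr n)} (hK : (K a).Iso (traceQuot ζ a D))
    (hD : traceSub ζ a D = augSub ζ a) {k : Fin a.dim} (hk : a.wt k = 0)
    (h2 : 1 ≤ (n - 1) / 2) : ExtRel K a (.chi 1 le_rfl h2) := by
  refine extRel_chi hK (c := 1) (d := 0) rfl (k := k) _ _ (by simp [hk]) ?_
  rw [hD, mem_augSub]
  intro k'
  simp [coef_bas]

section Chi

variable {i : ℕ} {h1 : 1 ≤ i} {h2 : i ≤ (n - 1) / 2}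

theorem coef_neg_antisymm :
    (coef (ζ := ζ) (.chi i h1 h2) i 0 (Irr.neg i h1 h2) -
      coef (.chi i h1 h2) 0 i (Irr.pos i h1 h2) : (projMod ζ (.chi i h1 h2)).carrier →ₗ[ℂ] ℂ)
      (bas (.chi i h1 h2) i 0 (Irr.neg i h1 h2) - bas (.chi i h1 h2) 0 i (Irr.pos i h1 h2)) =
      2 := by
  simp only [LinearMap.sub_apply, map_sub, coef_bas, Irr.pos_ne_neg, Irr.pos_ne_neg.symm]
  norm_num

theorem coef_symm :
    (coef (ζ := ζ) (.chi i h1 h2) i 0 (Irr.neg i h1 h2) +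
      coef (.chi i h1 h2) 0 i (Irr.pos i h1 h2) : (projMod ζ (.chi i h1 h2)).carrier →ₗ[ℂ] ℂ)
      (bas (.chi i h1 h2) i 0 (Irr.neg i h1 h2) + bas (.chi i h1 h2) 0 i (Irr.pos i h1 h2)) =
      2 := by
  simp only [LinearMap.add_apply, map_add, coef_bas, Irr.pos_ne_neg, Irr.pos_ne_neg.symm]
  norm_num

/-- The hypothesis `hlow` makes the antisymmetric functional kill X I, since X raises X^(i-1) b⁻ to
X^i b⁻. It holds for i = 1 because I has positive degree, and for tall χ_i by the equations of
`chiSub`. -/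
theorem extRel_sgn {D : Set (Irr n)}
    (hK : (K (.chi i h1 h2)).Iso (traceQuot ζ (.chi i h1 h2) D)) (hD : .sgn ∈ D)
    (hlow : ∀ x ∈ traceSub ζ (.chi i h1 h2) D,
      coef (.chi i h1 h2) (i - 1) 0 (Irr.neg i h1 h2) x = 0) :
    ExtRel K (.chi i h1 h2) .sgn := by
  have hx := antisymm_bas_mem_traceSub (ζ := ζ) (h1 := h1) (h2 := h2) hD
  refine nontrivial_ext_one_dim hK (Or.inr rfl)
    (coef (.chi i h1 h2) i 0 (Irr.neg i h1 h2) - coef (.chi i h1 h2) 0 i (Irr.pos i h1 h2))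
    (fun t x => ?_) (fun x => ?_) (fun x hx => ?_) hx
    (mem_augSub.1 (traceSub_le_augSub _ D hx)) ?_
  · rw [LinearMap.sub_apply, coef_r, coef_r, Irr.wt_pos, Irr.wt_neg]
    simp [zpw_zero]
  · rw [LinearMap.sub_apply, coef_s, coef_s, Irr.flip_pos, Irr.flip_neg, Irr.sign_chi]
    simp [Irr.sign]
  · have e := coef_pX_succ (.chi i h1 h2) (i - 1) 0 (Irr.neg i h1 h2) x
    rw [Nat.sub_add_cancel h1, hlow x hx] at e
    rw [LinearMap.sub_apply, e, coef_pX_zero, sub_zero]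
  · rw [coef_neg_antisymm]
    exact two_ne_zero

theorem extRel_triv {h1 : 1 ≤ 1} {h2 : 1 ≤ (n - 1) / 2} {D : Set (Irr n)}
    (hK : (K (.chi 1 h1 h2)).Iso (traceQuot ζ (.chi 1 h1 h2) D))
    (hD : traceSub ζ (.chi 1 h1 h2) D = augSub ζ (.chi 1 h1 h2)) :
    ExtRel K (.chi 1 h1 h2) .triv := by
  have hx : bas (.chi 1 h1 h2) 1 0 (Irr.neg 1 h1 h2) + bas (.chi 1 h1 h2) 0 1 (Irr.pos 1 h1 h2) ∈
      traceSub ζ (.chi 1 h1 h2) D := by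
    rw [hD, mem_augSub]
    intro k
    simp [coef_bas]
  refine nontrivial_ext_one_dim hK (Or.inl rfl)
    (coef (.chi 1 h1 h2) 1 0 (Irr.neg 1 h1 h2) + coef (.chi 1 h1 h2) 0 1 (Irr.pos 1 h1 h2))
    (fun t x => ?_) (fun x => ?_) (fun x hx => ?_) hx
    (mem_augSub.1 (traceSub_le_augSub _ D hx)) ?_
  · rw [LinearMap.add_apply, coef_r, coef_r, Irr.wt_pos, Irr.wt_neg]
    simp [zpw_zero]
  · rw [LinearMap.add_apply, coef_s, coef_s, Irr.flip_pos, Irr.flip_neg, Irr.sign_chi]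
    simp [Irr.sign, add_comm]
  · rw [LinearMap.add_apply, coef_pX_succ, coef_pX_zero,
      mem_augSub.1 (traceSub_le_augSub _ D hx), add_zero]
  · rw [coef_symm]
    exact two_ne_zero

/-! ### Nonzero multiplicities -/

/-- The vector Y^(i-j) b⁺ has weight j and exponent below i, so it violates an equation of `chiSub`
and survives in the quotient. -/
theorem gradedMult_chi_ne_zero (hζ : IsPrimitiveRoot ((ζ : ℂˣ) : ℂ) n) {D : Set (Irr n)}
    (hK : (K (.chi i h1 h2)).Iso (traceQuot ζ (.chi i h1 h2) D))
    (hD : ∀ m ∈ D, m = .sgn ∨ ∃ j h1 h2, i ≤ j ∧ m = .chi j h1 h2) {j : ℕ} (h1' : 1 ≤ j)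
    (h2' : j ≤ (n - 1) / 2) (hj : j ≤ i) :
    (K (.chi i h1 h2)).gradedMult (.chi j h1' h2') ≠ 0 := by
  obtain ⟨σ, hσ, hσx, hU⟩ := exists_equivariant_chi (ζ := ζ) h1' h2'
    (x := bas (.chi i h1 h2) 0 (i - j) (Irr.pos i h1 h2)) (fun t => by
      rw [r_smul_bas, Irr.wt_pos, Nat.cast_sub hj]
      congr 2
      push_cast
      ring)
  have hmem := bas_mem (ζ := ζ) (.chi i h1 h2) 0 (i - j) (Irr.pos i h1 h2)
  refine gradedMult_ne_zero_of_equivariant hK hσ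
    (hU _ hmem (gAct_smul_mem_gr (projMod ζ (.chi i h1 h2)) _ hmem))
    (v := Pi.single (Irr.pos _ _ _) 1) fun h => ?_
  rw [hσx] at h
  have e := (mem_chiSub.1 (traceSub_le_chiSub hζ hD h)).2.1 (i - j) (by omega)
  simp [coef_bas] at e

/-- The vector X^i b⁻ + Y^i b⁺ spans a copy of triv, and its two coefficients add up to 2 instead of
0. -/
theorem gradedMult_triv_ne_zero (hζ : IsPrimitiveRoot ((ζ : ℂˣ) : ℂ) n) {D : Set (Irr n)}
    (hK : (K (.chi i h1 h2)).Iso (traceQuot ζ (.chi i h1 h2) D))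
    (hD : ∀ m ∈ D, m = .sgn ∨ ∃ j h1 h2, i ≤ j ∧ m = .chi j h1 h2) :
    (K (.chi i h1 h2)).gradedMult .triv ≠ 0 := by
  obtain ⟨σ, k, hσ, hσx⟩ := exists_equivariant_one_dim (Or.inl rfl)
    (symm_bas_r (ζ := ζ) (h1 := h1) (h2 := h2)) symm_bas_s
  refine gradedMult_ne_zero_of_equivariant hK hσ (i := i)
    (fun v => by rw [hσx]; exact Submodule.smul_mem _ _ symm_bas_mem_gr)
    (v := Pi.single k 1) fun h => ?_
  rw [hσx, Pi.single_eq_same, one_smul] at h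
  have e := (mem_chiSub.1 (traceSub_le_chiSub hζ hD h)).2.2
  rw [← LinearMap.add_apply, coef_symm] at e
  exact two_ne_zero e

end Chi

/-- In P_sgn the vector X^j has weight j, and X^n - Y^n spans a copy of triv because the twist by
sgn cancels the sign of s. Neither satisfies the equations of `sgnSub`. -/
theorem gradedMult_sgn_ne_zero [NeZero n] (hζ : IsPrimitiveRoot ((ζ : ℂˣ) : ℂ) n)
    (hK : (K .sgn).Iso (traceQuot ζ .sgn {.sgn})) {m : Irr n} (hm : m ≠ .sgn) :
    (K .sgn).gradedMult m ≠ 0 := by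
  have hn : n ≠ 0 := NeZero.ne n
  let k : Fin (Irr.sgn : Irr n).dim := (0 : Fin 1)
  rcases m with _ | _ | ⟨j, h1, h2⟩
  · have hmem : bas (ζ := ζ) (.sgn : Irr n) n 0 k - bas (.sgn : Irr n) 0 n k ∈
        (projMod ζ (.sgn : Irr n)).gr n := by
      refine sub_mem (bas_mem (.sgn : Irr n) n 0 k) ?_
      have := bas_mem (ζ := ζ) (.sgn : Irr n) 0 n k
      rwa [zero_add] at this
    have hf : (Irr.sgn : Irr n).flip k = k := rfl
    have hw : (Irr.sgn : Irr n).wt k = 0 := rfl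
    obtain ⟨σ, k', hσ, hσx⟩ := exists_equivariant_one_dim (m := (.triv : Irr n)) (ζ := ζ)
      (Or.inl rfl) (x := bas (ζ := ζ) (.sgn : Irr n) n 0 k - bas (ζ := ζ) (.sgn : Irr n) 0 n k)
      (fun t => by
        rw [smul_sub, r_smul_bas, r_smul_bas, hw]
        simp [zpw_zero])
      (by
        rw [smul_sub, s_smul_bas, s_smul_bas, hf]
        simp [Irr.sign, neg_add_eq_sub])
    refine gradedMult_ne_zero_of_equivariant hK hσ (i := n)
      (fun v => by rw [hσx]; exact Submodule.smul_mem _ _ hmem)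
      (v := Pi.single k' 1) fun h => ?_
    rw [hσx, Pi.single_eq_same, one_smul] at h
    have e := (mem_sgnSub.1 (traceSub_le_sgnSub hζ h)).2.2 k
    simp only [map_sub, coef_bas, hn, hn.symm, and_self, false_and, if_false, if_true]
      at e
    norm_num at e
  · exact absurd rfl hm
  · obtain ⟨σ, hσ, hσx, hU⟩ := exists_equivariant_chi (ζ := ζ) h1 h2
      (x := bas (ζ := ζ) (.sgn : Irr n) j 0 k) (fun t => by
        rw [r_smul_bas]
        simp [Irr.wt])
    have hmem := bas_mem (ζ := ζ) (.sgn : Irr n) j 0 k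
    refine gradedMult_ne_zero_of_equivariant hK hσ
      (hU _ hmem (gAct_smul_mem_gr (projMod ζ .sgn) _ hmem))
      (v := Pi.single (Irr.pos _ _ _) 1) fun h => ?_
    rw [hσx] at h
    have e := (mem_sgnSub.1 (traceSub_le_sgnSub hζ h)).1 j (by omega) k
    simp [coef_bas] at e

/-! ### The order of the representations -/

/-- A common description of the two kinds of families: `T` is the set of the indices `i` for which
`K_{χ_i}` is not simple, and `t` tells whether `K_sgn` is the twisted coinvariant algebra. -/
structure IsFamily (hn : Odd n) (_h3 : 3 ≤ n) (K : Irr n → GrMod n ζ) (T : Set ℕ) (t : Prop) :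
    Prop where
  triv : ∀ h, (K .triv).Iso (traceQuot ζ .triv {chiIdx hn 1 one_pos h})
  sgn_small : ∀ h, ¬ t → (K .sgn).Iso (traceQuot ζ .sgn {chiIdx hn 1 one_pos h})
  sgn_tall : t → (K .sgn).Iso (traceQuot ζ .sgn {.sgn})
  tall : ∀ i ∈ T, t
  chi_one : ∀ h1 hC h2, 1 ∉ T → (K (.chi 1 h1 hC)).Iso (traceQuot ζ (.chi 1 h1 hC)
    {.triv, .sgn, chiIdx hn 2 two_pos h2})
  chi_small : ∀ i, 2 ≤ i → ∀ (h1 : 1 ≤ i) (h0 : 0 < i - 1) (hC : i ≤ (n - 1) / 2)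
    (hi' : i - 1 < n) (hi : i + 1 < n), i ∉ T →
    (K (.chi i h1 hC)).Iso (traceQuot ζ (.chi i h1 hC)
      {chiIdx hn (i - 1) h0 hi', chiIdx hn (i + 1) i.succ_pos hi})
  chi_tall : ∀ i, ∀ (h1 : 1 ≤ i) (hC : i ≤ (n - 1) / 2) (hi : i + 1 < n), i ∈ T →
    (K (.chi i h1 hC)).Iso (traceQuot ζ (.chi i h1 hC)
      {.sgn, chiIdx hn (i + 1) i.succ_pos hi})

theorem chiIdx_of_le (hn : Odd n) {k : ℕ} (h0 : 0 < k) (hk : k < n) (h : k ≤ (n - 1) / 2) :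
    chiIdx hn k h0 hk = .chi k h0 h := dif_pos h

theorem isFamily_of_isFirstFamily {hn : Odd n} {h3 : 3 ≤ n} (h : IsFirstFamily hn h3 K) :
    IsFamily hn h3 K ∅ False := by
  obtain ⟨ht, hs, h1, hi⟩ := h
  rw [chiIdx_of_le hn (k := 1) _ _ (by omega)] at h1
  refine ⟨fun _ => ht, fun _ _ => hs, False.elim, fun _ => False.elim, fun _ _ _ _ => h1,
    fun i h2 _ _ hC _ _ _ => ?_, fun _ _ _ _ => False.elim⟩
  have e := hi i h2 hC
  rwa [chiIdx_of_le hn (k := i) _ _ hC] at e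

/-- The indices `i` for which `K_{χ_i} = F_{χ_i}^{sgn, χ_{i+1}}`. -/
def tallSet (hn : Odd n) (K : Irr n → GrMod n ζ) : Set ℕ :=
  {i | ∀ (h1 : 1 ≤ i) (hC : i ≤ (n - 1) / 2) (hi : i + 1 < n), (K (.chi i h1 hC)).Iso
    (traceQuot ζ (.chi i h1 hC) {.sgn, chiIdx hn (i + 1) i.succ_pos hi})}

/-- Taking for T all indices where the tall isomorphism holds makes the other alternative hold off
T. Indices outside 1, …, C belong to T vacuously, which is harmless because `chi_tall` carries the
bounds on i. -/
theorem isFamily_of_isSecondFamily {hn : Odd n} {h3 : 3 ≤ n} (h : IsSecondFamily hn h3 K) :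
    IsFamily hn h3 K (tallSet hn K) True := by
  obtain ⟨ht, hs, h1, hi⟩ := h
  rw [chiIdx_of_le hn (k := 1) _ _ (by omega)] at h1
  refine ⟨fun _ => ht, fun _ h => absurd trivial h, fun _ => hs, fun _ _ => trivial,
    fun _ _ _ h => ?_, fun i h2 _ _ hC _ _ h => ?_, fun i h1 hC hi h => h h1 hC hi⟩
  · exact h1.resolve_right fun h' => h fun _ _ _ => h'
  · have e := hi i h2 hC
    rw [chiIdx_of_le hn (k := i) _ _ hC] at e
    exact e.resolve_right fun h' => h fun _ _ _ => h'

theorem traceSub_chi_one (ζ : rootsOfUnity n ℂ) (hn : Odd n) (h3 : 3 ≤ n) :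
    traceSub ζ (.chi 1 le_rfl (by omega)) {.triv, .sgn, chiIdx hn 2 (by omega) (by omega)} =
      augSub ζ (.chi 1 le_rfl (by omega)) :=
  traceSub_chi_one_eq_augSub hn (by omega) (Or.inr (Or.inr rfl)) (Or.inl rfl) (Or.inr (Or.inl rfl))

namespace IsFamily

variable {hn : Odd n} {h3 : 3 ≤ n} {T : Set ℕ} {t : Prop}

theorem chi_tall_subset {i : ℕ} (h1 : 1 ≤ i) (hi : i + 1 < n) (hC : i ≤ (n - 1) / 2) :
    ∀ m ∈ ({.sgn, chiIdx hn (i + 1) (by omega) hi} : Set (Irr n)),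
      m = .sgn ∨ ∃ j h1 h2, i ≤ j ∧ m = .chi j h1 h2 := by
  rintro m (rfl | rfl)
  · exact Or.inl rfl
  · right
    by_cases h : i + 1 ≤ (n - 1) / 2
    · exact ⟨i + 1, by omega, h, by omega, dif_pos h⟩
    -- Here i = C, and χ_{C+1} is χ_{n-C-1} = χ_C since n = 2C + 1.
    · have hodd := hn
      obtain ⟨k, hk⟩ := hodd
      exact ⟨n - (i + 1), by omega, by omega, by omega, dif_neg h⟩

/-! ### Chains of nonzero extensions, and part (a). -/

theorem prec_of_extRel {a b : Irr n} (h : ExtRel K a b) : precK K a b :=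
  Relation.ReflTransGen.single h

theorem prec_triv_chi_one (h : IsFamily hn h3 K T t) :
    precK K .triv (.chi 1 le_rfl (by omega)) :=
  prec_of_extRel (extRel_chi_one (h.triv (by omega))
    (traceSub_triv_eq_augSub hn (by omega) (Set.mem_singleton _)) (k := (0 : Fin 1)) rfl _)

theorem prec_sgn_chi_one (h : IsFamily hn h3 K T t) (ht : ¬ t) :
    precK K .sgn (.chi 1 le_rfl (by omega)) :=
  prec_of_extRel (extRel_chi_one (h.sgn_small (by omega) ht)
    (traceSub_sgn_eq_augSub hn (by omega) (Set.mem_singleton _)) (k := (0 : Fin 1)) rfl _)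

theorem exists_iso_chi (h : IsFamily hn h3 K T t) {i : ℕ} (h1 : 1 ≤ i) (hC : i ≤ (n - 1) / 2) :
    ∃ D, chiIdx hn (i + 1) (by omega) (by omega) ∈ D ∧
      (K (.chi i h1 hC)).Iso (traceQuot ζ (.chi i h1 hC) D) := by
  by_cases hT : i ∈ T
  · exact ⟨_, Or.inr rfl, h.chi_tall i h1 hC (by omega) hT⟩
  · by_cases hi : i = 1
    · subst hi
      exact ⟨_, Or.inr (Or.inr rfl), h.chi_one le_rfl (by omega) (by omega) hT⟩
    · exact ⟨_, Or.inr rfl, h.chi_small i (by omega) (by omega) (by omega) hC (by omega) (by omega) hT⟩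

theorem prec_chi_succ (h : IsFamily hn h3 K T t) {i : ℕ} (h1 : 1 ≤ i)
    (hC : i + 1 ≤ (n - 1) / 2) :
    precK K (.chi i h1 (by omega)) (.chi (i + 1) (by omega) hC) := by
  obtain ⟨D, hD, hK⟩ := h.exists_iso_chi h1 (i.le_succ.trans hC)
  refine prec_of_extRel (extRel_chi hK (c := 1) (d := 0) rfl (k := Irr.pos _ _ _) _ _ ?_
    (pX_bas_pos_mem_traceSub hn (by omega) hD))
  rw [Irr.wt_pos]
  push_cast
  ring

theorem prec_chi_of_le (h : IsFamily hn h3 K T t) {i j : ℕ} (h1 : 1 ≤ i) (hij : i ≤ j)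
    (hC : j ≤ (n - 1) / 2) :
    precK K (.chi i h1 (hij.trans hC)) (.chi j (h1.trans hij) hC) := by
  induction j, hij using Nat.le_induction with
  | base => exact Relation.ReflTransGen.refl
  | succ j hij ih =>
    exact (ih (by omega)).trans (h.prec_chi_succ (h1.trans hij) hC)

theorem prec_chi_chiIdx (h : IsFamily hn h3 K T t) {i : ℕ} (h1 : 1 ≤ i)
    (hC : i ≤ (n - 1) / 2) :
    precK K (.chi i h1 hC) (chiIdx hn (i + 1) (by omega) (by omega)) := by
  by_cases h2 : i + 1 ≤ (n - 1) / 2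
  · rw [chiIdx_of_le hn _ _ h2]
    exact h.prec_chi_succ h1 h2
  · rw [chiIdx, dif_neg h2]
    exact h.prec_chi_of_le h1 (by obtain ⟨m, rfl⟩ := hn; omega)
      (by obtain ⟨m, rfl⟩ := hn; omega)

theorem prec_chi_one_triv (h : IsFamily hn h3 K T t) (hT : 1 ∉ T) :
    precK K (.chi 1 le_rfl (by omega)) .triv :=
  prec_of_extRel (extRel_triv (h.chi_one le_rfl (by omega) (by omega) hT) (traceSub_chi_one ζ hn h3))

theorem prec_chi_sgn_of_mem (h : IsFamily hn h3 K T t) (hζ : IsPrimitiveRoot ((ζ : ℂˣ) : ℂ) n)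
    {i : ℕ} (h1 : 1 ≤ i) (hC : i ≤ (n - 1) / 2) (hT : i ∈ T) :
    precK K (.chi i h1 hC) .sgn :=
  prec_of_extRel (extRel_sgn (h.chi_tall i h1 hC (by omega) hT) (Or.inl rfl) fun _ hx =>
    (mem_chiSub.1 (traceSub_le_chiSub hζ (chi_tall_subset h1 (by omega) hC) hx)).1 (i - 1) (by omega))

theorem prec_chi_one_sgn (h : IsFamily hn h3 K T t) (hζ : IsPrimitiveRoot ((ζ : ℂˣ) : ℂ) n) :
    precK K (.chi 1 le_rfl (by omega)) .sgn := by
  by_cases hT : 1 ∈ T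
  · exact h.prec_chi_sgn_of_mem hζ _ _ hT
  · exact prec_of_extRel (extRel_sgn (h.chi_one le_rfl (by omega) (by omega) hT) (Or.inr (Or.inl rfl)) fun x hx =>
      mem_augSub.1 (traceSub_le_augSub _ _ hx) _)

theorem prec_chi_pred (h : IsFamily hn h3 K T t) {i : ℕ} (h2 : 2 ≤ i)
    (hC : i ≤ (n - 1) / 2) (hT : i ∉ T) :
    precK K (.chi i (by omega) hC) (.chi (i - 1) (by omega) (by omega)) := by
  refine prec_of_extRel (extRel_chi (h.chi_small i h2 (by omega) (by omega) hC (by omega) (by omega) hT) (c := 0) (d := 1) rfl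
    (k := Irr.pos _ _ _) _ _ ?_ ?_)
  · rw [Irr.wt_pos, Nat.cast_sub (by omega)]
    push_cast
    ring
  · rw [traceSub_chi_eq_augSub hn (by omega) h2 (Or.inr rfl) (Or.inl rfl), mem_augSub]
    intro k
    simp [coef_bas]

theorem prec_triv (h : IsFamily hn h3 K T t) (hζ : IsPrimitiveRoot ((ζ : ℂˣ) : ℂ) n) (m : Irr n) :
    precK K .triv m := by
  rcases m with _ | _ | ⟨j, h1, h2⟩
  · exact Relation.ReflTransGen.refl
  · exact h.prec_triv_chi_one.trans (h.prec_chi_one_sgn hζ)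
  · exact h.prec_triv_chi_one.trans (h.prec_chi_of_le le_rfl h1 h2)

/-- As long as K_{χ_i} is simple there is a step down to χ_{i-1}, and from χ_1 to triv. The descent
is stopped only by a tall index. -/
theorem prec_chi_triv_or (h : IsFamily hn h3 K T t) {i : ℕ} (h1 : 1 ≤ i)
    (hC : i ≤ (n - 1) / 2) :
    precK K (.chi i h1 hC) .triv ∨ ∃ (s : ℕ) (hs1 : 1 ≤ s) (hsi : s ≤ i), s ∈ T ∧
      precK K (.chi i h1 hC) (.chi s hs1 (hsi.trans hC)) := by
  induction i, h1 using Nat.le_induction with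
  | base =>
    by_cases hT : 1 ∈ T
    · exact Or.inr ⟨1, le_rfl, le_rfl, hT, Relation.ReflTransGen.refl⟩
    · exact Or.inl (h.prec_chi_one_triv hT)
  | succ i h1 ih =>
    by_cases hT : i + 1 ∈ T
    · exact Or.inr ⟨i + 1, by omega, le_rfl, hT, Relation.ReflTransGen.refl⟩
    · have e : precK K (.chi (i + 1) (by omega) hC) (.chi i h1 (by omega)) :=
        h.prec_chi_pred (by omega) hC hT
      rcases ih (by omega) with h4 | ⟨s, hs1, hsi, hsT, h4⟩
      · exact Or.inl (e.trans h4)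
      · exact Or.inr ⟨s, hs1, by omega, hsT, e.trans h4⟩

theorem prec_chi_sgn (h : IsFamily hn h3 K T t) (hζ : IsPrimitiveRoot ((ζ : ℂˣ) : ℂ) n)
    {i : ℕ} (h1 : 1 ≤ i) (hC : i ≤ (n - 1) / 2) : precK K (.chi i h1 hC) .sgn := by
  rcases h.prec_chi_triv_or h1 hC with h4 | ⟨s, hs1, hsi, hsT, h4⟩
  · exact h4.trans (h.prec_triv hζ _)
  · exact h4.trans (h.prec_chi_sgn_of_mem hζ _ _ hsT)

/-- When l is not below everything, its class contains a tall module, which serves as K_{l'}: K_sgn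
itself, or K_{χ_s} for the tall s where the descent from χ_i stops. One can take m' = m, since the
representations missing above l are composition factors of that module. -/
theorem exists_gradedMult_ne_zero [NeZero n] (h : IsFamily hn h3 K T t)
    (hζ : IsPrimitiveRoot ((ζ : ℂˣ) : ℂ) n) {l m : Irr n} (hlm : ¬ precK K l m) :
    ∃ l' m' : Irr n, simK K l' l ∧ simK K m' m ∧ (K l').gradedMult m' ≠ 0 := by
  have hrefl : ∀ l, simK K l l := fun l =>
    ⟨Relation.ReflTransGen.refl, Relation.ReflTransGen.refl⟩
  rcases l with _ | _ | ⟨i, h1, h2⟩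
  · exact absurd (h.prec_triv hζ m) hlm
  · by_cases ht : t
    · refine ⟨.sgn, m, hrefl _, hrefl _, gradedMult_sgn_ne_zero hζ (h.sgn_tall ht) ?_⟩
      rintro rfl
      exact hlm Relation.ReflTransGen.refl
    · have hT : 1 ∉ T := fun h1 => ht (h.tall 1 h1)
      exact absurd (((h.prec_sgn_chi_one ht).trans (h.prec_chi_one_triv hT)).trans
        (h.prec_triv hζ m)) hlm
  · rcases h.prec_chi_triv_or h1 h2 with h4 | ⟨s, hs1, hsi, hsT, h4⟩
    · exact absurd (h4.trans (h.prec_triv hζ m)) hlm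
    · have hiso := h.chi_tall s hs1 (hsi.trans h2) (by omega) hsT
      refine ⟨.chi s hs1 (hsi.trans h2), m, ⟨h.prec_chi_of_le hs1 hsi h2, h4⟩, hrefl _, ?_⟩
      rcases m with _ | _ | ⟨j, hj1, hj2⟩
      · exact gradedMult_triv_ne_zero hζ hiso (chi_tall_subset hs1 (by omega) (hsi.trans h2))
      · exact absurd (h.prec_chi_sgn hζ h1 h2) hlm
      · refine gradedMult_chi_ne_zero hζ hiso (chi_tall_subset hs1 (by omega) (hsi.trans h2)) hj1 hj2 ?_
        by_contra! hsj
        exact hlm (h4.trans (h.prec_chi_of_le hs1 hsj.le hj2))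

theorem eq_sgn_of_prec [NeZero n] (h : IsFamily hn h3 K T t)
    (hζ : IsPrimitiveRoot ((ζ : ℂˣ) : ℂ) n) (ht : t) {m : Irr n} (hm : precK K .sgn m) :
    m = .sgn := by
  induction hm with
  | refl => rfl
  | tail _ hbc ih =>
    subst ih
    have e := mem_of_nontrivial_ext hζ (h.sgn_tall ht) hbc
    exact e

/-- For tall χ_i, the set of sgn and all χ_j with j ≥ i is closed under nonzero extensions: only
simple K_{χ_j} lead downwards, and only by one. -/
theorem eq_or_of_chi_prec [NeZero n] (h : IsFamily hn h3 K T t)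
    (hζ : IsPrimitiveRoot ((ζ : ℂˣ) : ℂ) n) {i : ℕ} (h1 : 1 ≤ i) (hC : i ≤ (n - 1) / 2)
    (hT : i ∈ T) {m : Irr n} (hm : precK K (.chi i h1 hC) m) :
    m = .sgn ∨ ∃ j h1 h2, i ≤ j ∧ m = .chi j h1 h2 := by
  induction hm with
  | refl => exact Or.inr ⟨i, h1, hC, le_rfl, rfl⟩
  | tail _ hbc ih =>
    rcases ih with rfl | ⟨j, hj1, hj2, hij, rfl⟩
    · have e := mem_of_nontrivial_ext hζ (h.sgn_tall (h.tall i hT)) hbc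
      exact Or.inl e
    · by_cases hjT : j ∈ T
      · have e := mem_of_nontrivial_ext hζ (h.chi_tall j hj1 hj2 (by omega) hjT) hbc
        rcases chi_tall_subset hj1 (by omega) hj2 _ e with e | ⟨k, hk1, hk2, hk, e⟩
        · exact Or.inl e
        · exact Or.inr ⟨k, hk1, hk2, hij.trans hk, e⟩
      -- As i is tall and j is not, j differs from i, so the step down to j - 1 stays at or above i.
      · have hlt : i < j := lt_of_le_of_ne hij (by rintro rfl; exact hjT hT)
        have e := mem_of_nontrivial_ext hζ (h.chi_small j (by omega) (by omega) (by omega) hj2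
          (by omega) (by omega) hjT) hbc
        rcases e with e | e
        · rw [chiIdx_of_le hn (k := j - 1) _ _ (by omega)] at e
          exact Or.inr ⟨j - 1, by omega, by omega, by omega, e⟩
        · rcases chi_tall_subset (hn := hn) hj1 (by omega) hj2 _ (Or.inr e) with e | ⟨k, hk1, hk2, hk, e⟩
          · exact Or.inl e
          · exact Or.inr ⟨k, hk1, hk2, hij.trans hk, e⟩

/-! ### Trace quotients of ≾_K and uniqueness of the preorder. -/

theorem traceSub_chi_tall (hζ : IsPrimitiveRoot ((ζ : ℂˣ) : ℂ) n) {i : ℕ} (h1 : 1 ≤ i)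
    (hi : i + 1 < n) (hC : i ≤ (n - 1) / 2) :
    traceSub ζ (.chi i h1 hC) {.sgn, chiIdx hn (i + 1) i.succ_pos hi} = chiSub ζ h1 hC :=
  traceSub_eq_chiSub hζ hn hi (Set.mem_insert_of_mem _ (Set.mem_singleton _))
    (Set.mem_insert _ _) (chi_tall_subset h1 hi hC)

theorem traceSub_precK_tall [NeZero n] (h : IsFamily hn h3 K T t)
    (hζ : IsPrimitiveRoot ((ζ : ℂˣ) : ℂ) n) {i : ℕ} (h1 : 1 ≤ i) (hC : i ≤ (n - 1) / 2)
    (hT : i ∈ T) : traceSub ζ (.chi i h1 hC) {m | precK K (.chi i h1 hC) m} = chiSub ζ h1 hC := by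
  have hi : i + 1 < n := by omega
  exact traceSub_eq_chiSub (D := {m | precK K (.chi i h1 hC) m}) hζ hn hi
    (h.prec_chi_chiIdx h1 hC) (h.prec_chi_sgn hζ h1 hC)
    (fun m hm => h.eq_or_of_chi_prec hζ h1 hC hT hm)

/-- It suffices to compare trace submodules: both are the positive part when K_l is simple, and both
are `chiSub` for tall χ_i. For tall sgn the sets D themselves agree. -/
theorem isTraceQuotient_precK [NeZero n] (h : IsFamily hn h3 K T t)
    (hζ : IsPrimitiveRoot ((ζ : ℂˣ) : ℂ) n) : IsTraceQuotient (precK K) K := by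
  have key : ∀ (l : Irr n) (D : Set (Irr n)), (K l).Iso (traceQuot ζ l D) →
      traceSub ζ l D = traceSub ζ l {m | precK K l m} →
      (K l).Iso (traceQuot ζ l {m | precK K l m}) := by
    intro l D hD e
    rwa [traceQuot_congr e] at hD
  have hone : chiIdx hn 1 one_pos (by omega) = .chi 1 le_rfl (by omega) :=
    chiIdx_of_le hn _ _ (by omega)
  intro l
  rcases l with _ | _ | ⟨i, h1, h2⟩
  · exact key _ _ (h.triv (by omega)) ((traceSub_triv_eq_augSub hn (by omega) (Set.mem_singleton _)).trans
      (traceSub_triv_eq_augSub (D := {m | precK K .triv m}) hn (by omega)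
        (h.prec_triv hζ _)).symm)
  · by_cases ht : t
    · have e : {m | precK K .sgn m} = ({.sgn} : Set (Irr n)) :=
        Set.ext fun m => ⟨h.eq_sgn_of_prec hζ ht, by rintro rfl; exact Relation.ReflTransGen.refl⟩
      rw [e]
      exact h.sgn_tall ht
    · refine key _ _ (h.sgn_small (by omega) ht)
        ((traceSub_sgn_eq_augSub hn (by omega) (Set.mem_singleton _)).trans
        (traceSub_sgn_eq_augSub (D := {m | precK K .sgn m}) hn (by omega) ?_).symm)
      rw [hone]
      exact h.prec_sgn_chi_one ht
  · by_cases hT : i ∈ T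
    · have hi : i + 1 < n := by omega
      exact key _ _ (h.chi_tall i h1 h2 hi hT)
        ((traceSub_chi_tall hζ h1 hi h2).trans (h.traceSub_precK_tall hζ h1 h2 hT).symm)
    · by_cases hi : i = 1
      · subst hi
        exact key _ _ (h.chi_one le_rfl (by omega) (by omega) hT) ((traceSub_chi_one ζ hn h3).trans
          (traceSub_chi_one_eq_augSub (D := {m | precK K (.chi 1 h1 h2) m}) hn (by omega)
            (h.prec_chi_chiIdx le_rfl h2) (h.prec_chi_one_triv hT) (h.prec_chi_one_sgn hζ)).symm)
      · refine key _ _ (h.chi_small i (by omega) (by omega) (by omega) h2 (by omega) (by omega) hT)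
          ((traceSub_chi_eq_augSub (D := {chiIdx hn (i - 1) (by omega) (by omega),
            chiIdx hn (i + 1) (by omega) (by omega)}) hn (by omega) (by omega)
            (Or.inr rfl) (Or.inl rfl)).trans
          (traceSub_chi_eq_augSub (D := {m | precK K (.chi i h1 h2) m}) hn (by omega) (by omega)
            (h.prec_chi_chiIdx h1 h2) ?_).symm)
        rw [chiIdx_of_le hn _ _ (by omega)]
        exact h.prec_chi_pred (by omega) h2 hT

/-- Ext¹ sees only representations in D, so R contains ≾_K. If R were larger at (l, m), part (a)
would provide m' in K_{l'} with R l' m'; the trace quotient then allows only m' = l', so l ≾_K m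
after all. -/
theorem eq_precK_of_isTraceQuotient [NeZero n] (h : IsFamily hn h3 K T t)
    (hζ : IsPrimitiveRoot ((ζ : ℂˣ) : ℂ) n) {R : Irr n → Irr n → Prop} [hR : IsPreorder (Irr n) R]
    (hRK : IsTraceQuotient R K) : R = precK K := by
  have hle : ∀ {l m}, precK K l m → R l m := by
    intro l m hlm
    induction hlm with
    | refl => exact refl_of R l
    | tail _ hbc ih => exact trans_of R ih (mem_of_nontrivial_ext hζ (hRK _) hbc)
  funext l m
  refine propext ⟨fun hlm => ?_, hle⟩
  by_contra hne
  obtain ⟨l', m', hl, hm, hmult⟩ := h.exists_gradedMult_ne_zero hζ hne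
  have h1 : R l' m' := trans_of R (trans_of R (hle hl.1) hlm) (hle hm.2)
  have h2 : m' = l' := eq_of_mult_ne_zero hζ (hRK l') h1 hmult
  subst h2
  exact hne (hl.2.trans hm.1)

end IsFamily

end

end DihedralSpringer

theorem mainTheorem7 {n : ℕ} (hn : Odd n) (h3 : 3 ≤ n) (ζ : rootsOfUnity n ℂ)
    (hζ : IsPrimitiveRoot ((ζ : ℂˣ) : ℂ) n) (K : Irr n → GrMod n ζ)
    (hK : IsFirstFamily hn h3 K ∨ IsSecondFamily hn h3 K) :
    (∀ l m : Irr n, ¬ precK K l m →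
      ∃ l' m' : Irr n, simK K l' l ∧ simK K m' m ∧ (K l').gradedMult m' ≠ 0) ∧
    IsPreorder (Irr n) (precK K) ∧
    ∀ R : Irr n → Irr n → Prop, IsPreorder (Irr n) R →
      (IsTraceQuotient R K ↔ R = precK K) := by
  have : NeZero n := ⟨by omega⟩
  obtain ⟨T, t, h⟩ : ∃ T t, IsFamily hn h3 K T t := by
    rcases hK with hK | hK
    · exact ⟨∅, False, isFamily_of_isFirstFamily hK⟩
    · exact ⟨_, True, isFamily_of_isSecondFamily hK⟩
  refine ⟨fun l m => h.exists_gradedMult_ne_zero hζ, ?_, fun R hR => ⟨fun hRK => ?_, ?_⟩⟩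
  · exact { refl := fun _ => Relation.ReflTransGen.refl
            trans := fun _ _ _ => Relation.ReflTransGen.trans }
  · exact h.eq_precK_of_isTraceQuotient hζ hRK
  · rintro rfl
    exact h.isTraceQuotient_precK hζ
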